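/- **Definitions.** A triangulation of a finite planar point set $S$ is a dissection of its convex hull into non-degenerate triangles with vertices in $S$ and pairwise disjoint interiors, such that no triangle contains a point of $S$ (in its interior or on a side) other than its three vertices. For $k\ge 3$ and $r\ge 1$ let $\mathrm{SC}(k,r)$ be the set of $kr$ points consisting of the $k$ corners of a convex $k$-gon and of $r-1$ further points in the interior of each of its sides (for definiteness: a regular $k$-gon with evenly subdivided sides), and let $\mathsf{tr}(k,r)$ be the number of triangulations of $\mathrm{SC}(k,r)$. For $k\in\{1,2\}$ and $kr\ge 3$ let $\mathsf{tr}(k,r)$ be the number of triangulations of a convex $kr$-gon, with vertices labelled cyclically by $\mathbb Z/kr\mathbb Z$, that use no diagonal joining two vertices of a common string $\{ir,ir+1,\dots,(i+1)r\}$, $0\le i\le k-1$. **Proposition.** Let $k,r$ be positive integers with $rk\ge 3$ and $(k,r)\ne(1,3)$. 1. If $k\ge 3$, then the number of triangulations of the point set formed by the corners of an arbitrary convex $k$-gon and $r-1$ arbitrary distinct interior points on each of its sides equals $\mathsf{tr}(k,r)$, that is, it depends on $k$ and $r$ only. 2. We have $$\mathsf{tr}(k,r)=-\frac{1}{4\pi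 i}\int_{\mathcal C}\frac{\left((1-t)^{r+1}-t^{r+1}\right)^k}{t^{rk}(1-t)^{rk}(1-2t)^{k-2}}\,dt$$ for every closed contour $\mathcal C$ (continuous on $[0,1]$, differentiable off a finite set, with integrable derivative) in the punctured disc $0<|t|<\tfrac12$ that encircles $0$ once in positive direction, i.e. has winding number $1$ around $0$. 3. The integrand in this representation is invariant under the substitution $t\mapsto 1-t$. -/

import Mathlib

noncomputable section

namespace SubdividedPolygon

/-- The Euclidean plane. -/
abbrev Plane : Type := EuclideanSpace ℝ (Fin 2)

/-! ### Triangulations of planar point sets -/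

/-- `T`, a finite family of triangles (each given by its set of three vertices), is a
triangulation of the planar point set `S`: the triangles are nondegenerate, have their vertices
in `S`, contain no further point of `S` (neither inside nor on a side), have pairwise disjoint
interiors, and together fill the convex hull of `S`. -/
structure IsTriangulation (S : Set Plane) (T : Finset (Finset Plane)) : Prop where
  card_eq_three : ∀ t ∈ T, t.card = 3
  affineIndependent : ∀ t ∈ T, AffineIndependent ℝ ((↑) : t → Plane)
  vertices_subset : ∀ t ∈ T, (t : Set Plane) ⊆ S
  no_other_point : ∀ t ∈ T, ∀ p ∈ S, p ∈ convexHull ℝ (t : Set Plane) → p ∈ t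
  disjoint_interiors : ∀ t ∈ T, ∀ t' ∈ T, t ≠ t' →
    Disjoint (interior (convexHull ℝ (t : Set Plane))) (interior (convexHull ℝ (t' : Set Plane)))
  cover : ⋃ t ∈ T, convexHull ℝ (t : Set Plane) = convexHull ℝ S

/-- The number of triangulations of a planar point set. -/
def numTriangulations (S : Set Plane) : ℕ := {T | IsTriangulation S T}.ncard

/-! ### Subdivided convex polygons -/

/-- Twice the signed area of the triangle `a b c`; positive iff `a b c` is a left turn. -/
def signedArea (a b c : Plane) : ℝ :=
  (b 0 - a 0) * (c 1 - a 1) - (b 1 - a 1) * (c 0 - a 0)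

/-- `c 0, …, c (k-1)` are the corners of a strictly convex `k`-gon in counterclockwise order
(and `c k` is again the first corner). -/
def IsConvexPolygon (k : ℕ) (c : ℕ → Plane) : Prop :=
  c k = c 0 ∧ ∀ i j l : ℕ, i < j → j < l → l < k → 0 < signedArea (c i) (c j) (c l)

/-- `S` consists of the `k` corners `c i` of a convex `k`-gon together with `r - 1` further points
on each side: the side from `c i` to `c (i+1)` carries the points with
parameters `0 = s i 0 < s i 1 < ⋯ < s i r = 1`. -/
def IsSC (k r : ℕ) (S : Set Plane) : Prop :=
  ∃ (c : ℕ → Plane) (s : ℕ → ℕ → ℝ), IsConvexPolygon k c ∧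
    (∀ i < k, s i 0 = 0 ∧ s i r = 1 ∧ ∀ j < r, s i j < s i (j + 1)) ∧
    S = {p | ∃ i < k, ∃ j < r, p = AffineMap.lineMap (c i) (c (i + 1)) (s i j)}

/-- The `a`-th vertex of the regular `n`-gon inscribed in the unit circle (periodic in `a`). -/
def regularVertex (n a : ℕ) : Plane :=
  !₂[Real.cos (2 * Real.pi * a / n), Real.sin (2 * Real.pi * a / n)]

/-- The point set `SC(k,r)`: the regular `k`-gon, each side subdivided evenly by `r - 1` points. -/
def regularSC (k r : ℕ) : Set Plane :=
  {p | ∃ i < k, ∃ j < r,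
    p = AffineMap.lineMap (regularVertex k i) (regularVertex k (i + 1)) ((j : ℝ) / r)}

/-! ### The inflated polygon: `k * r` points in convex position -/

/-- The vertex set of the regular `n`-gon. -/
def regularPolygon (n : ℕ) : Set Plane := {p | ∃ a < n, p = regularVertex n a}

/-- The vertex with index `a` of the `(k * r)`-gon belongs to the `i`-th string, i.e. it is one of
the `r + 1` cyclically consecutive vertices with indices `i r, i r + 1, …, i r + r`. -/
def InString (k r i a : ℕ) : Prop := ∃ j ≤ r, a = (i * r + j) % (k * r)

/-- The vertices with indices `a` and `b` of the `(k * r)`-gon span a forbidden diagonal: they are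
distinct, not neighbours on the boundary, and belong to a common string. -/
def IsForbidden (k r a b : ℕ) : Prop :=
  a ≠ b ∧ (a + 1) % (k * r) ≠ b ∧ (b + 1) % (k * r) ≠ a ∧
    ∃ i < k, InString k r i a ∧ InString k r i b

/-- The number of triangulations of a convex `(k * r)`-gon that use no forbidden diagonal. -/
def numLegalTriangulations (k r : ℕ) : ℕ :=
  {T | IsTriangulation (regularPolygon (k * r)) T ∧
    ∀ a b : ℕ, IsForbidden k r a b →
      ∀ t ∈ T, ¬ (regularVertex (k * r) a ∈ t ∧ regularVertex (k * r) b ∈ t)}.ncard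

/-- `tr(k,r)`: the number of triangulations of `SC(k,r)` if `k ≥ 3`. For `k = 1, 2`, where there is
no `k`-gon, the number of triangulations of a convex `(k * r)`-gon without forbidden diagonals. -/
def tr (k r : ℕ) : ℕ :=
  if 3 ≤ k then numTriangulations (regularSC k r) else numLegalTriangulations k r

/-! ### Contour integrals -/

/-- `γ`, restricted to `[0,1]`, is a closed contour in `ℂ`: continuous, closed, and differentiable
off finitely many points with integrable derivative (e.g. piecewise continuously
differentiable). -/
structure IsContour (γ : ℝ → ℂ) : Prop where
  continuousOn : ContinuousOn γ (Set.Icc 0 1)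
  closed : γ 0 = γ 1
  differentiable : ∃ F : Finset ℝ, ∀ x ∈ Set.Ioo (0 : ℝ) 1, x ∉ F → DifferentiableAt ℝ γ x
  integrable : IntervalIntegrable (deriv γ) MeasureTheory.volume 0 1

/-- The contour integral of `f` along `γ`. -/
def contourIntegral (f : ℂ → ℂ) (γ : ℝ → ℂ) : ℂ := ∫ x in (0 : ℝ)..1, f (γ x) * deriv γ x

/-- `γ` is a contour inside the punctured disc `0 < |t| < 1/2` that encircles `0` once in positive
direction, i.e. has winding number `1` around `0`. -/
def EncirclesZeroOnce (γ : ℝ → ℂ) : Prop :=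
  IsContour γ ∧ (∀ x ∈ Set.Icc (0 : ℝ) 1, 0 < ‖γ x‖ ∧ ‖γ x‖ < 1 / 2) ∧
    1 / (2 * Real.pi * Complex.I) * contourIntegral (fun t => 1 / t) γ = 1

/-- The integrand `((1-t)^(r+1) - t^(r+1))^k / (t^(rk) (1-t)^(rk) (1-2t)^(k-2))`, with an integer
exponent `k - 2`. -/
def integrand (k r : ℕ) (t : ℂ) : ℂ :=
  ((1 - t) ^ (r + 1) - t ^ (r + 1)) ^ k /
    (t ^ (r * k) * (1 - t) ^ (r * k) * (1 - 2 * t) ^ ((k : ℤ) - 2))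

end SubdividedPolygon

end

noncomputable section

open scoped Classical

namespace SubdividedPolygon

/-! Number the points `1, …, k * r` along the boundary, where `k * r` is the corner `0`. The segment
from `k * r` to `1` is then a boundary edge, and every triangulation has a triangle on it. Removing
that triangle, with apex `l`, leaves independent triangulations of the points `1, …, l` and `l, …, k
* r`. Iterating this gives a Catalan-type recursion, `splitCount`, which only sees which pairs of
points lie on a common side. Hence the positions of the points are irrelevant, and the convex `(k *
r)`-gon without forbidden diagonals obeys the same recursion (`IsConvexChain.isLegal_iff_isSplit`,
`numTriangulations_of_isSC`, `numLegalTriangulations_eq`).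

To solve the recursion, let `W` be the element `stepWeight` of the incidence algebra of `ℕ`. Away
from the string that the numbering cuts open, the counts `S` satisfy `S = W + S * S`: two points at
distance two on a common string have count `0`, although the product contributes `1`, and the weight
`-1` cancels this. So `S` is the Catalan series `∑ catalan m • W ^ (m + 1)`
(`splitCount_eq_catalanSum`). Treating the cut string separately amounts to one more step from the
point `0`, so that the total count is the sum of `catalan m` times the entry of `W ^ (m + 2)` at
`(0, k * r)` (`splitCount_base_eq_sum`). The case `(k, r) = (1, 3)` fails here, because the base
chord itself is then a step of length two inside a string.

The generating function `∑ y ^ m * W ^ m` at `(0, k * r)` is a `k`-th power, since no step of length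
two passes a corner. Within a string it satisfies `f (a + 2) = y * (f (a + 1) - f a)`. For `y = 1 /
(t * (1 - t))` the characteristic roots are `1 / t` and `1 / (1 - t)`, which gives the closed form
`stringFactor`; after multiplication by `(1 - 2 * t) ^ 2` the integrand appears
(`integrand_eq_sum`). It remains to integrate termwise: the integral of `(1 - 2 * t) ^ 2 / (t * (1 -
t)) ^ (m + 2)` is `-4πi * catalan m` (`EncirclesZeroOnce.integral_eq_catalan`). -/

/-! ### Signed areas, convex hulls and triangles in the plane -/

theorem signedArea_rotate (a b c : Plane) : signedArea b c a = signedArea a b c := by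
  unfold signedArea; ring

theorem signedArea_swap (a b c : Plane) : signedArea a c b = -signedArea a b c := by
  unfold signedArea; ring

theorem signedArea_self_right (a b : Plane) : signedArea a b b = 0 := by
  unfold signedArea; ring

theorem signedArea_self_left (a b : Plane) : signedArea a a b = 0 := by
  unfold signedArea; ring

theorem signedArea_self_outer (a b : Plane) : signedArea a b a = 0 := by
  unfold signedArea; ring

/-- The signed area of `a b x` as an affine function of `x`. -/
def areaMap (a b : Plane) : Plane →ᵃ[ℝ] ℝ where
  toFun x := signedArea a b x
  linear :=
    { toFun := fun v => (b 0 - a 0) * v 1 - (b 1 - a 1) * v 0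
      map_add' := fun v w => by simp; ring
      map_smul' := fun c v => by simp; ring }
  map_vadd' x v := by
    simp [signedArea]; ring

@[simp]
theorem areaMap_apply (a b x : Plane) : areaMap a b x = signedArea a b x := rfl

theorem AffineMap.map_combo (h : Plane →ᵃ[ℝ] ℝ) (x y : Plane) {s t : ℝ} (hst : s + t = 1) :
    h (s • x + t • y) = s * h x + t * h y := by
  simpa using Convex.combo_affine_apply (f := h) (x := x) (y := y) hst

theorem nonneg_of_mem_convexHull (h : Plane →ᵃ[ℝ] ℝ) {S : Set Plane} (hS : ∀ x ∈ S, 0 ≤ h x)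
    {x : Plane} (hx : x ∈ convexHull ℝ S) : 0 ≤ h x := by
  have : convexHull ℝ S ⊆ h ⁻¹' Set.Ici 0 :=
    convexHull_min (fun y hy => hS y hy) ((convex_Ici 0).affine_preimage h)
  exact this hx

theorem nonpos_of_mem_convexHull (h : Plane →ᵃ[ℝ] ℝ) {S : Set Plane} (hS : ∀ x ∈ S, h x ≤ 0)
    {x : Plane} (hx : x ∈ convexHull ℝ S) : h x ≤ 0 := by
  have : convexHull ℝ S ⊆ h ⁻¹' Set.Iic 0 :=
    convexHull_min (fun y hy => hS y hy) ((convex_Iic 0).affine_preimage h)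
  exact this hx

/-- A point of a convex hull on which a nonnegative affine function vanishes is in the convex hull
of the zeros. -/
theorem mem_convexHull_zeros (h : Plane →ᵃ[ℝ] ℝ) {S : Set Plane} (hS : ∀ x ∈ S, 0 ≤ h x)
    {x : Plane} (hx : x ∈ convexHull ℝ S) (h0 : h x = 0) :
    x ∈ convexHull ℝ {y ∈ S | h y = 0} := by
  let C : Set Plane := {z | 0 ≤ h z ∧ (h z = 0 → z ∈ convexHull ℝ {y ∈ S | h y = 0})}
  have hC : Convex ℝ C := by
    intro u hu v hv s t hs ht hst
    have e := AffineMap.map_combo h u v hst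
    refine ⟨by rw [e]; have := hu.1; have := hv.1; positivity, fun hz => ?_⟩
    rw [e] at hz
    have h1 : 0 ≤ s * h u := mul_nonneg hs hu.1
    have h2 : 0 ≤ t * h v := mul_nonneg ht hv.1
    have h1' : s * h u = 0 := by linarith
    have h2' : t * h v = 0 := by linarith
    rcases eq_or_lt_of_le hs with rfl | hs'
    · have ht1 : t = 1 := by linarith
      subst ht1
      simpa using hv.2 (by simpa using h2')
    rcases eq_or_lt_of_le ht with rfl | ht'
    · have hs1 : s = 1 := by linarith
      subst hs1
      simpa using hu.2 (by simpa using h1')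
    have hu0 := hu.2 ((mul_eq_zero.1 h1').resolve_left hs'.ne')
    have hv0 := hv.2 ((mul_eq_zero.1 h2').resolve_left ht'.ne')
    exact convex_convexHull ℝ _ hu0 hv0 hs ht hst
  have : convexHull ℝ S ⊆ C :=
    convexHull_min (fun y hy => ⟨hS y hy, fun h0 => subset_convexHull ℝ _ ⟨hy, h0⟩⟩) hC
  exact (this hx).2 h0

theorem signedArea_add (p q r x : Plane) :
    signedArea q r x + signedArea r p x + signedArea p q x = signedArea p q r := by
  unfold signedArea; ring

/-- Cramer's rule: the barycentric coordinates are ratios of signed areas. -/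
theorem barycentric {p q r : Plane} (hD : signedArea p q r ≠ 0) (x : Plane) :
    x = (signedArea q r x / signedArea p q r) • p + (signedArea r p x / signedArea p q r) • q +
      (signedArea p q x / signedArea p q r) • r := by
  ext i
  have e : ∀ u v w : ℝ, x i * signedArea p q r = signedArea q r x * p i + signedArea r p x * q i +
      signedArea p q x * r i := by
    intro _ _ _
    fin_cases i <;> (simp [signedArea]; ring)
  simp only [PiLp.add_apply, PiLp.smul_apply, smul_eq_mul]
  field_simp
  have := e 0 0 0
  linarith

theorem combo_three_mem {s : Set Plane} (hs : Convex ℝ s) {x y z : Plane} (hx : x ∈ s) (hy : y ∈ s)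
    (hz : z ∈ s) {a b c : ℝ} (ha : 0 ≤ a) (hb : 0 ≤ b) (hc : 0 ≤ c) (h : a + b + c = 1) :
    a • x + b • y + c • z ∈ s := by
  have := hs.sum_mem (t := Finset.univ) (w := ![a, b, c]) (z := ![x, y, z])
    (by intro i _; fin_cases i <;> assumption) (by simpa [Fin.sum_univ_three] using h)
    (by intro i _; fin_cases i <;> assumption)
  simpa [Fin.sum_univ_three] using this

theorem mem_convexHull_triple {p q r x : Plane} (hD : 0 < signedArea p q r)
    (h1 : 0 ≤ signedArea p q x) (h2 : 0 ≤ signedArea q r x) (h3 : 0 ≤ signedArea r p x) :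
    x ∈ convexHull ℝ ({p, q, r} : Set Plane) := by
  rw [barycentric hD.ne' x]
  refine combo_three_mem (convex_convexHull ℝ _) (subset_convexHull ℝ _ (by simp))
    (subset_convexHull ℝ _ (by simp)) (subset_convexHull ℝ _ (by simp)) (by positivity)
    (by positivity) (by positivity) ?_
  rw [← add_div, ← add_div, signedArea_add, div_self hD.ne']

theorem continuous_signedArea (p q : Plane) : Continuous fun x => signedArea p q x := by
  unfold signedArea; fun_prop

theorem mem_interior_triple {p q r x : Plane} (hD : 0 < signedArea p q r)
    (h1 : 0 < signedArea p q x) (h2 : 0 < signedArea q r x) (h3 : 0 < signedArea r p x) :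
    x ∈ interior (convexHull ℝ ({p, q, r} : Set Plane)) := by
  have ho : IsOpen {y | 0 < signedArea p q y ∧ 0 < signedArea q r y ∧ 0 < signedArea r p y} :=
    (isOpen_lt continuous_const (continuous_signedArea p q)).inter
      ((isOpen_lt continuous_const (continuous_signedArea q r)).inter
        (isOpen_lt continuous_const (continuous_signedArea r p)))
  exact interior_maximal (fun y hy => mem_convexHull_triple hD hy.1.le hy.2.1.le hy.2.2.le) ho
    ⟨h1, h2, h3⟩

theorem interior_triple_nonempty {p q r : Plane} (hD : 0 < signedArea p q r) :
    (interior (convexHull ℝ ({p, q, r} : Set Plane))).Nonempty := by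
  refine ⟨(1 / 3 : ℝ) • p + (1 / 3 : ℝ) • q + (1 / 3 : ℝ) • r, mem_interior_triple hD ?_ ?_ ?_⟩ <;>
  · refine lt_of_lt_of_eq (div_pos hD (by norm_num : (0 : ℝ) < 3)) ?_
    simp [signedArea]; ring

/-- A point common to a triangle and the interior of a set shows that interiors meet. -/
theorem interiors_meet {p q r x : Plane} {A : Set Plane} (hD : 0 < signedArea p q r)
    (hx : x ∈ convexHull ℝ ({p, q, r} : Set Plane)) (hA : x ∈ interior A) :
    ¬ Disjoint (interior (convexHull ℝ ({p, q, r} : Set Plane))) (interior A) := by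
  -- A convex set with nonempty interior lies in the closure of its interior, so an open set meeting
  -- the triangle also meets its interior.
  have hc := (convex_convexHull ℝ ({p, q, r} : Set Plane)).closure_interior_eq_closure_of_nonempty_interior
    (interior_triple_nonempty hD)
  have hx' : x ∈ closure (interior (convexHull ℝ ({p, q, r} : Set Plane))) := by
    rw [hc]; exact subset_closure hx
  obtain ⟨y, hy1, hy2⟩ := mem_closure_iff.1 hx' _ isOpen_interior hA
  exact Set.not_disjoint_iff.2 ⟨y, hy2, hy1⟩

/-- From a common interior point, a small push along the left normal `v` stays in `A` but makes the
area strictly positive. -/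
theorem disjoint_interior_of_separated {p q : Plane} (hpq : p ≠ q) {A B : Set Plane}
    (hA : ∀ x ∈ A, signedArea p q x ≤ 0) (hB : ∀ x ∈ B, 0 ≤ signedArea p q x) :
    Disjoint (interior A) (interior B) := by
  rw [Set.disjoint_left]
  intro x hxA hxB
  let v : Plane := !₂[-(q 1 - p 1), q 0 - p 0]
  have hcont : Filter.Tendsto (fun e : ℝ => x + e • v) (nhdsWithin 0 (Set.Ioi 0)) (nhds x) := by
    have : Continuous fun e : ℝ => x + e • v := by fun_prop
    have h := this.tendsto 0
    simp only [zero_smul, add_zero] at h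
    exact h.mono_left nhdsWithin_le_nhds
  have hev := hcont.eventually (isOpen_interior.mem_nhds hxA)
  obtain ⟨e, he, he0⟩ := (hev.and self_mem_nhdsWithin).exists
  have h1 := hA _ (interior_subset he)
  have h2 := hB _ (interior_subset hxB)
  have h3 : signedArea p q (x + e • v) = signedArea p q x +
      e * ((q 0 - p 0) ^ 2 + (q 1 - p 1) ^ 2) := by
    simp [signedArea, v]; ring
  have h4 : 0 < (q 0 - p 0) ^ 2 + (q 1 - p 1) ^ 2 := by
    by_contra hcon
    apply hpq
    have a0 : q 0 - p 0 = 0 := by nlinarith [sq_nonneg (q 0 - p 0), sq_nonneg (q 1 - p 1)]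
    have a1 : q 1 - p 1 = 0 := by nlinarith [sq_nonneg (q 0 - p 0), sq_nonneg (q 1 - p 1)]
    ext i
    fin_cases i <;> simp <;> linarith
  have he0' : 0 < e := he0
  have := mul_pos he0' h4
  linarith

theorem collinear_of_signedArea_eq_zero {p q r : Plane} (h : signedArea p q r = 0) :
    Collinear ℝ ({p, q, r} : Set Plane) := by
  by_cases hpq : p = q
  · subst hpq; simpa using collinear_pair ℝ p r
  have key : ∃ s : ℝ, r = p + s • (q - p) := by
    unfold signedArea at h
    by_cases h0 : q 0 - p 0 = 0
    · have h1 : q 1 - p 1 ≠ 0 := by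
        intro h1
        apply hpq
        ext i
        fin_cases i <;> simp <;> linarith
      refine ⟨(r 1 - p 1) / (q 1 - p 1), ?_⟩
      ext i
      fin_cases i
      · have : r 0 - p 0 = 0 := by
          have : (q 1 - p 1) * (r 0 - p 0) = 0 := by rw [h0] at h; linarith
          exact (mul_eq_zero.1 this).resolve_left h1
        simp [h0]; linarith
      · simp; field_simp; ring
    · refine ⟨(r 0 - p 0) / (q 0 - p 0), ?_⟩
      ext i
      fin_cases i
      · simp; field_simp; ring
      · simp; field_simp; linarith
  obtain ⟨s, hs⟩ := key
  rw [collinear_iff_of_mem (p₀ := p) (by simp)]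
  refine ⟨q - p, fun x hx => ?_⟩
  simp only [Set.mem_insert_iff, Set.mem_singleton_iff] at hx
  rcases hx with rfl | rfl | rfl
  · exact ⟨0, by simp⟩
  · exact ⟨1, by simp⟩
  · exact ⟨s, by rw [hs]; simp [add_comm]⟩

theorem signedArea_eq_zero_of_collinear {p q r : Plane} (h : Collinear ℝ ({p, q, r} : Set Plane)) :
    signedArea p q r = 0 := by
  obtain ⟨v, hv⟩ := (collinear_iff_of_mem (p₀ := p) (by simp)).1 h
  obtain ⟨a, ha⟩ := hv q (by simp)
  obtain ⟨b, hb⟩ := hv r (by simp)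
  rw [ha, hb]
  simp [signedArea]; ring

theorem affineIndependent_finset_iff {p q r : Plane} (hpq : p ≠ q) (hpr : p ≠ r) (hqr : q ≠ r)
    {t : Finset Plane} (ht : (t : Set Plane) = {p, q, r}) :
    AffineIndependent ℝ ((↑) : t → Plane) ↔ signedArea p q r ≠ 0 := by
  have h1 : AffineIndependent ℝ ![p, q, r] ↔ signedArea p q r ≠ 0 := by
    rw [affineIndependent_iff_not_collinear_set, not_iff_not]
    exact ⟨signedArea_eq_zero_of_collinear, collinear_of_signedArea_eq_zero⟩
  rw [← h1]
  have hr : Set.range ![p, q, r] = (t : Set Plane) := by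
    rw [ht]; ext x; simp [eq_comm, or_comm, or_left_comm]
  have hinj : Function.Injective ![p, q, r] := by
    intro i j hij
    fin_cases i <;> fin_cases j <;> simp_all
  have h2 : AffineIndependent ℝ (fun x : (t : Set Plane) => (x : Plane)) ↔
      AffineIndependent ℝ ![p, q, r] := by
    rw [← hr]
    exact ⟨fun h => AffineIndependent.of_set_of_injective h hinj, fun h => h.range⟩
  exact h2

theorem signedArea_ne_zero_of_mem {t : Finset Plane} (ht : t.card = 3)
    (hA : AffineIndependent ℝ ((↑) : t → Plane)) {p q r : Plane} (hp : p ∈ t) (hq : q ∈ t)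
    (hr : r ∈ t) (hpq : p ≠ q) (hpr : p ≠ r) (hqr : q ≠ r) : signedArea p q r ≠ 0 := by
  have : ({p, q, r} : Finset Plane) = t := by
    apply Finset.eq_of_subset_of_card_le
    · intro x; simp; rintro (rfl | rfl | rfl) <;> assumption
    · rw [ht, Finset.card_eq_three.2 ⟨p, q, r, hpq, hpr, hqr, rfl⟩]
  exact (affineIndependent_finset_iff hpq hpr hqr (by rw [← this]; simp)).1 hA

/-- The hull of `A ∪ B` on the `A`-side of a separating line is the hull of `A`, if the line cuts
the hull in a segment spanned by `A`. -/
theorem mem_convexHull_of_side (h : Plane →ᵃ[ℝ] ℝ) {A B : Set Plane}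
    (hB : ∀ x ∈ B, 0 ≤ h x) (hAn : A.Nonempty)
    (hcut : ∀ z ∈ convexHull ℝ (A ∪ B), h z = 0 → z ∈ convexHull ℝ A) {x : Plane}
    (hx : x ∈ convexHull ℝ (A ∪ B)) (hneg : h x < 0) : x ∈ convexHull ℝ A := by
  rcases B.eq_empty_or_nonempty with rfl | hBn
  · simpa using hx
  have hx0 := hx
  rw [convexHull_union hAn hBn, mem_convexJoin] at hx
  obtain ⟨u, hu, v, hv, hxuv⟩ := hx
  have hv0 := nonneg_of_mem_convexHull h hB hv
  have hvC : v ∈ convexHull ℝ (A ∪ B) := convexHull_mono Set.subset_union_right hv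
  obtain ⟨s, t, hs, ht, hst, rfl⟩ := hxuv
  set x := s • u + t • v with hxdef
  have hd : 0 < h v - h x := by linarith
  have hst' : h v / (h v - h x) + -h x / (h v - h x) = 1 := by field_simp; ring
  -- The weights are those of the point `z` where the segment from `x` to `v` meets the line `h =
  -- 0`. By `hcut` it lies in the hull of `A`, and so does `x`, being between `u` and `z`.
  have hz : (h v / (h v - h x)) • x + (-h x / (h v - h x)) • v ∈ convexHull ℝ A := by
    refine hcut _ (convex_convexHull ℝ _ hx0 hvC (by positivity)
      (div_nonneg (by linarith) hd.le) hst') ?_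
    rw [AffineMap.map_combo h x v hst']
    field_simp; ring
  set z := (h v / (h v - h x)) • x + (-h x / (h v - h x)) • v with hzdef
  rcases eq_or_lt_of_le ht with rfl | ht'
  · have : s = 1 := by linarith
    rw [hxdef, this]; simpa using hu
  have hq : 0 < -h x * s + t * (h v - h x) := by
    have := mul_nonneg (by linarith : 0 ≤ -h x) hs
    have := mul_pos ht' hd
    linarith
  -- `x` lies between `u` and `z`
  have e : x = ((-h x * s) / (-h x * s + t * (h v - h x))) • u +
      (t * (h v - h x) / (-h x * s + t * (h v - h x))) • z := by
    have key : ∀ a d Q V X U W : ℝ, d ≠ 0 → Q ≠ 0 → d = V + a → Q = a * s + t * d →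
        X = s * U + t * W → X = a * s / Q * U + t * d / Q * (V / d * X + a / d * W) := by
      intro a d Q V X U W hd hQ ed eQ eX
      have e1 : a * s / Q * U + t * d / Q * (V / d * X + a / d * W) =
          (a * s * U + t * (V * X + a * W)) / Q := by
        field_simp
      have hs' : s = 1 - t := by linarith
      rw [e1, eq_div_iff hQ, eX, eQ, ed, hs']; ring
    ext i
    have hxi : x i = s * u i + t * v i := by rw [hxdef]; simp
    rw [hzdef]
    simp only [PiLp.add_apply, PiLp.smul_apply, smul_eq_mul]
    exact key _ _ _ _ _ _ _ hd.ne' hq.ne' (by ring) rfl hxi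
  rw [e]
  exact convex_convexHull ℝ _ hu hz (div_nonneg (mul_nonneg (by linarith) hs) hq.le)
    (div_nonneg (by positivity) hq.le) (by rw [← add_div, div_self hq.ne'])

/-! ### Convex chains and splits along chords -/

/-- The points `p lo, …, p hi` are in weakly convex position, in counterclockwise order, and a
chord between indices related by `L` (other than the base chord from `lo` to `hi`) contains no
further point. -/
structure IsConvexChain (p : ℕ → Plane) (L : ℕ → ℕ → Prop) (lo hi : ℕ) : Prop where
  injOn : Set.InjOn p (Set.Icc lo hi)
  nonneg : ∀ i j l, lo ≤ i → i < j → j < l → l ≤ hi → 0 ≤ signedArea (p i) (p j) (p l)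
  pos : ∀ i j l, lo ≤ i → i < j → j < l → l ≤ hi → L i l → (lo < i ∨ l < hi) →
    0 < signedArea (p i) (p j) (p l)
  -- The second alternative allows for the base edge lying on a subdivided side: `p hi` is a corner,
  -- `p lo` the next point and `p m` a later one on that side. No triangle can then have the edge
  -- from `p m` to `p hi`.
  base : ∀ m, lo < m → m < hi → 0 < signedArea (p lo) (p m) (p hi) ∨
    (p lo ∈ segment ℝ (p m) (p hi) ∧ m + 1 < hi ∧ ¬ L m hi)

/-- A triangulation of the points `p i, …, p j` all of whose chords are related by `L`. -/
structure IsLegalTriangulation (p : ℕ → Plane) (L : ℕ → ℕ → Prop) (i j : ℕ)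
    (T : Finset (Finset Plane)) : Prop where
  isTriangulation : IsTriangulation (p '' Set.Icc i j) T
  legal : ∀ t ∈ T, ∀ a b, i ≤ a → a + 1 < b → b ≤ j → p a ∈ t → p b ∈ t → L a b

/-- The recursive structure of triangulations: remove the triangle at the base edge. -/
inductive IsSplit (p : ℕ → Plane) (L : ℕ → ℕ → Prop) : ℕ → ℕ → Finset (Finset Plane) → Prop
  | edge (i : ℕ) : IsSplit p L i (i + 1) ∅
  | join (i l j : ℕ) (T₁ T₂ : Finset (Finset Plane)) : IsSplit p L i l T₁ → IsSplit p L l j T₂ →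
      L i j → IsSplit p L i j (insert {p i, p l, p j} (T₁ ∪ T₂))

theorem IsSplit.lt {p : ℕ → Plane} {L : ℕ → ℕ → Prop} {i j : ℕ} {T : Finset (Finset Plane)}
    (h : IsSplit p L i j T) : i < j := by
  induction h with
  | edge i => omega
  | join i l j T₁ T₂ _ _ _ h1 h2 => omega

theorem IsSplit.legal_or {p : ℕ → Plane} {L : ℕ → ℕ → Prop} {i j : ℕ} {T : Finset (Finset Plane)}
    (h : IsSplit p L i j T) : i + 1 = j ∨ L i j := by
  cases h with
  | edge i => exact Or.inl rfl
  | join _ _ _ _ _ _ _ h => exact Or.inr h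

section chain

variable {p : ℕ → Plane} {L : ℕ → ℕ → Prop} {lo hi : ℕ}

theorem IsConvexChain.ne (H : IsConvexChain p L lo hi) {a b : ℕ} (ha : lo ≤ a) (hab : a < b)
    (hb : b ≤ hi) : p a ≠ p b := fun h =>
  hab.ne (H.injOn ⟨ha, by omega⟩ ⟨by omega, hb⟩ h)

/-- For `i ≤ m ≤ l`, the point `m` is right of the chord from `i` to `l`. -/
theorem IsConvexChain.nonpos_inside (H : IsConvexChain p L lo hi) {i l m : ℕ} (hi0 : lo ≤ i)
    (him : i ≤ m) (hml : m ≤ l) (hl : l ≤ hi) : signedArea (p i) (p l) (p m) ≤ 0 := by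
  rcases eq_or_lt_of_le him with rfl | h1
  · rw [signedArea_self_outer]
  rcases eq_or_lt_of_le hml with rfl | h2
  · rw [signedArea_self_right]
  rw [signedArea_swap]
  linarith [H.nonneg i m l hi0 h1 h2 hl]

theorem IsConvexChain.nonneg_right (H : IsConvexChain p L lo hi) {i l m : ℕ} (hi0 : lo ≤ i)
    (hil : i < l) (hml : l ≤ m) (hl : m ≤ hi) : 0 ≤ signedArea (p i) (p l) (p m) := by
  rcases eq_or_lt_of_le hml with rfl | h2
  · rw [signedArea_self_right]
  exact H.nonneg i l m hi0 hil h2 hl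

theorem IsConvexChain.nonneg_left (H : IsConvexChain p L lo hi) {i l m : ℕ} (hi0 : lo ≤ m)
    (him : m ≤ i) (hml : i < l) (hl : l ≤ hi) : 0 ≤ signedArea (p i) (p l) (p m) := by
  rw [signedArea_rotate]
  rcases eq_or_lt_of_le him with rfl | h2
  · rw [signedArea_self_left]
  exact H.nonneg m i l hi0 h2 hml hl

/-- All points are left of the line through two neighbours. -/
theorem IsConvexChain.nonneg_neighbours (H : IsConvexChain p L lo hi) {a m : ℕ} (ha : lo ≤ a)
    (ha' : a + 1 ≤ hi) (hm : lo ≤ m) (hm' : m ≤ hi) : 0 ≤ signedArea (p a) (p (a + 1)) (p m) := by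
  rcases Nat.lt_or_ge a m with h | h
  · exact H.nonneg_right ha (by omega) (by omega) hm'
  · exact H.nonneg_left hm h (by omega) ha'

theorem IsConvexChain.nonneg_base (H : IsConvexChain p L lo hi) {i j m : ℕ} (hi0 : lo ≤ i)
    (him : i ≤ m) (hml : m ≤ j) (hl : j ≤ hi) : 0 ≤ signedArea (p j) (p i) (p m) := by
  have := H.nonpos_inside hi0 him hml hl
  rw [← signedArea_rotate, signedArea_swap]
  linarith [signedArea_rotate (p i) (p m) (p j), signedArea_swap (p i) (p j) (p m)]

/-- The base triangle of a split is nondegenerate. -/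
theorem IsConvexChain.pos_of_legal (H : IsConvexChain p L lo hi) {i l j : ℕ} (hi0 : lo ≤ i)
    (hil : i < l) (hlj : l < j) (hj : j ≤ hi) (hij : L i j) (h2 : l + 1 = j ∨ L l j) :
    0 < signedArea (p i) (p l) (p j) := by
  by_cases hb : lo < i ∨ j < hi
  · exact H.pos i l j hi0 hil hlj hj hij hb
  · obtain rfl : i = lo := by omega
    obtain rfl : j = hi := by omega
    rcases H.base l hil hlj with h | ⟨-, h3, h4⟩
    · exact h
    · rcases h2 with h2 | h2
      · omega
      · exact absurd h2 h4

theorem mem_image_Icc {i a j : ℕ} (h1 : i ≤ a) (h2 : a ≤ j) : p a ∈ p '' Set.Icc i j :=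
  ⟨a, ⟨h1, h2⟩, rfl⟩

theorem image_Icc_union {i l j : ℕ} (hil : i ≤ l) (hlj : l ≤ j) :
    p '' Set.Icc i j = p '' Set.Icc i l ∪ p '' Set.Icc l j := by
  rw [← Set.image_union, Set.Icc_union_Icc_eq_Icc hil hlj]

/-- A point of the hull on the line of the chord `i l` is on the chord. -/
theorem IsConvexChain.mem_chord_left (H : IsConvexChain p L lo hi) {i l j : ℕ} (hi0 : lo ≤ i)
    (hil : i + 1 < l) (hlj : l < j) (hj : j ≤ hi) (hD : 0 < signedArea (p i) (p l) (p j))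
    (hL : L i l) {z : Plane} (hz : z ∈ convexHull ℝ (p '' Set.Icc i j))
    (h0 : signedArea (p i) (p l) z = 0) : z ∈ convexHull ℝ (p '' Set.Icc i l) := by
  have h3 : 0 ≤ signedArea (p j) (p i) z := nonneg_of_mem_convexHull (areaMap (p j) (p i))
    (by rintro _ ⟨m, hm, rfl⟩; exact H.nonneg_base hi0 hm.1 hm.2 hj) hz
  obtain ⟨l', rfl⟩ : ∃ l', l = l' + 1 := ⟨l - 1, by omega⟩
  have h4 : 0 ≤ signedArea (p l') (p (l' + 1)) z :=
    nonneg_of_mem_convexHull (areaMap (p l') (p (l' + 1)))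
    (by
      rintro _ ⟨m, hm, rfl⟩
      exact H.nonneg_neighbours (by omega) (by omega) (hi0.trans hm.1) (hm.2.trans hj)) hz
  have hpos := H.pos i l' (l' + 1) hi0 (by omega) (by omega) (by omega) hL (by omega)
  have hsum := signedArea_add (p i) (p (l' + 1)) (p j) z
  have hb := barycentric hD.ne' z
  rw [h0, zero_div, zero_smul, add_zero] at hb
  have hc : signedArea (p (l' + 1)) (p j) z / signedArea (p i) (p (l' + 1)) (p j) +
      signedArea (p j) (p i) z / signedArea (p i) (p (l' + 1)) (p j) = 1 := by
    rw [← add_div, div_eq_one_iff_eq hD.ne']; linarith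
  -- On the line of the chord, `z` is a combination of `p i` and `p l` alone. The coefficient of `p
  -- l` is nonnegative because of the base line; that of `p i` because the line through the
  -- neighbours `l - 1` and `l` supports the hull and `p i` is strictly left of it.
  have h5 := AffineMap.map_combo (areaMap (p l') (p (l' + 1))) (p i) (p (l' + 1)) hc
  rw [← hb] at h5
  simp only [areaMap_apply, signedArea_self_right, mul_zero, add_zero] at h5
  rw [h5, signedArea_rotate (p i)] at h4
  have h6 := nonneg_of_mul_nonneg_left h4 hpos
  rw [hb]
  exact convex_convexHull ℝ _ (subset_convexHull ℝ _ (mem_image_Icc le_rfl (by omega)))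
    (subset_convexHull ℝ _ (mem_image_Icc (by omega) le_rfl)) h6 (by positivity) hc

theorem IsConvexChain.mem_chord_right (H : IsConvexChain p L lo hi) {i l j : ℕ} (hi0 : lo ≤ i)
    (hil : i < l) (hlj : l + 1 < j) (hj : j ≤ hi) (hD : 0 < signedArea (p i) (p l) (p j))
    (hL : L l j) {z : Plane} (hz : z ∈ convexHull ℝ (p '' Set.Icc i j))
    (h0 : signedArea (p l) (p j) z = 0) : z ∈ convexHull ℝ (p '' Set.Icc l j) := by
  have h3 : 0 ≤ signedArea (p j) (p i) z := nonneg_of_mem_convexHull (areaMap (p j) (p i))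
    (by rintro _ ⟨m, hm, rfl⟩; exact H.nonneg_base hi0 hm.1 hm.2 hj) hz
  have h4 : 0 ≤ signedArea (p l) (p (l + 1)) z :=
    nonneg_of_mem_convexHull (areaMap (p l) (p (l + 1)))
    (by
      rintro _ ⟨m, hm, rfl⟩
      exact H.nonneg_neighbours (by omega) (by omega) (hi0.trans hm.1) (hm.2.trans hj)) hz
  have hpos := H.pos l (l + 1) j (by omega) (by omega) (by omega) (by omega) hL (by omega)
  have hsum := signedArea_add (p i) (p l) (p j) z
  have hb := barycentric hD.ne' z
  rw [h0, zero_div, zero_smul, zero_add] at hb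
  have hc : signedArea (p j) (p i) z / signedArea (p i) (p l) (p j) +
      signedArea (p i) (p l) z / signedArea (p i) (p l) (p j) = 1 := by
    rw [← add_div, div_eq_one_iff_eq hD.ne']; linarith
  have h5 := AffineMap.map_combo (areaMap (p l) (p (l + 1))) (p l) (p j) hc
  rw [← hb] at h5
  simp only [areaMap_apply, signedArea_self_outer, mul_zero, zero_add] at h5
  rw [h5] at h4
  have h6 := nonneg_of_mul_nonneg_left h4 hpos
  rw [hb]
  exact convex_convexHull ℝ _ (subset_convexHull ℝ _ (mem_image_Icc le_rfl (by omega)))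
    (subset_convexHull ℝ _ (mem_image_Icc (by omega) le_rfl)) (by positivity) h6 hc

/-- The part of the hull right of the chord `i l` is the hull of the points `i, …, l`. -/
theorem IsConvexChain.mem_hull_left (H : IsConvexChain p L lo hi) {i l j : ℕ} (hi0 : lo ≤ i)
    (hil : i < l) (hlj : l < j) (hj : j ≤ hi) (hD : 0 < signedArea (p i) (p l) (p j))
    (hL : i + 1 = l ∨ L i l) {x : Plane} (hx : x ∈ convexHull ℝ (p '' Set.Icc i j))
    (hneg : signedArea (p i) (p l) x < 0) :
    i + 1 < l ∧ x ∈ convexHull ℝ (p '' Set.Icc i l) := by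
  have hil' : i + 1 < l := by
    by_contra hcon
    obtain rfl : l = i + 1 := by omega
    have : 0 ≤ signedArea (p i) (p (i + 1)) x :=
      nonneg_of_mem_convexHull (areaMap (p i) (p (i + 1)))
      (by
        rintro _ ⟨m, hm, rfl⟩
        exact H.nonneg_neighbours (by omega) (by omega) (hi0.trans hm.1) (hm.2.trans hj)) hx
    linarith
  refine ⟨hil', ?_⟩
  have hL' : L i l := hL.resolve_left (by omega)
  rw [image_Icc_union hil.le hlj.le] at hx
  refine mem_convexHull_of_side (areaMap (p i) (p l)) ?_ 
    ⟨_, mem_image_Icc (le_refl i) hil.le⟩ ?_ hx hneg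
  · rintro _ ⟨m, hm, rfl⟩
    exact H.nonneg_right hi0 hil hm.1 (hm.2.trans hj)
  · intro z hz h0
    rw [← image_Icc_union hil.le hlj.le] at hz
    exact H.mem_chord_left hi0 hil' hlj hj hD hL' hz h0

theorem IsConvexChain.mem_hull_right (H : IsConvexChain p L lo hi) {i l j : ℕ} (hi0 : lo ≤ i)
    (hil : i < l) (hlj : l < j) (hj : j ≤ hi) (hD : 0 < signedArea (p i) (p l) (p j))
    (hL : l + 1 = j ∨ L l j) {x : Plane} (hx : x ∈ convexHull ℝ (p '' Set.Icc i j))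
    (hneg : signedArea (p l) (p j) x < 0) :
    l + 1 < j ∧ x ∈ convexHull ℝ (p '' Set.Icc l j) := by
  have hlj' : l + 1 < j := by
    by_contra hcon
    obtain rfl : j = l + 1 := by omega
    have : 0 ≤ signedArea (p l) (p (l + 1)) x :=
      nonneg_of_mem_convexHull (areaMap (p l) (p (l + 1)))
      (by
        rintro _ ⟨m, hm, rfl⟩
        exact H.nonneg_neighbours (by omega) (by omega) (hi0.trans hm.1) (hm.2.trans hj)) hx
    linarith
  refine ⟨hlj', ?_⟩
  have hL' : L l j := hL.resolve_left (by omega)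
  rw [image_Icc_union hil.le hlj.le, Set.union_comm] at hx
  refine mem_convexHull_of_side (areaMap (p l) (p j)) ?_ 
    ⟨_, mem_image_Icc (le_refl l) hlj.le⟩ ?_ hx hneg
  · rintro _ ⟨m, hm, rfl⟩
    exact H.nonneg_left (hi0.trans hm.1) hm.2 hlj hj
  · intro z hz h0
    rw [Set.union_comm, ← image_Icc_union hil.le hlj.le] at hz
    exact H.mem_chord_right hi0 hil hlj' hj hD hL' hz h0

/-- Triangles with vertices in `i, …, l` contain no points beyond `l`. -/
theorem IsConvexChain.le_of_mem_hull_left (H : IsConvexChain p L lo hi) {i l j m : ℕ}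
    (hi0 : lo ≤ i) (hil : i < l) (hlj : l < j) (hj : j ≤ hi)
    (hD : 0 < signedArea (p i) (p l) (p j)) (hL : i + 1 = l ∨ L i l) (hlm : l < m) (hmj : m ≤ j) :
    p m ∉ convexHull ℝ (p '' Set.Icc i l) := by
  intro hm
  have hfl : ∀ x ∈ p '' Set.Icc i l, 0 ≤ (-areaMap (p i) (p l)) x := by
    rintro _ ⟨a, ha, rfl⟩
    simpa using H.nonpos_inside hi0 ha.1 ha.2 (by omega)
  have h1 := nonneg_of_mem_convexHull _ hfl hm
  have h2 := H.nonneg_right hi0 hil hlm.le (hmj.trans hj)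
  have h0 : signedArea (p i) (p l) (p m) = 0 := by
    simp at h1; linarith
  have h3 := mem_convexHull_zeros _ hfl hm (by simp [h0])
  -- Strictness at the legal chord leaves only its end points on the line. Then `p m` is on the
  -- segment from `p i` to `p l`, and not strictly left of the line from `p l` to `p j`, which
  -- forces `p m = p l`.
  have h4 : {y ∈ p '' Set.Icc i l | (-areaMap (p i) (p l)) y = 0} ⊆ {p i, p l} := by
    rintro _ ⟨⟨a, ha, rfl⟩, h0⟩
    by_contra hcon
    have hai : i ≠ a := by rintro rfl; simp at hcon
    have hal : a ≠ l := by rintro rfl; simp at hcon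
    have hia := lt_of_le_of_ne ha.1 hai
    have hal' := lt_of_le_of_ne ha.2 hal
    have := H.pos i a l hi0 hia hal' (by omega) (hL.resolve_left (by omega)) (by omega)
    rw [signedArea_swap] at this
    simp at h0
    linarith
  have h5 := convexHull_mono h4 h3
  rw [convexHull_pair] at h5
  obtain ⟨s, t, hs, ht, hst, e⟩ := h5
  have h6 := AffineMap.map_combo (areaMap (p l) (p j)) (p i) (p l) hst
  rw [e] at h6
  simp only [areaMap_apply, signedArea_self_outer, mul_zero, add_zero] at h6
  rw [signedArea_rotate (p i)] at h6
  have h7 := H.nonpos_inside (by omega) hlm.le hmj hj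
  rw [h6] at h7
  have : s = 0 := by
    by_contra hs0
    have := mul_pos (lt_of_le_of_ne hs (Ne.symm hs0)) hD
    linarith
  have ht1 : t = 1 := by linarith
  rw [this, ht1] at e
  simp at e
  exact H.ne (by omega) hlm (by omega) e

theorem IsConvexChain.ge_of_mem_hull_right (H : IsConvexChain p L lo hi) {i l j m : ℕ}
    (hi0 : lo ≤ i) (hil : i < l) (hlj : l < j) (hj : j ≤ hi)
    (hD : 0 < signedArea (p i) (p l) (p j)) (hL : l + 1 = j ∨ L l j) (him : i ≤ m) (hml : m < l) :
    p m ∉ convexHull ℝ (p '' Set.Icc l j) := by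
  intro hm
  have hfl : ∀ x ∈ p '' Set.Icc l j, 0 ≤ (-areaMap (p l) (p j)) x := by
    rintro _ ⟨a, ha, rfl⟩
    simpa using H.nonpos_inside (by omega) ha.1 ha.2 (by omega)
  have h1 := nonneg_of_mem_convexHull _ hfl hm
  have h2 := H.nonneg_left (hi0.trans him) hml.le hlj hj
  have h0 : signedArea (p l) (p j) (p m) = 0 := by
    simp at h1; linarith
  have h3 := mem_convexHull_zeros _ hfl hm (by simp [h0])
  have h4 : {y ∈ p '' Set.Icc l j | (-areaMap (p l) (p j)) y = 0} ⊆ {p l, p j} := by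
    rintro _ ⟨⟨a, ha, rfl⟩, h0⟩
    by_contra hcon
    have hai : l ≠ a := by rintro rfl; simp at hcon
    have hal : a ≠ j := by rintro rfl; simp at hcon
    have hia := lt_of_le_of_ne ha.1 hai
    have hal' := lt_of_le_of_ne ha.2 hal
    have := H.pos l a j (by omega) hia hal' (by omega) (hL.resolve_left (by omega)) (by omega)
    rw [signedArea_swap] at this
    simp at h0
    linarith
  have h5 := convexHull_mono h4 h3
  rw [convexHull_pair] at h5
  obtain ⟨s, t, hs, ht, hst, e⟩ := h5
  have h6 := AffineMap.map_combo (areaMap (p i) (p l)) (p l) (p j) hst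
  rw [e] at h6
  simp only [areaMap_apply, signedArea_self_right, mul_zero, zero_add] at h6
  have h7 := H.nonpos_inside hi0 him hml.le (hlj.le.trans hj)
  rw [h6] at h7
  have : t = 0 := by
    by_contra hs0
    have := mul_pos (lt_of_le_of_ne ht (Ne.symm hs0)) hD
    linarith
  have ht1 : s = 1 := by linarith
  rw [this, ht1] at e
  simp at e
  exact H.ne (by omega) hml (by omega) e.symm

theorem IsConvexChain.hull_left_nonpos (H : IsConvexChain p L lo hi) {i l : ℕ} (hi0 : lo ≤ i)
    (hl : l ≤ hi) {x : Plane} (hx : x ∈ convexHull ℝ (p '' Set.Icc i l)) :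
    signedArea (p i) (p l) x ≤ 0 :=
  nonpos_of_mem_convexHull (areaMap (p i) (p l))
    (by rintro _ ⟨a, ha, rfl⟩; exact H.nonpos_inside hi0 ha.1 ha.2 hl) hx

theorem IsConvexChain.hull_nonneg_left (H : IsConvexChain p L lo hi) {i l j : ℕ} (hi0 : lo ≤ i)
    (hil : i < l) (hj : j ≤ hi) {x : Plane} (hx : x ∈ convexHull ℝ (p '' Set.Icc l j)) :
    0 ≤ signedArea (p i) (p l) x :=
  nonneg_of_mem_convexHull (areaMap (p i) (p l))
    (by rintro _ ⟨a, ha, rfl⟩; exact H.nonneg_right hi0 hil ha.1 (ha.2.trans hj)) hx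

theorem IsConvexChain.hull_nonneg_right (H : IsConvexChain p L lo hi) {i l j : ℕ} (hi0 : lo ≤ i)
    (hlj : l < j) (hj : j ≤ hi) {x : Plane} (hx : x ∈ convexHull ℝ (p '' Set.Icc i l)) :
    0 ≤ signedArea (p l) (p j) x :=
  nonneg_of_mem_convexHull (areaMap (p l) (p j))
    (by rintro _ ⟨a, ha, rfl⟩; exact H.nonneg_left (hi0.trans ha.1) ha.2 hlj hj) hx

theorem triple_subset_image {i l j : ℕ} (hil : i ≤ l) (hlj : l ≤ j) :
    ({p i, p l, p j} : Set Plane) ⊆ p '' Set.Icc i j := by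
  intro x hx
  simp only [Set.mem_insert_iff, Set.mem_singleton_iff] at hx
  rcases hx with rfl | rfl | rfl
  · exact ⟨i, ⟨le_rfl, by omega⟩, rfl⟩
  · exact ⟨l, ⟨by omega, by omega⟩, rfl⟩
  · exact ⟨j, ⟨by omega, le_rfl⟩, rfl⟩

theorem triangle_nonneg {q r s : Plane} (hD : 0 < signedArea q r s) {x : Plane}
    (hx : x ∈ convexHull ℝ ({q, r, s} : Set Plane)) :
    0 ≤ signedArea q r x ∧ 0 ≤ signedArea r s x := by
  constructor
  · refine nonneg_of_mem_convexHull (areaMap q r) ?_ hx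
    intro y hy
    simp only [Set.mem_insert_iff, Set.mem_singleton_iff] at hy
    rcases hy with rfl | rfl | rfl
    · simp [signedArea_self_outer]
    · simp [signedArea_self_right]
    · exact hD.le
  · refine nonneg_of_mem_convexHull (areaMap r s) ?_ hx
    intro y hy
    simp only [Set.mem_insert_iff, Set.mem_singleton_iff] at hy
    rcases hy with rfl | rfl | rfl
    · simp only [areaMap_apply]; rw [signedArea_rotate]; exact hD.le
    · simp [signedArea_self_outer]
    · simp [signedArea_self_right]

end chain

theorem interiors_meet_of_ne_zero {p q r x : Plane} {A : Set Plane} (hD : signedArea p q r ≠ 0)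
    (hx : x ∈ convexHull ℝ ({p, q, r} : Set Plane)) (hA : x ∈ interior A) :
    ¬ Disjoint (interior (convexHull ℝ ({p, q, r} : Set Plane))) (interior A) := by
  rcases lt_or_gt_of_ne hD with h | h
  · have e : ({p, q, r} : Set Plane) = {p, r, q} := by rw [Set.pair_comm q r]
    rw [e] at hx ⊢
    exact interiors_meet (by rw [signedArea_swap]; linarith) hx hA
  · exact interiors_meet h hx hA

theorem signedArea_eq_zero_of_line {p q x y z : Plane} (hpq : p ≠ q) (hx : signedArea p q x = 0)
    (hy : signedArea p q y = 0) (hz : signedArea p q z = 0) : signedArea x y z = 0 := by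
  unfold signedArea at *
  by_cases h0 : q 0 - p 0 = 0
  · have h1 : q 1 - p 1 ≠ 0 := by
      intro h1
      apply hpq
      ext i
      fin_cases i <;> simp <;> linarith
    apply mul_left_cancel₀ h1
    linear_combination (y 1 - x 1) * hz + (x 1 - z 1) * hy + (z 1 - y 1) * hx
  · apply mul_left_cancel₀ h0
    linear_combination (y 0 - x 0) * hz - (z 0 - x 0) * hy + (z 0 - y 0) * hx

/-! ### Splits are triangulations -/

section chain

variable {p : ℕ → Plane} {L : ℕ → ℕ → Prop} {lo hi : ℕ}

/-- The lines through the chords `i l` and `l j` separate the three pieces, which makes the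
interiors disjoint. A point of the hull strictly right of one of these chords lies in the piece cut
off by it, and any other point in the base triangle, which gives the covering. An edge is a
degenerate piece without triangles and has to be listed apart, since its hull is not covered. -/
theorem IsConvexChain.isLegal_of_isSplit (H : IsConvexChain p L lo hi) {i j : ℕ}
    {T : Finset (Finset Plane)} (hT : IsSplit p L i j T) (hi0 : lo ≤ i) (hj : j ≤ hi) :
    (i + 1 = j ∧ T = ∅) ∨ (i + 1 < j ∧ IsLegalTriangulation p L i j T) := by
  induction hT with
  | edge i => exact Or.inl ⟨rfl, rfl⟩
  | join i l j T₁ T₂ hs1 hs2 hL ih1 ih2 =>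
    right
    have hil := hs1.lt
    have hlj := hs2.lt
    have hL1 := hs1.legal_or
    have hL2 := hs2.legal_or
    have ih1 := ih1 hi0 (by omega)
    have ih2 := ih2 (by omega) hj
    have hD := H.pos_of_legal hi0 hil hlj hj hL hL2
    have n1 : p i ≠ p l := H.ne hi0 hil (by omega)
    have n2 : p l ≠ p j := H.ne (by omega) hlj hj
    have n3 : p i ≠ p j := H.ne (by omega) (by omega) hj
    have c0 : ((({p i, p l, p j} : Finset Plane)) : Set Plane) = {p i, p l, p j} := by simp
    have k1 : ∀ t ∈ T₁, i + 1 < l ∧ IsLegalTriangulation p L i l T₁ := by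
      intro t ht
      rcases ih1 with ⟨-, rfl⟩ | h
      · simp at ht
      · exact h
    have k2 : ∀ t ∈ T₂, l + 1 < j ∧ IsLegalTriangulation p L l j T₂ := by
      intro t ht
      rcases ih2 with ⟨-, rfl⟩ | h
      · simp at ht
      · exact h
    have s1 : ∀ t ∈ T₁, (t : Set Plane) ⊆ p '' Set.Icc i l := fun t ht =>
      (k1 t ht).2.isTriangulation.vertices_subset t ht
    have s2 : ∀ t ∈ T₂, (t : Set Plane) ⊆ p '' Set.Icc l j := fun t ht =>
      (k2 t ht).2.isTriangulation.vertices_subset t ht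
    have cases_mem : ∀ t ∈ insert {p i, p l, p j} (T₁ ∪ T₂),
        t = {p i, p l, p j} ∨ t ∈ T₁ ∨ t ∈ T₂ := by
      intro t ht; simpa using ht
    have neg1 : ∀ t ∈ T₁, ∀ x ∈ convexHull ℝ (t : Set Plane), signedArea (p i) (p l) x ≤ 0 :=
      fun t ht x hx => H.hull_left_nonpos hi0 (by omega) (convexHull_mono (s1 t ht) hx)
    have neg2 : ∀ t ∈ T₂, ∀ x ∈ convexHull ℝ (t : Set Plane), signedArea (p l) (p j) x ≤ 0 :=
      fun t ht x hx => H.hull_left_nonpos (by omega) hj (convexHull_mono (s2 t ht) hx)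
    have pos12 : ∀ t ∈ T₂, ∀ x ∈ convexHull ℝ (t : Set Plane), 0 ≤ signedArea (p i) (p l) x :=
      fun t ht x hx => H.hull_nonneg_left hi0 hil hj (convexHull_mono (s2 t ht) hx)
    have pos0 : ∀ x ∈ convexHull ℝ ((({p i, p l, p j} : Finset Plane)) : Set Plane),
        0 ≤ signedArea (p i) (p l) x ∧ 0 ≤ signedArea (p l) (p j) x := by
      rw [c0]; exact fun x hx => triangle_nonneg hD hx
    have sub1 : p '' Set.Icc i l ⊆ p '' Set.Icc i j :=
      Set.image_mono (Set.Icc_subset_Icc le_rfl hlj.le)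
    have sub2 : p '' Set.Icc l j ⊆ p '' Set.Icc i j :=
      Set.image_mono (Set.Icc_subset_Icc hil.le le_rfl)
    refine ⟨by omega, ⟨?_, ?_, ?_, ?_, ?_, ?_⟩, ?_⟩
    · intro t ht
      rcases cases_mem t ht with rfl | ht | ht
      · exact Finset.card_eq_three.2 ⟨_, _, _, n1, n3, n2, rfl⟩
      · exact (k1 t ht).2.isTriangulation.card_eq_three t ht
      · exact (k2 t ht).2.isTriangulation.card_eq_three t ht
    · intro t ht
      rcases cases_mem t ht with rfl | ht | ht
      · exact (affineIndependent_finset_iff n1 n3 n2 c0).2 hD.ne'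
      · exact (k1 t ht).2.isTriangulation.affineIndependent t ht
      · exact (k2 t ht).2.isTriangulation.affineIndependent t ht
    · intro t ht
      rcases cases_mem t ht with rfl | ht | ht
      · rw [c0]; exact triple_subset_image hil.le hlj.le
      · exact (s1 t ht).trans sub1
      · exact (s2 t ht).trans sub2
    · rintro t ht _ ⟨m, hm, rfl⟩ hmt
      rcases cases_mem t ht with rfl | ht | ht
      · by_contra hcon
        have e1 : m ≠ i := by rintro rfl; simp at hcon
        have e2 : m ≠ l := by rintro rfl; simp at hcon
        have e3 : m ≠ j := by rintro rfl; simp at hcon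
        have hm1 := hm.1
        have hm2 := hm.2
        obtain ⟨q1, q2⟩ := pos0 _ hmt
        rcases lt_or_gt_of_ne e2 with h | h
        · have := H.pos i m l hi0 (by omega) h (by omega) (hL1.resolve_left (by omega)) (by omega)
          rw [signedArea_swap] at this
          linarith
        · have := H.pos l m j (by omega) h (by omega) (by omega) (hL2.resolve_left (by omega))
            (by omega)
          rw [signedArea_swap] at this
          linarith
      · have hk := (k1 t ht).2.isTriangulation
        by_cases hml : m ≤ l
        · exact hk.no_other_point t ht _ (mem_image_Icc hm.1 hml) hmt
        · exact absurd (convexHull_mono (s1 t ht) hmt)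
            (H.le_of_mem_hull_left hi0 hil hlj hj hD hL1 (by omega) hm.2)
      · have hk := (k2 t ht).2.isTriangulation
        by_cases hml : l ≤ m
        · exact hk.no_other_point t ht _ (mem_image_Icc hml hm.2) hmt
        · exact absurd (convexHull_mono (s2 t ht) hmt)
            (H.ge_of_mem_hull_right hi0 hil hlj hj hD hL2 hm.1 (by omega))
    · intro t ht t' ht' htt'
      rcases cases_mem t ht with rfl | ht | ht <;> rcases cases_mem t' ht' with rfl | ht' | ht'
      · exact absurd rfl htt'
      · exact (disjoint_interior_of_separated n1 (neg1 t' ht') fun x hx => (pos0 x hx).1).symm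
      · exact (disjoint_interior_of_separated n2 (neg2 t' ht') fun x hx => (pos0 x hx).2).symm
      · exact disjoint_interior_of_separated n1 (neg1 t ht) fun x hx => (pos0 x hx).1
      · exact (k1 t ht).2.isTriangulation.disjoint_interiors t ht t' ht' htt'
      · exact disjoint_interior_of_separated n1 (neg1 t ht) (pos12 t' ht')
      · exact disjoint_interior_of_separated n2 (neg2 t ht) fun x hx => (pos0 x hx).2
      · exact (disjoint_interior_of_separated n1 (neg1 t' ht') (pos12 t ht)).symm
      · exact (k2 t ht).2.isTriangulation.disjoint_interiors t ht t' ht' htt'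
    · apply Set.Subset.antisymm
      · refine Set.iUnion₂_subset fun t ht => convexHull_mono ?_
        rcases cases_mem t ht with rfl | ht | ht
        · rw [c0]; exact triple_subset_image hil.le hlj.le
        · exact (s1 t ht).trans sub1
        · exact (s2 t ht).trans sub2
      · intro x hx
        rw [Set.mem_iUnion₂]
        by_cases h1 : signedArea (p i) (p l) x < 0
        · obtain ⟨hil', hx'⟩ := H.mem_hull_left hi0 hil hlj hj hD hL1 hx h1
          have hk := (ih1.resolve_left (by omega)).2.isTriangulation
          rw [← hk.cover, Set.mem_iUnion₂] at hx'
          obtain ⟨t, ht, hxt⟩ := hx'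
          exact ⟨t, by simp [ht], hxt⟩
        by_cases h2 : signedArea (p l) (p j) x < 0
        · obtain ⟨hil', hx'⟩ := H.mem_hull_right hi0 hil hlj hj hD hL2 hx h2
          have hk := (ih2.resolve_left (by omega)).2.isTriangulation
          rw [← hk.cover, Set.mem_iUnion₂] at hx'
          obtain ⟨t, ht, hxt⟩ := hx'
          exact ⟨t, by simp [ht], hxt⟩
        refine ⟨{p i, p l, p j}, by simp, ?_⟩
        rw [c0]
        exact mem_convexHull_triple hD (not_lt.1 h1) (not_lt.1 h2)
          (nonneg_of_mem_convexHull (areaMap (p j) (p i))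
            (by rintro _ ⟨m, hm, rfl⟩; exact H.nonneg_base hi0 hm.1 hm.2 hj) hx)
    · intro t ht a b hia hab hbj ha hb
      have inj : ∀ a b, i ≤ a → a ≤ j → i ≤ b → b ≤ j → p a = p b → a = b := fun a b h1 h2 h3 h4 h =>
        H.injOn ⟨by omega, by omega⟩ ⟨by omega, by omega⟩ h
      rcases cases_mem t ht with rfl | ht | ht
      · simp only [Finset.mem_insert, Finset.mem_singleton] at ha hb
        have ha' : a = i ∨ a = l ∨ a = j := by
          rcases ha with h | h | h
          · exact Or.inl (inj _ _ (by omega) (by omega) (by omega) (by omega) h)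
          · exact Or.inr (Or.inl (inj _ _ (by omega) (by omega) (by omega) (by omega) h))
          · exact Or.inr (Or.inr (inj _ _ (by omega) (by omega) (by omega) (by omega) h))
        have hb' : b = i ∨ b = l ∨ b = j := by
          rcases hb with h | h | h
          · exact Or.inl (inj _ _ (by omega) (by omega) (by omega) (by omega) h)
          · exact Or.inr (Or.inl (inj _ _ (by omega) (by omega) (by omega) (by omega) h))
          · exact Or.inr (Or.inr (inj _ _ (by omega) (by omega) (by omega) (by omega) h))
        rcases ha' with rfl | rfl | rfl <;> rcases hb' with rfl | rfl | rfl <;>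
          first
          | omega
          | exact hL
          | exact hL1.resolve_left (by omega)
          | exact hL2.resolve_left (by omega)
      · have hbl : b ≤ l := by
          obtain ⟨b', hb', e⟩ := s1 t ht hb
          rw [inj b b' (by omega) hbj hb'.1 (hb'.2.trans hlj.le) e.symm]; exact hb'.2
        exact (k1 t ht).2.legal t ht a b hia hab hbl ha hb
      · have hbl : l ≤ a := by
          obtain ⟨b', hb', e⟩ := s2 t ht ha
          rw [inj a b' (by omega) (by omega) (hil.le.trans hb'.1) hb'.2 e.symm]; exact hb'.1
        exact (k2 t ht).2.legal t ht a b hbl hab hbj ha hb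

/-! ### Triangulations are splits -/

/-- A triangle of the triangulation sits at the base edge. -/
theorem IsConvexChain.exists_base_triangle (H : IsConvexChain p L lo hi) {i j : ℕ}
    {T : Finset (Finset Plane)} (hT : IsTriangulation (p '' Set.Icc i j) T)
    (hi0 : lo ≤ i) (hj : j ≤ hi) (hij : i + 1 < j) (hL : L i j) :
    ∃ l, i < l ∧ l < j ∧ {p i, p l, p j} ∈ T := by
  have n3 : p i ≠ p j := H.ne hi0 (by omega) hj
  have hbase : ∀ m, i < m → m < j →
      0 < signedArea (p i) (p m) (p j) ∨ p i ∈ segment ℝ (p m) (p j) := by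
    intro m h1 h2
    by_cases hb : lo < i ∨ j < hi
    · exact Or.inl (H.pos i m j hi0 h1 h2 hj hL hb)
    · obtain rfl : i = lo := by omega
      obtain rfl : j = hi := by omega
      rcases H.base m h1 h2 with h | h
      · exact Or.inl h
      · exact Or.inr h.1
  -- The midpoint of the base edge lies in some triangle `t`. The base line supports the hull, so
  -- `q` is already in the hull of the vertices of `t` on that line; each of these is `p j` or has
  -- `p i` between itself and `p j`.
  let q : Plane := (1 / 2 : ℝ) • p i + (1 / 2 : ℝ) • p j
  have hhalf : (1 / 2 : ℝ) + 1 / 2 = 1 := by norm_num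
  have hq : q ∈ convexHull ℝ (p '' Set.Icc i j) :=
    convex_convexHull ℝ _ (subset_convexHull ℝ _ (mem_image_Icc le_rfl (by omega)))
      (subset_convexHull ℝ _ (mem_image_Icc (by omega) le_rfl)) (by norm_num) (by norm_num) hhalf
  rw [← hT.cover, Set.mem_iUnion₂] at hq
  obtain ⟨t, ht, hqt⟩ := hq
  have hts := hT.vertices_subset t ht
  have hzeros := mem_convexHull_zeros (areaMap (p j) (p i)) (S := t)
    (by
      intro x hx
      obtain ⟨m, hm, rfl⟩ := hts hx
      exact H.nonneg_base hi0 hm.1 hm.2 hj) hqt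
    (by
      rw [AffineMap.map_combo _ _ _ hhalf]
      simp [signedArea_self_right, signedArea_self_outer])
  have hz : ∀ y ∈ t, signedArea (p j) (p i) y = 0 → y = p j ∨ p i ∈ segment ℝ y (p j) := by
    intro y hy h0
    obtain ⟨m, hm, rfl⟩ := hts hy
    rcases eq_or_lt_of_le hm.1 with rfl | h1
    · exact Or.inr (left_mem_segment ℝ _ _)
    rcases eq_or_lt_of_le hm.2 with rfl | h2
    · exact Or.inl rfl
    rcases hbase m h1 h2 with h | h
    · rw [← signedArea_rotate] at h0
      rw [← signedArea_rotate, ← signedArea_rotate] at h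
      rw [signedArea_rotate] at h0
      linarith [signedArea_rotate (p i) (p m) (p j), signedArea_rotate (p m) (p j) (p i)]
    · exact Or.inr h
  have hjt : p j ∈ t := by
    by_contra hcon
    -- The line through `p i` and `w` is perpendicular to the base. Without `p j`, all vertices of
    -- `t` on the base line would be on its far side or on it, whereas `q` is strictly on the side
    -- of `p j`.
    let w : Plane := !₂[p i 0 + (p j 1 - p i 1), p i 1 - (p j 0 - p i 0)]
    have e1 : signedArea (p i) w (p j) = (p j 1 - p i 1) ^ 2 + (p j 0 - p i 0) ^ 2 := by
      simp [signedArea, w]; ring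
    have hpos : 0 < signedArea (p i) w (p j) := by
      rw [e1]
      by_contra hc
      apply n3
      have a0 : p j 0 - p i 0 = 0 := by
        nlinarith [sq_nonneg (p j 0 - p i 0), sq_nonneg (p j 1 - p i 1)]
      have a1 : p j 1 - p i 1 = 0 := by
        nlinarith [sq_nonneg (p j 0 - p i 0), sq_nonneg (p j 1 - p i 1)]
      ext a
      fin_cases a <;> simp <;> linarith
    have h1 := nonpos_of_mem_convexHull (areaMap (p i) w)
      (by
        rintro y ⟨hy, h0⟩
        rcases hz y hy h0 with rfl | ⟨s, u, hs, hu, hsu, e⟩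
        · exact absurd hy hcon
        · have h2 := AffineMap.map_combo (areaMap (p i) w) y (p j) hsu
          rw [e] at h2
          simp only [areaMap_apply, signedArea_self_outer] at h2 ⊢
          have hs0 : 0 < s := by
            rcases eq_or_lt_of_le hs with rfl | h
            · have : u = 1 := by linarith
              subst this
              simp at e
              exact absurd e.symm n3
            · exact h
          have := mul_nonneg hu hpos.le
          by_contra hc
          have := mul_pos hs0 (not_le.1 hc)
          linarith) hzeros
    rw [AffineMap.map_combo _ _ _ hhalf] at h1
    simp only [areaMap_apply, signedArea_self_outer] at h1
    linarith
  have hit : p i ∈ t := by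
    -- Since `q` is not `p j`, the base line carries another vertex `y` of `t`. Then `p i` is
    -- between `y` and `p j`, hence in the triangle, hence one of its vertices.
    have : ∃ y ∈ t, signedArea (p j) (p i) y = 0 ∧ y ≠ p j := by
      by_contra! hcon
      have hs : {y ∈ (t : Set Plane) | areaMap (p j) (p i) y = 0} ⊆ {p j} :=
        fun y hy => hcon y hy.1 hy.2
      have h1 := convexHull_mono hs hzeros
      rw [convexHull_singleton, Set.mem_singleton_iff] at h1
      apply n3
      have h2 : (1 / 2 : ℝ) • p i = (1 / 2 : ℝ) • p j := by
        have h3 : (1 / 2 : ℝ) • p i + (1 / 2 : ℝ) • p j = (1 / 2 : ℝ) • p j + (1 / 2 : ℝ) • p j := by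
          rw [← add_smul, hhalf, one_smul]; exact h1
        exact add_right_cancel h3
      exact smul_right_injective _ (by norm_num : (1 / 2 : ℝ) ≠ 0) h2
    obtain ⟨y, hy, h0, hne⟩ := this
    refine hT.no_other_point t ht _ (mem_image_Icc le_rfl (by omega)) ?_
    have := (hz y hy h0).resolve_left hne
    exact (convex_convexHull ℝ _).segment_subset (subset_convexHull ℝ _ hy)
      (subset_convexHull ℝ _ hjt) this
  have hcard := hT.card_eq_three t ht
  have : ∃ x ∈ t, x ∉ ({p i, p j} : Finset Plane) := by
    by_contra! hcon
    have := Finset.card_le_card (show t ⊆ {p i, p j} from hcon)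
    have := (Finset.card_le_two (a := p i) (b := p j))
    omega
  obtain ⟨x, hxt, hx⟩ := this
  obtain ⟨l, hl, rfl⟩ := hts hxt
  simp only [Finset.mem_insert, Finset.mem_singleton, not_or] at hx
  have hli : l ≠ i := by rintro rfl; exact hx.1 rfl
  have hlj : l ≠ j := by rintro rfl; exact hx.2 rfl
  have hl1 := hl.1
  have hl2 := hl.2
  refine ⟨l, by omega, by omega, ?_⟩
  have : ({p i, p l, p j} : Finset Plane) = t := by
    apply Finset.eq_of_subset_of_card_le
    · intro x; simp; rintro (rfl | rfl | rfl) <;> assumption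
    · rw [hcard, Finset.card_eq_three.2 ⟨p i, p l, p j, Ne.symm hx.1, n3, hx.2, rfl⟩]
  rw [this]; exact ht

/-- No triangle other than `i l j` crosses that triangle. -/
theorem IsConvexChain.not_crossing (H : IsConvexChain p L lo hi) {i l j a c : ℕ}
    {T : Finset (Finset Plane)} (hT : IsTriangulation (p '' Set.Icc i j) T)
    (hi0 : lo ≤ i) (hj : j ≤ hi) (hil : i < l) (hlj : l < j) (h0 : {p i, p l, p j} ∈ T)
    {t : Finset Plane} (ht : t ∈ T) (hne : t ≠ {p i, p l, p j}) (hia : i ≤ a) (hal : a < l)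
    (hlc : l < c) (hcj : c ≤ j) (hat : p a ∈ t) (hct : p c ∈ t) : False := by
  have hD : 0 < signedArea (p i) (p l) (p j) :=
    lt_of_le_of_ne (H.nonneg i l j hi0 hil hlj hj) (signedArea_ne_zero_of_mem
      (hT.card_eq_three _ h0) (hT.affineIndependent _ h0) (by simp) (by simp) (by simp)
      (H.ne hi0 hil (by omega)) (H.ne hi0 (by omega) hj) (H.ne (by omega) hlj hj)).symm
  have A1 := H.nonpos_inside hi0 hia hal.le (by omega)
  have C1 := H.nonneg_right hi0 hil hlc.le (hcj.trans hj)
  have A2 := H.nonneg_left (hi0.trans hia) hal.le hlj hj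
  have C2 := H.nonpos_inside (by omega : lo ≤ l) hlc.le hcj hj
  -- A Plücker relation among the five points.
  have pl : signedArea (p i) (p l) (p c) * signedArea (p l) (p j) (p a) -
      signedArea (p i) (p l) (p a) * signedArea (p l) (p j) (p c) =
      signedArea (p i) (p l) (p j) * signedArea (p a) (p l) (p c) := by
    unfold signedArea; ring
  have hac : p a ≠ p c := H.ne (by omega) (by omega) (by omega)
  have hal' : p a ≠ p l := H.ne (by omega) (by omega) (by omega)
  have hlc' : p l ≠ p c := H.ne (by omega) (by omega) (by omega)
  -- a point with first two coordinates zero is the apex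
  have apex : ∀ z, signedArea (p i) (p l) z = 0 → signedArea (p l) (p j) z = 0 → z = p l := by
    intro z h1 h2
    have hb := barycentric hD.ne' z
    have hs := signedArea_add (p i) (p l) (p j) z
    rw [h1, h2] at hb hs
    have : signedArea (p j) (p i) z = signedArea (p i) (p l) (p j) := by linarith
    rw [this, div_self hD.ne'] at hb
    simpa using hb
  set a1 := signedArea (p i) (p l) (p a) with ha1
  set a2 := signedArea (p l) (p j) (p a) with ha2
  set c1 := signedArea (p i) (p l) (p c) with hc1
  set c2 := signedArea (p l) (p j) (p c) with hc2
  have hs : 0 < (c1 - c2) + (a2 - a1) := by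
    by_contra hcon
    exact hal' (apex _ (by linarith) (by linarith))
  set s := (c1 - c2) + (a2 - a1) with hsdef
  have hst : (c1 - c2) / s + (a2 - a1) / s = 1 := by rw [← add_div, div_self hs.ne']
  -- The weights are chosen so that the areas with respect to the chords `i l` and `l j` agree at
  -- `z`. By the Plücker relation their common value has the sign of the area of `a l c`.
  set z : Plane := ((c1 - c2) / s) • p a + ((a2 - a1) / s) • p c with hz
  have hzt : z ∈ convexHull ℝ (t : Set Plane) :=
    convex_convexHull ℝ _ (subset_convexHull ℝ _ hat) (subset_convexHull ℝ _ hct)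
      (div_nonneg (by linarith) hs.le) (div_nonneg (by linarith) hs.le) hst
  have z1 : signedArea (p i) (p l) z =
      signedArea (p i) (p l) (p j) * signedArea (p a) (p l) (p c) / s := by
    have := AffineMap.map_combo (areaMap (p i) (p l)) (p a) (p c) hst
    simp only [areaMap_apply] at this
    rw [hz, this, ← pl, ← ha1, ← hc1]; ring
  have z2 : signedArea (p l) (p j) z =
      signedArea (p i) (p l) (p j) * signedArea (p a) (p l) (p c) / s := by
    have := AffineMap.map_combo (areaMap (p l) (p j)) (p a) (p c) hst
    simp only [areaMap_apply] at this
    rw [hz, this, ← pl, ← ha2, ← hc2]; ring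
  have hcard := hT.card_eq_three t ht
  have haff := hT.affineIndependent t ht
  -- If `a l c` is degenerate, then `z = p l`, which makes `p l` a vertex of `t` collinear with two
  -- others. Otherwise `z`, moved slightly towards a vertex off the base line, is an interior point
  -- of the base triangle that belongs to `t`.
  rcases eq_or_lt_of_le (H.nonneg a l c (by omega) hal hlc (by omega)) with he | hpos
  · rw [← he, mul_zero, zero_div] at z1 z2
    have hzl := apex z z1 z2
    rw [hzl] at hzt
    have hlt := hT.no_other_point t ht _ (mem_image_Icc hil.le hlj.le) hzt
    exact signedArea_ne_zero_of_mem hcard haff hat hlt hct hal' hac hlc' he.symm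
  · have z1' : 0 < signedArea (p i) (p l) z := by rw [z1]; positivity
    have z2' : 0 < signedArea (p l) (p j) z := by rw [z2]; positivity
    have nn3 : ∀ x ∈ (t : Set Plane), 0 ≤ areaMap (p j) (p i) x := by
      intro x hx
      obtain ⟨m, hm, rfl⟩ := hT.vertices_subset t ht hx
      exact H.nonneg_base hi0 hm.1 hm.2 hj
    have z3 := nonneg_of_mem_convexHull (areaMap (p j) (p i)) nn3 hzt
    obtain ⟨x, y, w, hxy, hxw, hyw, htxyw⟩ := Finset.card_eq_three.1 hcard
    have harea : signedArea x y w ≠ 0 := signedArea_ne_zero_of_mem hcard haff (by simp [htxyw])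
      (by simp [htxyw]) (by simp [htxyw]) hxy hxw hyw
    have : ∃ b ∈ t, 0 < signedArea (p j) (p i) b := by
      by_contra! hcon
      have hzero : ∀ b ∈ t, signedArea (p j) (p i) b = 0 := fun b hb =>
        le_antisymm (hcon b hb) (nn3 b hb)
      exact harea (signedArea_eq_zero_of_line (H.ne hi0 (by omega) hj).symm
        (hzero x (by simp [htxyw])) (hzero y (by simp [htxyw])) (hzero w (by simp [htxyw])))
    obtain ⟨b, hbt, hb⟩ := this
    have hcont : Filter.Tendsto (fun e : ℝ => (1 - e) • z + e • b) (nhdsWithin 0 (Set.Ioi 0))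
        (nhds z) := by
      have : Continuous fun e : ℝ => (1 - e) • z + e • b := by fun_prop
      have h := this.tendsto 0
      simp only [sub_zero, one_smul, zero_smul, add_zero] at h
      exact h.mono_left nhdsWithin_le_nhds
    have ev1 := ((continuous_signedArea (p i) (p l)).tendsto z).comp hcont |>.eventually
      (lt_mem_nhds z1')
    have ev2 := ((continuous_signedArea (p l) (p j)).tendsto z).comp hcont |>.eventually
      (lt_mem_nhds z2')
    have ev3 : ∀ᶠ e : ℝ in nhdsWithin 0 (Set.Ioi 0), e < 1 :=
      nhdsWithin_le_nhds (gt_mem_nhds one_pos)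
    obtain ⟨e, ⟨⟨h1, h2⟩, h3⟩, h4⟩ := (((ev1.and ev2).and ev3).and self_mem_nhdsWithin).exists
    have h4' : 0 < e := h4
    have hsum : (1 - e) + e = 1 := by ring
    have h5 := AffineMap.map_combo (areaMap (p j) (p i)) z b hsum
    have h5' : 0 < signedArea (p j) (p i) ((1 - e) • z + e • b) := by
      simp only [areaMap_apply] at h5 z3
      rw [h5]
      have := mul_nonneg (sub_pos.2 h3).le z3
      have := mul_pos h4' hb
      linarith
    have hin := mem_interior_triple hD h1 h2 h5'
    have hmem : (1 - e) • z + e • b ∈ convexHull ℝ (t : Set Plane) :=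
      convex_convexHull ℝ _ hzt (subset_convexHull ℝ _ hbt) (sub_pos.2 h3).le h4'.le hsum
    have hd := hT.disjoint_interiors t ht _ h0 hne
    have ct : (t : Set Plane) = {x, y, w} := by rw [htxyw]; simp
    have c0 : ((({p i, p l, p j} : Finset Plane)) : Set Plane) = {p i, p l, p j} := by simp
    rw [ct, c0] at hd
    rw [ct] at hmem
    exact interiors_meet_of_ne_zero harea hmem hin hd

end chain

section chain

variable {p : ℕ → Plane} {L : ℕ → ℕ → Prop} {lo hi : ℕ}

/-- Restricting a triangulation to the part cut off by the chord from `i` to `l`. -/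
theorem IsLegalTriangulation.restrict {i j a b : ℕ} {T : Finset (Finset Plane)}
    (hT : IsLegalTriangulation p L i j T) (hia : i ≤ a) (hbj : b ≤ j)
    (hcov : convexHull ℝ (p '' Set.Icc a b) ⊆
      ⋃ t ∈ T.filter (fun t : Finset Plane => (t : Set Plane) ⊆ p '' Set.Icc a b), convexHull ℝ (t : Set Plane)) :
    IsLegalTriangulation p L a b
      (T.filter fun t : Finset Plane => (t : Set Plane) ⊆ p '' Set.Icc a b) := by
  have hsub : p '' Set.Icc a b ⊆ p '' Set.Icc i j := Set.image_mono (Set.Icc_subset_Icc hia hbj)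
  have h := hT.isTriangulation
  refine ⟨⟨?_, ?_, ?_, ?_, ?_, ?_⟩, ?_⟩
  · exact fun t ht => h.card_eq_three t (Finset.mem_filter.1 ht).1
  · exact fun t ht => h.affineIndependent t (Finset.mem_filter.1 ht).1
  · exact fun t ht => (Finset.mem_filter.1 ht).2
  · exact fun t ht q hq => h.no_other_point t (Finset.mem_filter.1 ht).1 q (hsub hq)
  · exact fun t ht t' ht' => h.disjoint_interiors t (Finset.mem_filter.1 ht).1 t'
      (Finset.mem_filter.1 ht').1
  · exact Set.Subset.antisymm
      (Set.iUnion₂_subset fun t ht => convexHull_mono (Finset.mem_filter.1 ht).2) hcov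
  · exact fun t ht c d hc hcd hd => hT.legal t (Finset.mem_filter.1 ht).1 c d (hia.trans hc) hcd
      (hd.trans hbj)

/-- A closed set containing the points of a convex set on one side of a line contains all points
of the convex set, if one of them is strictly on that side. -/
theorem subset_of_halfspace {C U : Set Plane} (hC : Convex ℝ C) (hU : IsClosed U) {q r m : Plane}
    (hm : m ∈ C) (hm0 : signedArea q r m < 0) (hle : ∀ x ∈ C, signedArea q r x ≤ 0)
    (hsub : ∀ x ∈ C, signedArea q r x < 0 → x ∈ U) : C ⊆ U := by
  intro x hx
  have hcont : Filter.Tendsto (fun e : ℝ => (1 - e) • x + e • m) (nhdsWithin 0 (Set.Ioi 0))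
      (nhds x) := by
    have : Continuous fun e : ℝ => (1 - e) • x + e • m := by fun_prop
    have h := this.tendsto 0
    simp only [sub_zero, one_smul, zero_smul, add_zero] at h
    exact h.mono_left nhdsWithin_le_nhds
  refine hU.mem_of_tendsto hcont ?_
  have ev3 : ∀ᶠ e : ℝ in nhdsWithin 0 (Set.Ioi 0), e < 1 :=
    nhdsWithin_le_nhds (gt_mem_nhds one_pos)
  filter_upwards [ev3, self_mem_nhdsWithin] with e he he0
  have he0' : 0 < e := he0
  have hsum : (1 - e) + e = 1 := by ring
  refine hsub _ (hC hx hm (sub_pos.2 he).le he0'.le hsum) ?_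
  have h5 := AffineMap.map_combo (areaMap q r) x m hsum
  simp only [areaMap_apply] at h5
  rw [h5]
  have := mul_pos he0' (neg_pos.2 hm0)
  have := mul_nonneg (sub_pos.2 he).le (neg_nonneg.2 (hle x hx))
  linarith

theorem isClosed_iUnion_hull (T : Finset (Finset Plane)) :
    IsClosed (⋃ t ∈ T, convexHull ℝ (t : Set Plane)) :=
  T.finite_toSet.isClosed_biUnion fun t _ => (t.finite_toSet.isCompact_convexHull (𝕜 := ℝ)).isClosed

theorem IsTriangulation.eq_empty_of_edge {i : ℕ} {T : Finset (Finset Plane)}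
    (h : ∀ t ∈ T, t.card = 3) :
    T.filter (fun t : Finset Plane => (t : Set Plane) ⊆ p '' Set.Icc i (i + 1)) = ∅ := by
  rw [Finset.filter_eq_empty_iff]
  intro t ht hsub
  have hsub' : t ⊆ (Finset.Icc i (i + 1)).image p := by
    intro x hx
    simpa using hsub hx
  have h1 := Finset.card_le_card hsub'
  have h2 := (Finset.card_image_le (s := Finset.Icc i (i + 1)) (f := p))
  rw [Nat.card_Icc] at h2
  have := h t ht
  omega

/-- Induction on a bound for `j - i`. No triangle crosses the base triangle, so every other one has
all its vertices on one side of the apex `l`, and the two groups triangulate the two sides. -/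
theorem IsConvexChain.isSplit_of_isLegal (H : IsConvexChain p L lo hi) : ∀ (n i j : ℕ)
    (T : Finset (Finset Plane)), j ≤ i + n → lo ≤ i → j ≤ hi → i + 1 < j → L i j →
      IsLegalTriangulation p L i j T → IsSplit p L i j T := by
  intro n
  induction n with
  | zero => intro i j T h1 h2 h3 h4; omega
  | succ n ih =>
    intro i j T hn hi0 hj hij hL hT
    obtain ⟨l, hil, hlj, h0⟩ := H.exists_base_triangle hT.isTriangulation hi0 hj hij hL
    have n1 : p i ≠ p l := H.ne hi0 hil (by omega)
    have n2 : p l ≠ p j := H.ne (by omega) hlj hj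
    have n3 : p i ≠ p j := H.ne (by omega) (by omega) hj
    have hcard := hT.isTriangulation.card_eq_three
    have hD : 0 < signedArea (p i) (p l) (p j) :=
      lt_of_le_of_ne (H.nonneg i l j hi0 hil hlj hj) (signedArea_ne_zero_of_mem
        (hcard _ h0) (hT.isTriangulation.affineIndependent _ h0) (by simp) (by simp) (by simp)
        n1 n3 n2).symm
    have hL1 : i + 1 < l → L i l := fun h =>
      hT.legal _ h0 i l le_rfl h hlj.le (by simp) (by simp)
    have hL2 : l + 1 < j → L l j := fun h =>
      hT.legal _ h0 l j hil.le h le_rfl (by simp) (by simp)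
    have c0 : ((({p i, p l, p j} : Finset Plane)) : Set Plane) = {p i, p l, p j} := by simp
    set T₁ := T.filter (fun t : Finset Plane => (t : Set Plane) ⊆ p '' Set.Icc i l) with hT1
    set T₂ := T.filter (fun t : Finset Plane => (t : Set Plane) ⊆ p '' Set.Icc l j) with hT2
    have hside : ∀ t ∈ T, t = {p i, p l, p j} ∨ t ∈ T₁ ∨ t ∈ T₂ := by
      intro t ht
      by_contra! hcon
      obtain ⟨hne, h1, h2⟩ := hcon
      have h1' : ¬ (t : Set Plane) ⊆ p '' Set.Icc i l := fun h => h1 (Finset.mem_filter.2 ⟨ht, h⟩)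
      have h2' : ¬ (t : Set Plane) ⊆ p '' Set.Icc l j := fun h => h2 (Finset.mem_filter.2 ⟨ht, h⟩)
      obtain ⟨x, hxt, hx⟩ := Set.not_subset.1 h1'
      obtain ⟨y, hyt, hy⟩ := Set.not_subset.1 h2'
      obtain ⟨c, hc, rfl⟩ := hT.isTriangulation.vertices_subset t ht hxt
      obtain ⟨a, ha, rfl⟩ := hT.isTriangulation.vertices_subset t ht hyt
      have hlc : l < c := by
        by_contra h
        exact hx (mem_image_Icc hc.1 (not_lt.1 h))
      have hal : a < l := by
        by_contra h
        exact hy (mem_image_Icc (not_lt.1 h) ha.2)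
      exact H.not_crossing hT.isTriangulation hi0 hj hil hlj h0 ht hne ha.1 hal hlc hc.2 hyt hxt
    have hTeq : T = insert {p i, p l, p j} (T₁ ∪ T₂) := by
      ext t
      simp only [Finset.mem_insert, Finset.mem_union]
      constructor
      · exact hside t
      · rintro (rfl | h | h)
        · exact h0
        · exact (Finset.mem_filter.1 h).1
        · exact (Finset.mem_filter.1 h).1
    have sub1 : p '' Set.Icc i l ⊆ p '' Set.Icc i j :=
      Set.image_mono (Set.Icc_subset_Icc le_rfl hlj.le)
    have sub2 : p '' Set.Icc l j ⊆ p '' Set.Icc i j :=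
      Set.image_mono (Set.Icc_subset_Icc hil.le le_rfl)
    have r1 : IsSplit p L i l T₁ := by
      rcases eq_or_lt_of_le (show i + 1 ≤ l from hil) with rfl | hil'
      · rw [hT1, IsTriangulation.eq_empty_of_edge hcard]
        exact IsSplit.edge i
      · refine ih i l T₁ (by omega) hi0 (by omega) hil' (hL1 hil') (hT.restrict le_rfl hlj.le ?_)
        -- Strictly right of the chord, only triangles of the group `T₁` can cover. Points on the
        -- chord itself follow because a finite union of triangles is closed; the neighbour `i + 1`
        -- of `i` is a point strictly on that side.
        refine subset_of_halfspace (q := p i) (r := p l) (convex_convexHull ℝ _)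
          (isClosed_iUnion_hull _)
          (subset_convexHull ℝ _ (mem_image_Icc (Nat.le_succ i) hil'.le)) ?_ ?_ ?_
        · have := H.pos i (i + 1) l hi0 (by omega) hil' (by omega) (hL1 hil') (by omega)
          rw [signedArea_swap] at this
          linarith
        · exact fun x hx => H.hull_left_nonpos hi0 (by omega) hx
        · intro x hx hneg
          have hx' := convexHull_mono sub1 hx
          rw [← hT.isTriangulation.cover, Set.mem_iUnion₂] at hx'
          obtain ⟨t, ht, hxt⟩ := hx'
          rw [Set.mem_iUnion₂]
          refine ⟨t, ?_, hxt⟩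
          rcases hside t ht with rfl | h | h
          · rw [c0] at hxt
            linarith [(triangle_nonneg hD hxt).1]
          · exact h
          · linarith [H.hull_nonneg_left hi0 hil hj
              (convexHull_mono (Finset.mem_filter.1 h).2 hxt)]
    have r2 : IsSplit p L l j T₂ := by
      rcases eq_or_lt_of_le (show l + 1 ≤ j from hlj) with rfl | hlj'
      · rw [hT2, IsTriangulation.eq_empty_of_edge hcard]
        exact IsSplit.edge l
      · refine ih l j T₂ (by omega) (by omega) hj hlj' (hL2 hlj') (hT.restrict hil.le le_rfl ?_)
        refine subset_of_halfspace (q := p l) (r := p j) (convex_convexHull ℝ _)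
          (isClosed_iUnion_hull _)
          (subset_convexHull ℝ _ (mem_image_Icc (Nat.le_succ l) hlj'.le)) ?_ ?_ ?_
        · have := H.pos l (l + 1) j (by omega) (by omega) hlj' (by omega) (hL2 hlj') (by omega)
          rw [signedArea_swap] at this
          linarith
        · exact fun x hx => H.hull_left_nonpos (by omega) hj hx
        · intro x hx hneg
          have hx' := convexHull_mono sub2 hx
          rw [← hT.isTriangulation.cover, Set.mem_iUnion₂] at hx'
          obtain ⟨t, ht, hxt⟩ := hx'
          rw [Set.mem_iUnion₂]
          refine ⟨t, ?_, hxt⟩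
          rcases hside t ht with rfl | h | h
          · rw [c0] at hxt
            linarith [(triangle_nonneg hD hxt).2]
          · linarith [H.hull_nonneg_right hi0 hlj hj
              (convexHull_mono (Finset.mem_filter.1 h).2 hxt)]
          · exact h
    rw [hTeq]
    exact IsSplit.join i l j T₁ T₂ r1 r2 hL

theorem IsConvexChain.isLegal_iff_isSplit (H : IsConvexChain p L lo hi) (hlt : lo + 1 < hi)
    (hL : L lo hi) {T : Finset (Finset Plane)} :
    IsLegalTriangulation p L lo hi T ↔ IsSplit p L lo hi T := by
  constructor
  · exact H.isSplit_of_isLegal (hi - lo) lo hi T (by omega) le_rfl le_rfl hlt hL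
  · intro h
    rcases H.isLegal_of_isSplit h le_rfl le_rfl with ⟨h, -⟩ | h
    · omega
    · exact h.2

end chain

/-! ### Counting splits -/

/-- The number of ways to split the interval from `i` to `j` recursively, through intervals that
are steps or related by `L`. -/
def splitCount (L : ℕ → ℕ → Prop) (i j : ℕ) : ℕ :=
  if j = i + 1 then 1
  else if L i j then
    ∑ l ∈ (Finset.Ioo i j).attach,
      have := Finset.mem_Ioo.1 l.2
      splitCount L i l * splitCount L l j
  else 0
termination_by j - i

theorem splitCount_succ (L : ℕ → ℕ → Prop) (i : ℕ) : splitCount L i (i + 1) = 1 := by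
  rw [splitCount, if_pos rfl]

theorem splitCount_of_not (L : ℕ → ℕ → Prop) {i j : ℕ} (hij : j ≠ i + 1) (h : ¬ L i j) :
    splitCount L i j = 0 := by
  rw [splitCount, if_neg hij, if_neg h]

theorem splitCount_eq_sum (L : ℕ → ℕ → Prop) {i j : ℕ} (hij : j ≠ i + 1) (h : L i j) :
    splitCount L i j = ∑ l ∈ Finset.Ioo i j, splitCount L i l * splitCount L l j := by
  rw [splitCount, if_neg hij, if_pos h]
  exact Finset.sum_attach (Finset.Ioo i j) fun l => splitCount L i l * splitCount L l j

section count

variable {p : ℕ → Plane} {L : ℕ → ℕ → Prop} {lo hi : ℕ}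

theorem IsSplit.subset {i j : ℕ} {T : Finset (Finset Plane)} (h : IsSplit p L i j T) :
    ∀ t ∈ T, (t : Set Plane) ⊆ p '' Set.Icc i j := by
  induction h with
  | edge i => simp
  | join i l j T₁ T₂ h1 h2 _ ih1 ih2 =>
    have := h1.lt
    have := h2.lt
    intro t ht
    simp only [Finset.mem_insert, Finset.mem_union] at ht
    rcases ht with rfl | ht | ht
    · simpa using triple_subset_image (p := p) h1.lt.le h2.lt.le
    · exact (ih1 t ht).trans (Set.image_mono (Set.Icc_subset_Icc le_rfl h2.lt.le))
    · exact (ih2 t ht).trans (Set.image_mono (Set.Icc_subset_Icc h1.lt.le le_rfl))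

theorem IsSplit.card (hp : Set.InjOn p (Set.Icc lo hi)) {i j : ℕ} {T : Finset (Finset Plane)}
    (h : IsSplit p L i j T) (hi0 : lo ≤ i) (hj : j ≤ hi) : ∀ t ∈ T, t.card = 3 := by
  induction h with
  | edge i => simp
  | join i l j T₁ T₂ h1 h2 _ ih1 ih2 =>
    have a1 := h1.lt
    have a2 := h2.lt
    intro t ht
    simp only [Finset.mem_insert, Finset.mem_union] at ht
    rcases ht with rfl | ht | ht
    · refine Finset.card_eq_three.2 ⟨p i, p l, p j, fun e => ?_, fun e => ?_, fun e => ?_, rfl⟩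
      all_goals
        have := hp ⟨by omega, by omega⟩ ⟨by omega, by omega⟩ e
        omega
    · exact ih1 hi0 (by omega) t ht
    · exact ih2 (by omega) hj t ht

theorem not_mem_image_of_gt (hp : Set.InjOn p (Set.Icc lo hi)) {i l m : ℕ} (hi0 : lo ≤ i)
    (hlm : l < m) (hm0 : lo ≤ m) (hm : m ≤ hi) : p m ∉ p '' Set.Icc i l := by
  rintro ⟨a, ha, e⟩
  have := hp ⟨hi0.trans ha.1, ha.2.trans (hlm.le.trans hm)⟩ ⟨hm0, hm⟩ e
  have := ha.2
  omega

theorem not_mem_image_of_lt (hp : Set.InjOn p (Set.Icc lo hi)) {l j m : ℕ} (hm0 : lo ≤ m)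
    (hml : m < l) (hm : m ≤ hi) (hj : j ≤ hi) : p m ∉ p '' Set.Icc l j := by
  rintro ⟨a, ha, e⟩
  have := hp ⟨hm0.trans (hml.le.trans ha.1), ha.2.trans hj⟩ ⟨hm0, hm⟩ e
  have := ha.1
  omega

/-- The parts of a split are determined by the split. -/
theorem IsSplit.join_inj (hp : Set.InjOn p (Set.Icc lo hi)) {i j l l' : ℕ}
    {T₁ T₂ T₁' T₂' : Finset (Finset Plane)} (hi0 : lo ≤ i) (hj : j ≤ hi)
    (h1 : IsSplit p L i l T₁) (h2 : IsSplit p L l j T₂) (h1' : IsSplit p L i l' T₁')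
    (h2' : IsSplit p L l' j T₂')
    (h : (insert {p i, p l, p j} (T₁ ∪ T₂) : Finset (Finset Plane)) =
      insert {p i, p l', p j} (T₁' ∪ T₂')) :
    l = l' ∧ T₁ = T₁' ∧ T₂ = T₂' := by
  have a1 := h1.lt
  have a2 := h2.lt
  have a1' := h1'.lt
  have a2' := h2'.lt
  -- The base triangle is the only one containing both `p i` and `p j`, so it determines the apex.
  have hll : l = l' := by
    have hmem : ({p i, p l, p j} : Finset Plane) ∈ insert {p i, p l', p j} (T₁' ∪ T₂') := by
      rw [← h]; simp
    simp only [Finset.mem_insert, Finset.mem_union] at hmem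
    rcases hmem with hmem | hmem | hmem
    · have : p l ∈ ({p i, p l', p j} : Finset Plane) := by rw [← hmem]; simp
      simp only [Finset.mem_insert, Finset.mem_singleton] at this
      rcases this with e | e | e
      · have := hp ⟨by omega, by omega⟩ ⟨by omega, by omega⟩ e
        omega
      · exact hp ⟨by omega, by omega⟩ ⟨by omega, by omega⟩ e
      · have := hp ⟨by omega, by omega⟩ ⟨by omega, by omega⟩ e
        omega
    · exact absurd (h1'.subset _ hmem (by simp : p j ∈ _))
        (not_mem_image_of_gt hp hi0 a2' (by omega) hj)
    · exact absurd (h2'.subset _ hmem (by simp : p i ∈ _))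
        (not_mem_image_of_lt hp hi0 a1' (by omega) hj)
  subst hll
  have n0 : ¬ ((({p i, p l, p j} : Finset Plane)) : Set Plane) ⊆ p '' Set.Icc i l := fun h =>
    not_mem_image_of_gt hp hi0 a2 (by omega) hj (h (by simp : p j ∈ _))
  have n0' : ¬ ((({p i, p l, p j} : Finset Plane)) : Set Plane) ⊆ p '' Set.Icc l j := fun h =>
    not_mem_image_of_lt hp hi0 a1 (by omega) hj (h (by simp : p i ∈ _))
  -- The two groups of triangles share at most the point `p l`, so each is recovered by filtering
  -- for the vertices.
  have small : ∀ t : Finset Plane, t.card = 3 → (t : Set Plane) ⊆ p '' Set.Icc i l →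
      ¬ (t : Set Plane) ⊆ p '' Set.Icc l j := by
    intro t ht hs1 hs2
    have hsub : t ⊆ {p l} := by
      intro x hx
      obtain ⟨a, ha, rfl⟩ := hs1 hx
      obtain ⟨b, hb, e⟩ := hs2 hx
      have ha1 := ha.1
      have ha2 := ha.2
      have hb1 := hb.1
      have hb2 := hb.2
      have := hp ⟨by omega, by omega⟩ ⟨by omega, by omega⟩ e
      obtain rfl : a = l := by omega
      simp
    have := Finset.card_le_card hsub
    rw [ht] at this
    simp at this
  have f1 : ∀ T₁ T₂, IsSplit p L i l T₁ → IsSplit p L l j T₂ →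
      (insert {p i, p l, p j} (T₁ ∪ T₂)).filter (fun t : Finset Plane =>
        (t : Set Plane) ⊆ p '' Set.Icc i l) = T₁ := by
    intro T₁ T₂ h1 h2
    ext t
    simp only [Finset.mem_filter, Finset.mem_insert, Finset.mem_union]
    constructor
    · rintro ⟨rfl | ht | ht, hs⟩
      · exact absurd hs n0
      · exact ht
      · exact absurd (h2.subset t ht) (small t (h2.card hp (by omega) hj t ht) hs)
    · exact fun ht => ⟨Or.inr (Or.inl ht), h1.subset t ht⟩
  have f2 : ∀ T₁ T₂, IsSplit p L i l T₁ → IsSplit p L l j T₂ →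
      (insert {p i, p l, p j} (T₁ ∪ T₂)).filter (fun t : Finset Plane =>
        (t : Set Plane) ⊆ p '' Set.Icc l j) = T₂ := by
    intro T₁ T₂ h1 h2
    ext t
    simp only [Finset.mem_filter, Finset.mem_insert, Finset.mem_union]
    constructor
    · rintro ⟨rfl | ht | ht, hs⟩
      · exact absurd hs n0'
      · exact absurd hs (small t (h1.card hp (by omega) (by omega) t ht) (h1.subset t ht))
      · exact ht
    · exact fun ht => ⟨Or.inr (Or.inr ht), h2.subset t ht⟩
  refine ⟨rfl, ?_, ?_⟩
  · rw [← f1 T₁ T₂ h1 h2, h, f1 T₁' T₂' h1' h2']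
  · rw [← f2 T₁ T₂ h1 h2, h, f2 T₁' T₂' h1' h2']

theorem IsSplit.eq_empty_of_edge {i j : ℕ} {T : Finset (Finset Plane)} (h : IsSplit p L i j T)
    (hj : j = i + 1) : T = ∅ := by
  cases h with
  | edge => rfl
  | join _ l _ _ _ h1 h2 =>
    have := h1.lt
    have := h2.lt
    omega

/-- The splits with apex `l` are in bijection with pairs of splits of the two parts, and different
apices give different splits; both facts are `IsSplit.join_inj`. The set of splits is exhibited as a
finite set so that cardinalities can be multiplied and added. -/
theorem exists_finset_isSplit (L : ℕ → ℕ → Prop) (hp : Set.InjOn p (Set.Icc lo hi)) (n : ℕ) :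
    ∀ i j, j ≤ i + n → lo ≤ i → i < j → j ≤ hi → ∃ F : Finset (Finset (Finset Plane)),
      (∀ T, T ∈ F ↔ IsSplit p L i j T) ∧ F.card = splitCount L i j := by
  induction n with
  | zero => intro i j h1 _ h2; omega
  | succ n ih =>
    intro i j hn hi0 hij hj
    by_cases he : j = i + 1
    · subst he
      refine ⟨{∅}, fun T => ?_, by simp [splitCount_succ]⟩
      rw [Finset.mem_singleton]
      exact ⟨fun h => h ▸ IsSplit.edge i, fun h => h.eq_empty_of_edge rfl⟩
    by_cases hL : L i j
    swap
    · refine ⟨∅, fun T => ?_, by simp [splitCount_of_not L he hL]⟩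
      simp only [Finset.notMem_empty, false_iff]
      intro h
      rcases h.legal_or with h | h
      · omega
      · exact hL h
    have hF1 : ∀ l, ∃ F : Finset (Finset (Finset Plane)), i < l → l < j →
        (∀ T, T ∈ F ↔ IsSplit p L i l T) ∧ F.card = splitCount L i l := by
      intro l
      by_cases h : i < l ∧ l < j
      · obtain ⟨F, hF⟩ := ih i l (by omega) hi0 h.1 (by omega)
        exact ⟨F, fun _ _ => hF⟩
      · exact ⟨∅, fun h1 h2 => absurd ⟨h1, h2⟩ h⟩
    have hF2 : ∀ l, ∃ F : Finset (Finset (Finset Plane)), i < l → l < j →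
        (∀ T, T ∈ F ↔ IsSplit p L l j T) ∧ F.card = splitCount L l j := by
      intro l
      by_cases h : i < l ∧ l < j
      · obtain ⟨F, hF⟩ := ih l j (by omega) (by omega) h.2 hj
        exact ⟨F, fun _ _ => hF⟩
      · exact ⟨∅, fun h1 h2 => absurd ⟨h1, h2⟩ h⟩
    choose F₁ hF₁ using hF1
    choose F₂ hF₂ using hF2
    let G : ℕ → Finset (Finset (Finset Plane)) := fun l =>
      (F₁ l ×ˢ F₂ l).image fun T => insert {p i, p l, p j} (T.1 ∪ T.2)
    have hG : ∀ l, i < l → l < j → ∀ T, T ∈ G l ↔ ∃ T₁ T₂, IsSplit p L i l T₁ ∧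
        IsSplit p L l j T₂ ∧ insert {p i, p l, p j} (T₁ ∪ T₂) = T := by
      intro l h1 h2 T
      simp only [G, Finset.mem_image, Finset.mem_product, Prod.exists, (hF₁ l h1 h2).1,
        (hF₂ l h1 h2).1, and_assoc]
    refine ⟨(Finset.Ioo i j).biUnion G, fun T => ?_, ?_⟩
    · simp only [Finset.mem_biUnion, Finset.mem_Ioo]
      constructor
      · rintro ⟨l, ⟨h1, h2⟩, hT⟩
        obtain ⟨T₁, T₂, hs1, hs2, rfl⟩ := (hG l h1 h2 T).1 hT
        exact IsSplit.join i l j T₁ T₂ hs1 hs2 hL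
      · intro hT
        cases hT with
        | edge => exact absurd rfl he
        | join _ l _ T₁ T₂ hs1 hs2 _ =>
          exact ⟨l, ⟨hs1.lt, hs2.lt⟩, (hG l hs1.lt hs2.lt _).2 ⟨T₁, T₂, hs1, hs2, rfl⟩⟩
    · rw [Finset.card_biUnion, splitCount_eq_sum L he hL]
      · refine Finset.sum_congr rfl fun l hl => ?_
        obtain ⟨h1, h2⟩ := Finset.mem_Ioo.1 hl
        rw [Finset.card_image_of_injOn, Finset.card_product, (hF₁ l h1 h2).2, (hF₂ l h1 h2).2]
        rintro ⟨T₁, T₂⟩ hT ⟨T₁', T₂'⟩ hT' heq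
        simp only [Finset.coe_product, Set.mem_prod, Finset.mem_coe, (hF₁ l h1 h2).1,
          (hF₂ l h1 h2).1] at hT hT'
        obtain ⟨-, e1, e2⟩ := IsSplit.join_inj hp hi0 hj hT.1 hT.2 hT'.1 hT'.2 heq
        rw [e1, e2]
      · intro l hl l' hl' hne
        obtain ⟨h1, h2⟩ := Finset.mem_Ioo.1 hl
        obtain ⟨h1', h2'⟩ := Finset.mem_Ioo.1 hl'
        rw [Function.onFun, Finset.disjoint_left]
        intro T hT hT'
        obtain ⟨T₁, T₂, hs1, hs2, rfl⟩ := (hG l h1 h2 T).1 hT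
        obtain ⟨T₁', T₂', hs1', hs2', e⟩ := (hG l' h1' h2' _).1 hT'
        exact hne (IsSplit.join_inj hp hi0 hj hs1 hs2 hs1' hs2' e.symm).1

theorem IsConvexChain.ncard_isLegal (H : IsConvexChain p L lo hi) (hlt : lo + 1 < hi)
    (hL : L lo hi) : {T | IsLegalTriangulation p L lo hi T}.ncard = splitCount L lo hi := by
  obtain ⟨F, hF, hcard⟩ := exists_finset_isSplit L H.injOn (hi - lo) lo hi (by omega) le_rfl
    (by omega) le_rfl
  rw [← hcard, ← Set.ncard_coe_finset]
  congr 1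
  ext T
  simp only [Set.mem_ofPred_eq, Finset.mem_coe, hF]
  exact H.isLegal_iff_isSplit hlt hL

end count

/-! ### Subdivided convex polygons as convex chains -/

/-- The admissible chords between points `1, …, k * r`, the last of which is the corner `0`: the
base chord, and the chords whose end points are not in a common string. -/
def Admissible (k r a b : ℕ) : Prop :=
  (a = 1 ∧ b = k * r) ∨ ((∀ i, ¬ (i * r ≤ a ∧ b ≤ (i + 1) * r)) ∧ ¬ (b = k * r ∧ a ≤ r))

section corners

variable {k : ℕ} {c : ℕ → Plane}

/-- The index `k` is a second name for the corner `0`, at which the last side ends. Rotation reduces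
it to the definition; only `x = 0`, `z = k` has to be excluded, where two corners coincide. -/
theorem IsConvexPolygon.pos (hc : IsConvexPolygon k c) {x y z : ℕ} (hxy : x < y) (hyz : y < z)
    (hz : z ≤ k) (h : 0 < x ∨ z < k) : 0 < signedArea (c x) (c y) (c z) := by
  rcases eq_or_lt_of_le hz with rfl | hz
  · rw [hc.1, signedArea_rotate]
    exact hc.2 0 x y (by omega) hxy hyz
  · exact hc.2 x y z hxy hyz hz

theorem IsConvexPolygon.nonneg (hc : IsConvexPolygon k c) {x y z : ℕ} (hxy : x ≤ y) (hyz : y ≤ z)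
    (hz : z ≤ k) : 0 ≤ signedArea (c x) (c y) (c z) := by
  rcases eq_or_lt_of_le hxy with rfl | hxy
  · rw [signedArea_self_left]
  rcases eq_or_lt_of_le hyz with rfl | hyz
  · rw [signedArea_self_right]
  by_cases h : 0 < x ∨ z < k
  · exact (hc.pos hxy hyz hz h).le
  · obtain rfl : x = 0 := by omega
    obtain rfl : z = k := by omega
    rw [hc.1, signedArea_self_outer]

theorem IsConvexPolygon.ne_succ (hc : IsConvexPolygon k c) (hk : 3 ≤ k) {i : ℕ} (hi : i < k) :
    c i ≠ c (i + 1) := by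
  intro h
  by_cases h2 : i + 2 ≤ k
  · have := hc.pos (Nat.lt_succ_self i) (Nat.lt_succ_self (i + 1)) h2 (by omega)
    rw [h, signedArea_self_left] at this
    exact lt_irrefl _ this
  · have := hc.pos (show 1 < i by omega) (Nat.lt_succ_self i) (by omega) (by omega)
    rw [← h, signedArea_self_right] at this
    exact lt_irrefl _ this

end corners

theorem lineMap_combo (x y : Plane) (s : ℝ) : AffineMap.lineMap x y s = (1 - s) • x + s • y :=
  AffineMap.lineMap_apply_module _ _ _

theorem signedArea_lineMap_right (a b x y : Plane) (s : ℝ) :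
    signedArea a b (AffineMap.lineMap x y s) = (1 - s) * signedArea a b x + s * signedArea a b y := by
  rw [lineMap_combo]
  exact AffineMap.map_combo (areaMap a b) x y (by ring)

theorem signedArea_lineMap_mid (a b x y : Plane) (s : ℝ) :
    signedArea a (AffineMap.lineMap x y s) b = (1 - s) * signedArea a x b + s * signedArea a y b := by
  rw [signedArea_swap, signedArea_lineMap_right, signedArea_swap a b x, signedArea_swap a b y]; ring

theorem signedArea_lineMap_left (a b x y : Plane) (s : ℝ) :
    signedArea (AffineMap.lineMap x y s) a b = (1 - s) * signedArea x a b + s * signedArea y a b := by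
  rw [← signedArea_rotate (AffineMap.lineMap x y s), signedArea_lineMap_right, signedArea_rotate x,
    signedArea_rotate y]

theorem signedArea_swap_left (x y z : Plane) : signedArea y x z = -signedArea x y z := by
  unfold signedArea; ring

theorem signedArea_lineMap_lineMap (x y z : Plane) (s t : ℝ) :
    signedArea (AffineMap.lineMap x y s) (AffineMap.lineMap x y t) z =
      (t - s) * signedArea x y z := by
  simp only [signedArea_lineMap_left, signedArea_lineMap_mid, signedArea_self_left,
    signedArea_swap_left x y z]
  ring

theorem signedArea_eq_zero_of_mem_segment {x y z : Plane} (h : z ∈ segment ℝ x y) :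
    signedArea x y z = 0 := by
  obtain ⟨s, t, _, _, hst, rfl⟩ := h
  have := AffineMap.map_combo (areaMap x y) x y hst
  simpa [signedArea_self_outer, signedArea_self_right] using this

theorem lineMap_mem_segment_lineMap (x y : Plane) {s t u : ℝ} (hst : s ≤ t) (htu : t ≤ u) :
    AffineMap.lineMap x y t ∈ segment ℝ (AffineMap.lineMap x y s : Plane)
      (AffineMap.lineMap x y u) := by
  rw [← image_segment ℝ (AffineMap.lineMap x y : ℝ →ᵃ[ℝ] Plane) s u, segment_eq_Icc (hst.trans htu)]
  exact ⟨t, ⟨hst, htu⟩, rfl⟩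

/-- The boundary points of a subdivided polygon, numbered along the boundary such that the point
`i * r + j` is the `j`-th point on the side `i`, for `1 ≤ j ≤ r`. -/
def boundaryPoint (r : ℕ) (c : ℕ → Plane) (s : ℕ → ℕ → ℝ) (a : ℕ) : Plane :=
  AffineMap.lineMap (c ((a - 1) / r)) (c ((a - 1) / r + 1)) (s ((a - 1) / r) ((a - 1) % r + 1))

section subdivided

variable {k r : ℕ} {c : ℕ → Plane} {s : ℕ → ℕ → ℝ}

theorem boundaryPoint_mul_add (i : ℕ) {j : ℕ} (hj : 1 ≤ j) (hjr : j ≤ r) :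
    boundaryPoint r c s (i * r + j) = AffineMap.lineMap (c i) (c (i + 1)) (s i j) := by
  have h1 : (i * r + j - 1) / r = i := by
    rw [Nat.div_eq_iff (by omega)]
    constructor
    · omega
    · rw [Nat.add_sub_assoc (by omega)] ; omega
  have h2 : (i * r + j - 1) % r = j - 1 := by
    rw [show i * r + j - 1 = (j - 1) + r * i by rw [mul_comm r i]; omega, Nat.add_mul_mod_self_left,
      Nat.mod_eq_of_lt (by omega)]
  rw [boundaryPoint, h1, h2, Nat.sub_add_cancel hj]

theorem exists_side {a : ℕ} (ha : 1 ≤ a) (ha' : a ≤ k * r) :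
    ∃ i j, i < k ∧ 1 ≤ j ∧ j ≤ r ∧ a = i * r + j := by
  have hr : 0 < r := by
    rcases Nat.eq_zero_or_pos r with rfl | h
    · simp at ha'; omega
    · exact h
  refine ⟨(a - 1) / r, (a - 1) % r + 1, ?_, by omega, Nat.mod_lt _ hr, ?_⟩
  · rw [Nat.div_lt_iff_lt_mul hr]; omega
  · have := Nat.div_add_mod (a - 1) r
    rw [mul_comm] at this; omega

theorem side_le {i i' j j' : ℕ} (hj : 1 ≤ j) (hj' : j' ≤ r) (h : i * r + j < i' * r + j') :
    i ≤ i' := by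
  by_contra hcon
  have : (i' + 1) * r ≤ i * r := Nat.mul_le_mul_right r (by omega)
  rw [add_mul] at this
  omega

theorem subdivision_lt (hs : ∀ i < k, s i 0 = 0 ∧ s i r = 1 ∧ ∀ j < r, s i j < s i (j + 1))
    {i j j' : ℕ} (hi : i < k) (hj : j < j') (hj' : j' ≤ r) : s i j < s i j' := by
  induction j', hj using Nat.le_induction with
  | base => exact (hs i hi).2.2 j (by omega)
  | succ m hm ih => exact (ih (by omega)).trans ((hs i hi).2.2 m (by omega))

theorem subdivision_pos (hs : ∀ i < k, s i 0 = 0 ∧ s i r = 1 ∧ ∀ j < r, s i j < s i (j + 1))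
    {i j : ℕ} (hi : i < k) (hj : 0 < j) (hj' : j ≤ r) : 0 < s i j := by
  have := subdivision_lt hs hi hj hj'
  rwa [(hs i hi).1] at this

theorem subdivision_le_one (hs : ∀ i < k, s i 0 = 0 ∧ s i r = 1 ∧ ∀ j < r, s i j < s i (j + 1))
    {i j : ℕ} (hi : i < k) (hj' : j ≤ r) : s i j ≤ 1 := by
  rcases eq_or_lt_of_le hj' with rfl | h
  · exact (hs i hi).2.1.le
  · have := subdivision_lt hs hi h le_rfl
    rw [(hs i hi).2.1] at this
    exact this.le

theorem subdivision_lt_one (hs : ∀ i < k, s i 0 = 0 ∧ s i r = 1 ∧ ∀ j < r, s i j < s i (j + 1))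
    {i j : ℕ} (hi : i < k) (hj' : j < r) : s i j < 1 := by
  have := subdivision_lt hs hi hj' le_rfl
  rwa [(hs i hi).2.1] at this

/-- Orientation of three boundary points. -/
theorem boundaryPoint_area (hk : 3 ≤ k) (hc : IsConvexPolygon k c)
    (hs : ∀ i < k, s i 0 = 0 ∧ s i r = 1 ∧ ∀ j < r, s i j < s i (j + 1)) {a b e : ℕ} (ha : 1 ≤ a)
    (hab : a < b) (hbe : b < e) (he : e ≤ k * r) :
    0 < signedArea (boundaryPoint r c s a) (boundaryPoint r c s b) (boundaryPoint r c s e) ∨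
    (signedArea (boundaryPoint r c s a) (boundaryPoint r c s b) (boundaryPoint r c s e) = 0 ∧
      ((∃ i, i * r ≤ a ∧ e ≤ (i + 1) * r) ∨ (e = k * r ∧ b ≤ r))) := by
  obtain ⟨i1, j1, hi1, hj1, hjr1, rfl⟩ := exists_side ha (by omega : a ≤ k * r)
  obtain ⟨i2, j2, hi2, hj2, hjr2, rfl⟩ := exists_side (by omega : 1 ≤ b) (by omega : b ≤ k * r)
  obtain ⟨i3, j3, hi3, hj3, hjr3, rfl⟩ := exists_side (by omega : 1 ≤ e) he
  have h12 := side_le hj1 hjr2 hab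
  have h23 := side_le hj2 hjr3 hbe
  rw [boundaryPoint_mul_add i1 hj1 hjr1, boundaryPoint_mul_add i2 hj2 hjr2,
    boundaryPoint_mul_add i3 hj3 hjr3]
  have p1 := subdivision_pos hs hi1 hj1 hjr1
  have p2 := subdivision_pos hs hi2 hj2 hjr2
  have p3 := subdivision_pos hs hi3 hj3 hjr3
  have q1 := sub_nonneg.2 (subdivision_le_one hs hi1 hjr1)
  have q2 := sub_nonneg.2 (subdivision_le_one hs hi2 hjr2)
  have q3 := sub_nonneg.2 (subdivision_le_one hs hi3 hjr3)
  -- Cases according to which consecutive points share a side. If exactly two do, the area is a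
  -- positive multiple of the area spanned by that side and the third point; it vanishes only if the
  -- third point is an end of the side. The end may be the corner `0`, reached as the point `k * r`.
  rcases eq_or_lt_of_le h12 with rfl | h12 <;> rcases eq_or_lt_of_le h23 with rfl | h23
  · right
    refine ⟨?_, Or.inl ⟨i1, by omega, by rw [add_mul]; omega⟩⟩
    rw [signedArea_lineMap_lineMap, signedArea_lineMap_right, signedArea_self_outer,
      signedArea_self_right]
    ring
  · have hlt := sub_pos.2 (subdivision_lt hs hi1 (by omega : j1 < j2) hjr2)
    rw [signedArea_lineMap_lineMap, signedArea_lineMap_right]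
    have n1 := mul_nonneg q3 (hc.nonneg (Nat.le_succ i1) (by omega : i1 + 1 ≤ i3) hi3.le)
    have n2 := mul_nonneg p3.le (hc.nonneg (Nat.le_succ i1) (by omega : i1 + 1 ≤ i3 + 1) hi3)
    by_cases hw : i1 = 0 ∧ i3 + 1 = k
    · obtain ⟨rfl, rfl⟩ := hw
      rcases eq_or_lt_of_le hjr3 with rfl | hj3'
      · right
        refine ⟨?_, Or.inr ⟨by ring, by omega⟩⟩
        rw [(hs i3 hi3).2.1, hc.1, signedArea_self_outer]
        ring
      · left
        have := mul_pos (sub_pos.2 (subdivision_lt_one hs hi3 hj3'))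
          (hc.pos (show 0 < 0 + 1 by omega) (by omega : 0 + 1 < i3) hi3.le (by omega))
        exact mul_pos hlt (by linarith)
    · left
      have := mul_pos p3 (hc.pos (Nat.lt_succ_self i1) (by omega : i1 + 1 < i3 + 1) hi3 (by omega))
      exact mul_pos hlt (by linarith)
  · have hlt := sub_pos.2 (subdivision_lt hs hi2 (by omega : j2 < j3) hjr3)
    rw [← signedArea_rotate, signedArea_lineMap_lineMap, signedArea_lineMap_right,
      signedArea_rotate (c i1), signedArea_rotate (c (i1 + 1))]
    have n1 := mul_nonneg q1 (hc.nonneg h12.le (Nat.le_succ i2) hi2)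
    have n2 := mul_nonneg p1.le (hc.nonneg (by omega : i1 + 1 ≤ i2) (Nat.le_succ i2) hi2)
    by_cases hw : i1 + 1 = i2
    · subst hw
      rcases eq_or_lt_of_le hjr1 with rfl | hj1'
      · right
        refine ⟨?_, Or.inl ⟨i1 + 1, by rw [add_mul]; omega, by rw [add_mul (i1 + 1)]; omega⟩⟩
        rw [(hs i1 hi1).2.1, signedArea_self_left]
        ring
      · left
        have := mul_pos (sub_pos.2 (subdivision_lt_one hs hi1 hj1'))
          (hc.pos (Nat.lt_succ_self i1) (Nat.lt_succ_self (i1 + 1)) hi2 (by omega))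
        exact mul_pos hlt (by linarith)
    · left
      have := mul_pos p1 (hc.pos (by omega : i1 + 1 < i2) (Nat.lt_succ_self i2) hi2 (by omega))
      exact mul_pos hlt (by linarith)
  · left
    -- On three different sides the area is trilinear, a nonnegative combination of eight areas of
    -- corner triples. The triple of the three end corners is nondegenerate and has positive weight,
    -- because `j ≥ 1` on each side.
    simp only [signedArea_lineMap_left, signedArea_lineMap_mid, signedArea_lineMap_right]
    have m000 := hc.nonneg h12.le h23.le hi3.le
    have m001 := hc.nonneg h12.le (by omega : i2 ≤ i3 + 1) hi3
    have m010 := hc.nonneg (by omega : i1 ≤ i2 + 1) (by omega : i2 + 1 ≤ i3) hi3.le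
    have m011 := hc.nonneg (by omega : i1 ≤ i2 + 1) (by omega : i2 + 1 ≤ i3 + 1) hi3
    have m100 := hc.nonneg (by omega : i1 + 1 ≤ i2) h23.le hi3.le
    have m101 := hc.nonneg (by omega : i1 + 1 ≤ i2) (by omega : i2 ≤ i3 + 1) hi3
    have m110 := hc.nonneg (by omega : i1 + 1 ≤ i2 + 1) (by omega : i2 + 1 ≤ i3) hi3.le
    have m111 := hc.pos (by omega : i1 + 1 < i2 + 1) (by omega : i2 + 1 < i3 + 1) hi3 (by omega)
    generalize 1 - s i1 j1 = w1 at *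
    generalize 1 - s i2 j2 = w2 at *
    generalize 1 - s i3 j3 = w3 at *
    positivity

theorem boundaryPoint_last (hc : IsConvexPolygon k c)
    (hs : ∀ i < k, s i 0 = 0 ∧ s i r = 1 ∧ ∀ j < r, s i j < s i (j + 1)) (hk : 1 ≤ k)
    (hr : 1 ≤ r) : boundaryPoint r c s (k * r) = c 0 := by
  obtain ⟨k, rfl⟩ : ∃ k', k = k' + 1 := ⟨k - 1, by omega⟩
  rw [show (k + 1) * r = k * r + r by ring, boundaryPoint_mul_add k hr le_rfl,
    (hs k (by omega)).2.1, AffineMap.lineMap_apply_one, hc.1]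

/-- A coincidence on different sides would put a point of the later side on the line through the
earlier one. As each side is numbered without its initial corner, this leaves only the corner `0`,
which is the end of the last side and not a numbered point of the first. -/
theorem boundaryPoint_injOn (hk : 3 ≤ k) (hc : IsConvexPolygon k c)
    (hs : ∀ i < k, s i 0 = 0 ∧ s i r = 1 ∧ ∀ j < r, s i j < s i (j + 1)) :
    Set.InjOn (boundaryPoint r c s) (Set.Icc 1 (k * r)) := by
  have key : ∀ a b, 1 ≤ a → a < b → b ≤ k * r →
      boundaryPoint r c s a ≠ boundaryPoint r c s b := by
    intro a b ha hab hb heq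
    obtain ⟨i1, j1, hi1, hj1, hjr1, rfl⟩ := exists_side ha (by omega : a ≤ k * r)
    obtain ⟨i2, j2, hi2, hj2, hjr2, rfl⟩ := exists_side (by omega : 1 ≤ b) hb
    have h12 := side_le hj1 hjr2 hab
    rw [boundaryPoint_mul_add i1 hj1 hjr1, boundaryPoint_mul_add i2 hj2 hjr2] at heq
    rcases eq_or_lt_of_le h12 with rfl | h12
    · have := AffineMap.lineMap_injective ℝ (hc.ne_succ hk hi1) heq
      have h := subdivision_lt hs hi1 (by omega : j1 < j2) hjr2
      linarith
    have h0 : signedArea (c i1) (c (i1 + 1))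
        (AffineMap.lineMap (c i2) (c (i2 + 1)) (s i2 j2)) = 0 := by
      rw [← heq, signedArea_lineMap_right, signedArea_self_outer, signedArea_self_right]; ring
    rw [signedArea_lineMap_right] at h0
    have p2 := subdivision_pos hs hi2 hj2 hjr2
    have q2 := sub_nonneg.2 (subdivision_le_one hs hi2 hjr2)
    have n1 := mul_nonneg q2 (hc.nonneg (Nat.le_succ i1) (by omega : i1 + 1 ≤ i2) hi2.le)
    have n2 := mul_nonneg p2.le (hc.nonneg (Nat.le_succ i1) (by omega : i1 + 1 ≤ i2 + 1) hi2)
    by_cases hw : i1 = 0 ∧ i2 + 1 = k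
    · obtain ⟨rfl, rfl⟩ := hw
      rcases eq_or_lt_of_le hjr2 with rfl | hj2'
      · rw [(hs i2 hi2).2.1, AffineMap.lineMap_apply_one, hc.1] at heq
        have e0 : AffineMap.lineMap (c 0) (c (0 + 1)) (s 0 j1) =
            AffineMap.lineMap (c 0) (c (0 + 1)) (0 : ℝ) := by
          rw [heq, AffineMap.lineMap_apply_zero]
        have := AffineMap.lineMap_injective ℝ (hc.ne_succ hk hi1) e0
        have h := subdivision_pos hs hi1 hj1 hjr1
        linarith
      · have := mul_pos (sub_pos.2 (subdivision_lt_one hs hi2 hj2'))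
          (hc.pos (show 0 < 0 + 1 by omega) (by omega : 0 + 1 < i2) hi2.le (by omega))
        linarith
    · have := mul_pos p2 (hc.pos (Nat.lt_succ_self i1) (by omega : i1 + 1 < i2 + 1) hi2 (by omega))
      linarith
  intro a ha b hb heq
  rcases lt_trichotomy a b with h | h | h
  · exact absurd heq (key a b ha.1 h hb.2)
  · exact h
  · exact absurd heq.symm (key b a hb.1 h ha.2)

theorem string_end_le {i b : ℕ} (h : i * r < k * r) (hb : b ≤ (i + 1) * r) :
    i < k ∧ b ≤ k * r := by
  have h1 : i < k := lt_of_mul_lt_mul_right h (Nat.zero_le r)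
  exact ⟨h1, hb.trans (Nat.mul_le_mul_right r h1)⟩

/-- The degenerate triples `a < b < e` found in `boundaryPoint_area` are those whose outer chord
lies in a string, or which end at `k * r` with `b` on the first side. Admissibility excludes both,
except for the base chord. -/
theorem isConvexChain_boundaryPoint (hk : 3 ≤ k) (hr : 1 ≤ r) (hc : IsConvexPolygon k c)
    (hs : ∀ i < k, s i 0 = 0 ∧ s i r = 1 ∧ ∀ j < r, s i j < s i (j + 1)) :
    IsConvexChain (boundaryPoint r c s) (Admissible k r) 1 (k * r) where
  injOn := boundaryPoint_injOn hk hc hs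
  nonneg i j l hi hij hjl hl := by
    rcases boundaryPoint_area hk hc hs hi hij hjl hl with h | h
    · exact h.le
    · exact h.1.ge
  pos i j l hi hij hjl hl hL hb := by
    rcases boundaryPoint_area hk hc hs hi hij hjl hl with h | ⟨-, ⟨q, h⟩ | h⟩
    · exact h
    · rcases hL with hL | hL
      · omega
      · exact absurd h (hL.1 q)
    · rcases hL with hL | hL
      · omega
      · exact absurd ⟨h.1, by omega⟩ hL.2
  base m hm hm' := by
    have h3 : 3 * r ≤ k * r := Nat.mul_le_mul_right r hk
    rcases boundaryPoint_area hk hc hs le_rfl hm hm' le_rfl with h | ⟨-, ⟨q, h1, h2⟩ | ⟨-, h⟩⟩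
    · exact Or.inl h
    · rcases Nat.eq_zero_or_pos q with rfl | hq
      · omega
      · have h4 : 1 * r ≤ q * r := Nat.mul_le_mul_right r hq
        obtain rfl : r = 1 := by omega
        omega
    · right
      refine ⟨?_, by omega, ?_⟩
      · have e1 := boundaryPoint_mul_add (c := c) (s := s) 0 (le_refl 1) hr
        have e2 := boundaryPoint_mul_add (c := c) (s := s) 0 hm.le h
        have e3 := boundaryPoint_last hc hs (by omega) hr
        rw [zero_mul, zero_add] at e1 e2
        rw [e1, e2, e3, segment_symm]
        have := lineMap_mem_segment_lineMap (c 0) (c (0 + 1))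
          (subdivision_pos hs (by omega : 0 < k) one_pos hr).le
          (subdivision_lt hs (by omega : 0 < k) hm h).le
        rwa [AffineMap.lineMap_apply_zero] at this
      · rintro (h5 | h5)
        · omega
        · exact h5.2 ⟨rfl, h⟩

/-- The corner at the beginning of a side, as a boundary point. -/
theorem boundaryPoint_string (hs : ∀ i < k, s i 0 = 0 ∧ s i r = 1 ∧ ∀ j < r, s i j < s i (j + 1))
    {i j : ℕ} (hi : i < k) (hj : 1 ≤ i * r + j) (hjr : j ≤ r) :
    boundaryPoint r c s (i * r + j) = AffineMap.lineMap (c i) (c (i + 1)) (s i j) := by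
  rcases Nat.eq_zero_or_pos j with rfl | hj0
  · obtain ⟨i, rfl⟩ : ∃ i', i = i' + 1 := by
      rcases Nat.eq_zero_or_pos i with rfl | h
      · simp at hj
      · exact ⟨i - 1, by omega⟩
    have hr : 1 ≤ r := by
      rcases Nat.eq_zero_or_pos r with rfl | h
      · simp at hj
      · exact h
    rw [show (i + 1) * r + 0 = i * r + r by ring, boundaryPoint_mul_add i hr le_rfl,
      (hs i (by omega)).2.1, (hs (i + 1) hi).1, AffineMap.lineMap_apply_one,
      AffineMap.lineMap_apply_zero]
  · exact boundaryPoint_mul_add i hj0 hjr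

theorem image_boundaryPoint (hr : 1 ≤ r) (hc : IsConvexPolygon k c)
    (hs : ∀ i < k, s i 0 = 0 ∧ s i r = 1 ∧ ∀ j < r, s i j < s i (j + 1)) :
    {p | ∃ i < k, ∃ j < r, p = AffineMap.lineMap (c i) (c (i + 1)) (s i j)} =
      boundaryPoint r c s '' Set.Icc 1 (k * r) := by
  ext x
  constructor
  · rintro ⟨i, hi, j, hj, rfl⟩
    have h2 : (i + 1) * r ≤ k * r := Nat.mul_le_mul_right r hi
    rw [add_mul] at h2
    by_cases h : 1 ≤ i * r + j
    · exact ⟨i * r + j, ⟨h, by omega⟩, boundaryPoint_string hs hi h hj.le⟩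
    · obtain rfl : j = 0 := by omega
      have : i * r = 0 := by omega
      obtain rfl : i = 0 := (Nat.mul_eq_zero.1 this).resolve_right (by omega)
      refine ⟨k * r, ⟨by omega, le_rfl⟩, ?_⟩
      rw [boundaryPoint_last hc hs (by omega) hr, (hs 0 hi).1, AffineMap.lineMap_apply_zero]
  · rintro ⟨a, ha, rfl⟩
    obtain ⟨i, j, hi, hj, hjr, rfl⟩ := exists_side ha.1 ha.2
    rw [boundaryPoint_mul_add i hj hjr]
    rcases eq_or_lt_of_le hjr with rfl | hjr
    · rw [(hs i hi).2.1, AffineMap.lineMap_apply_one]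
      rcases eq_or_lt_of_le (show i + 1 ≤ k from hi) with rfl | hi'
      · exact ⟨0, by omega, 0, by omega, by
          rw [hc.1, (hs 0 (by omega)).1, AffineMap.lineMap_apply_zero]⟩
      · exact ⟨i + 1, hi', 0, by omega, by
          rw [(hs (i + 1) hi').1, AffineMap.lineMap_apply_zero]⟩
    · exact ⟨i, hi, j, hjr, rfl⟩

/-- Two points with no admissible chord are separated by a third point of their segment. -/
theorem exists_between (hk : 3 ≤ k) (hr : 1 ≤ r) (hc : IsConvexPolygon k c)
    (hs : ∀ i < k, s i 0 = 0 ∧ s i r = 1 ∧ ∀ j < r, s i j < s i (j + 1)) {a b : ℕ} (ha : 1 ≤ a)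
    (hab : a + 1 < b) (hb : b ≤ k * r) (h : ¬ Admissible k r a b) :
    ∃ m, 1 ≤ m ∧ m ≤ k * r ∧ m ≠ a ∧ m ≠ b ∧
      boundaryPoint r c s m ∈ segment ℝ (boundaryPoint r c s a) (boundaryPoint r c s b) := by
  unfold Admissible at h
  push Not at h
  obtain ⟨h1, h2⟩ := h
  by_cases hst : ∃ i, i * r ≤ a ∧ b ≤ (i + 1) * r
  · obtain ⟨i, hi1, hi2⟩ := hst
    obtain ⟨hik, -⟩ := string_end_le (by omega : i * r < k * r) hi2
    rw [add_mul, one_mul] at hi2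
    obtain ⟨j, rfl⟩ := Nat.exists_eq_add_of_le hi1
    obtain ⟨j', rfl⟩ := Nat.exists_eq_add_of_le (show i * r ≤ b by omega)
    refine ⟨i * r + (j + 1), by omega, by omega, by omega, by omega, ?_⟩
    rw [boundaryPoint_string hs hik ha (by omega), boundaryPoint_string hs hik (by omega) (by omega),
      boundaryPoint_string hs hik (by omega) (by omega)]
    exact lineMap_mem_segment_lineMap _ _ (subdivision_lt hs hik (by omega) (by omega)).le
      (subdivision_lt hs hik (by omega) (by omega)).le
  · push Not at hst
    obtain ⟨rfl, har⟩ := h2 fun i hi => hst i hi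
    have ha1 : a ≠ 1 := fun h => h1 h rfl
    have hbase := (isConvexChain_boundaryPoint hk hr hc hs).base a (by omega) (by omega)
    have e1 := boundaryPoint_string (c := c) hs (by omega : 0 < k) (by omega : 1 ≤ 0 * r + 1) hr
    have e2 := boundaryPoint_string (c := c) hs (by omega : 0 < k) (by omega : 1 ≤ 0 * r + a) har
    have e3 := boundaryPoint_last hc hs (by omega) hr
    rw [zero_mul, zero_add] at e1 e2
    refine ⟨1, le_rfl, by omega, Ne.symm ha1, by omega, ?_⟩
    rw [e1, e2, e3, segment_symm]
    have := lineMap_mem_segment_lineMap (c 0) (c (0 + 1))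
      (subdivision_pos hs (by omega : 0 < k) one_pos hr).le
      (subdivision_lt hs (by omega : 0 < k) (by omega : 1 < a) har).le
    rwa [AffineMap.lineMap_apply_zero] at this

/-- The number of triangulations of a subdivided convex polygon. -/
theorem numTriangulations_of_isSC (hk : 3 ≤ k) (hr : 1 ≤ r) {S : Set Plane} (hS : IsSC k r S) :
    numTriangulations S = splitCount (Admissible k r) 1 (k * r) := by
  obtain ⟨c, s, hc, hs, rfl⟩ := hS
  have H := isConvexChain_boundaryPoint hk hr hc hs
  have h3 : 3 * r ≤ k * r := Nat.mul_le_mul_right r hk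
  rw [image_boundaryPoint hr hc hs, ← H.ncard_isLegal (by omega) (Or.inl ⟨rfl, rfl⟩),
    numTriangulations]
  congr 1
  ext T
  simp only [Set.mem_ofPred_eq]
  refine ⟨fun hT => ⟨hT, ?_⟩, fun hT => hT.isTriangulation⟩
  intro t ht a b ha hab hb hat hbt
  by_contra hL
  -- Legality is automatic here: the point between the ends of an inadmissible chord would be a
  -- third vertex of the triangle, collinear with the other two.
  obtain ⟨m, hm1, hm2, hma, hmb, hseg⟩ := exists_between hk hr hc hs ha hab hb hL
  have hmt := hT.no_other_point t ht _ (mem_image_Icc hm1 hm2)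
    ((convex_convexHull ℝ _).segment_subset (subset_convexHull ℝ _ hat) (subset_convexHull ℝ _ hbt)
      hseg)
  have inj := fun {x y : ℕ} (h1 : 1 ≤ x) (h2 : x ≤ k * r) (h3 : 1 ≤ y) (h4 : y ≤ k * r)
    (hne : x ≠ y) => (H.injOn.ne ⟨h1, h2⟩ ⟨h3, h4⟩ hne)
  exact signedArea_ne_zero_of_mem (hT.card_eq_three t ht) (hT.affineIndependent t ht) hat hbt hmt
    (inj ha (by omega) (by omega) hb (by omega)) (inj ha (by omega) hm1 hm2 hma.symm)
    (inj (by omega) hb hm1 hm2 hmb.symm) (signedArea_eq_zero_of_mem_segment hseg)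

end subdivided

/-! ### The regular polygon with forbidden diagonals -/

/-- Half the angle between two vertices is the inscribed angle over their chord. In this factored
form the sign is visible: for increasing indices below `n`, all three sines are positive. -/
theorem regularVertex_area (n a b c : ℕ) :
    signedArea (regularVertex n a) (regularVertex n b) (regularVertex n c) =
      4 * Real.sin (Real.pi * ((b : ℝ) - a) / n) * Real.sin (Real.pi * ((c : ℝ) - b) / n) *
        Real.sin (Real.pi * ((c : ℝ) - a) / n) := by
  have ha : 2 * Real.pi * (a : ℝ) / n = 2 * (Real.pi * a / n) := by ring
  have hb : 2 * Real.pi * (b : ℝ) / n = 2 * (Real.pi * b / n) := by ring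
  have hc : 2 * Real.pi * (c : ℝ) / n = 2 * (Real.pi * c / n) := by ring
  have e1 : Real.pi * ((b : ℝ) - a) / n = Real.pi * b / n - Real.pi * a / n := by ring
  have e2 : Real.pi * ((c : ℝ) - b) / n = Real.pi * c / n - Real.pi * b / n := by ring
  have e3 : Real.pi * ((c : ℝ) - a) / n = Real.pi * c / n - Real.pi * a / n := by ring
  simp only [signedArea, regularVertex, ha, hb, hc, e1, e2, e3, Real.sin_sub, Real.cos_two_mul,
    Real.sin_two_mul]
  have sa := Real.sin_sq_add_cos_sq (Real.pi * a / n)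
  have sb := Real.sin_sq_add_cos_sq (Real.pi * b / n)
  have sc := Real.sin_sq_add_cos_sq (Real.pi * c / n)
  simp
  generalize Real.sin (Real.pi * a / n) = x at *
  generalize Real.cos (Real.pi * a / n) = x' at *
  generalize Real.sin (Real.pi * b / n) = y at *
  generalize Real.cos (Real.pi * b / n) = y' at *
  generalize Real.sin (Real.pi * c / n) = z at *
  generalize Real.cos (Real.pi * c / n) = z' at *
  have hx : x ^ 2 = 1 - x' ^ 2 := by linarith
  have hy : y ^ 2 = 1 - y' ^ 2 := by linarith
  have hz : z ^ 2 = 1 - z' ^ 2 := by linarith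
  ring_nf
  simp only [hx, hy, hz]
  ring

theorem isConvexPolygon_regularVertex {n : ℕ} (hn : 1 ≤ n) :
    IsConvexPolygon n (regularVertex n) := by
  have hn0 : (0 : ℝ) < n := by exact_mod_cast hn
  constructor
  · have : 2 * Real.pi * (n : ℝ) / n = 2 * Real.pi := by field_simp
    simp [regularVertex, this]
  · intro i j l hij hjl hl
    rw [regularVertex_area]
    have key : ∀ x y : ℕ, x < y → y < n → 0 < Real.sin (Real.pi * ((y : ℝ) - x) / n) := by
      intro x y hxy hy
      have h1 : (x : ℝ) < y := by exact_mod_cast hxy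
      have h2 : (y : ℝ) < n := by exact_mod_cast hy
      have h3 : (0 : ℝ) ≤ x := Nat.cast_nonneg x
      apply Real.sin_pos_of_pos_of_lt_pi
      · exact div_pos (mul_pos Real.pi_pos (by linarith)) hn0
      · rw [div_lt_iff₀ hn0]
        exact mul_lt_mul_of_pos_left (by linarith) Real.pi_pos
    have k1 := key i j hij (by omega)
    have k2 := key j l hjl hl
    have k3 := key i l (by omega) hl
    positivity

theorem isSC_regularSC {k r : ℕ} (hk : 1 ≤ k) (hr : 1 ≤ r) : IsSC k r (regularSC k r) := by
  have hr0 : (0 : ℝ) < r := by exact_mod_cast hr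
  refine ⟨regularVertex k, fun _ j => (j : ℝ) / r, isConvexPolygon_regularVertex hk, ?_, rfl⟩
  refine fun i _ => ⟨by simp, div_self hr0.ne', fun j _ => ?_⟩
  rw [div_lt_div_iff_of_pos_right hr0]
  push_cast
  linarith

/-- Strict convexity rules out degenerate triples, so any relation `L` is allowed. -/
theorem isConvexChain_regularVertex {n : ℕ} (hn : 3 ≤ n) (L : ℕ → ℕ → Prop) :
    IsConvexChain (regularVertex n) L 1 n := by
  have hc := isConvexPolygon_regularVertex (show 1 ≤ n by omega)
  have hpos : ∀ i j l, 1 ≤ i → i < j → j < l → l ≤ n →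
      0 < signedArea (regularVertex n i) (regularVertex n j) (regularVertex n l) :=
    fun i j l hi hij hjl hl => hc.pos hij hjl hl (Or.inl hi)
  refine ⟨?_, fun i j l h1 h2 h3 h4 => (hpos i j l h1 h2 h3 h4).le,
    fun i j l h1 h2 h3 h4 _ _ => hpos i j l h1 h2 h3 h4,
    fun m h1 h2 => Or.inl (hpos 1 m n le_rfl h1 h2 le_rfl)⟩
  have key : ∀ x y, 1 ≤ x → x < y → y ≤ n → regularVertex n x ≠ regularVertex n y := by
    intro x y hx hxy hy heq
    by_cases h1 : 1 < x
    · have := hpos 1 x y le_rfl h1 hxy hy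
      rw [heq, signedArea_self_right] at this
      exact lt_irrefl _ this
    by_cases h2 : y < n
    · have := hpos x y n hx hxy h2 le_rfl
      rw [heq, signedArea_self_left] at this
      exact lt_irrefl _ this
    · have := hpos x 2 y hx (by omega) (by omega) hy
      rw [heq, signedArea_self_outer] at this
      exact lt_irrefl _ this
  intro a ha b hb heq
  rcases lt_trichotomy a b with h | h | h
  · exact absurd heq (key a b ha.1 h hb.2)
  · exact h
  · exact absurd heq.symm (key b a hb.1 h ha.2)

theorem regularVertex_mod {n a : ℕ} (hn : 1 ≤ n) (ha : a ≤ n) :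
    regularVertex n (a % n) = regularVertex n a := by
  rcases eq_or_lt_of_le ha with rfl | h
  · rw [Nat.mod_self, (isConvexPolygon_regularVertex hn).1]
  · rw [Nat.mod_eq_of_lt h]

theorem image_regularVertex {n : ℕ} (hn : 1 ≤ n) :
    regularPolygon n = regularVertex n '' Set.Icc 1 n := by
  ext x
  constructor
  · rintro ⟨a, ha, rfl⟩
    rcases Nat.eq_zero_or_pos a with rfl | h
    · exact ⟨n, ⟨hn, le_rfl⟩, (isConvexPolygon_regularVertex hn).1⟩
    · exact ⟨a, ⟨h, ha.le⟩, rfl⟩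
  · rintro ⟨a, ha, rfl⟩
    exact ⟨a % n, Nat.mod_lt _ hn, (regularVertex_mod hn ha.2).symm⟩

theorem IsForbidden.symm {k r a b : ℕ} (h : IsForbidden k r a b) : IsForbidden k r b a := by
  obtain ⟨h1, h2, h3, i, hi, h4, h5⟩ := h
  exact ⟨h1.symm, h3, h2, i, hi, h5, h4⟩

/-- Forbidden diagonals are described by residues modulo `k * r`, admissible chords by indices from
`1` to `k * r`. Only the last index changes under reduction; it becomes the initial point of the
string `0`, which accounts for the extra condition in `Admissible`. -/
theorem isForbidden_of_not_admissible {k r a b : ℕ} (hkr : 3 ≤ k * r) (ha : 1 ≤ a)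
    (hab : a + 1 < b) (hb : b ≤ k * r) (h : ¬ Admissible k r a b) :
    IsForbidden k r a (b % (k * r)) := by
  unfold Admissible at h
  push Not at h
  obtain ⟨h1, h2⟩ := h
  have hk : 0 < k := by
    rcases Nat.eq_zero_or_pos k with rfl | h
    · simp at hkr
    · exact h
  have ham : a % (k * r) = a := Nat.mod_eq_of_lt (by omega)
  have ha1 : (a + 1) % (k * r) = a + 1 := Nat.mod_eq_of_lt (by omega)
  have hne : a ≠ b % (k * r) ∧ (a + 1) % (k * r) ≠ b % (k * r) ∧
      (b % (k * r) + 1) % (k * r) ≠ a := by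
    rw [ha1]
    rcases eq_or_lt_of_le hb with rfl | hb
    · rw [Nat.mod_self, Nat.zero_add, Nat.mod_eq_of_lt (by omega : 1 < k * r)]
      exact ⟨by omega, by omega, fun h => h1 h.symm rfl⟩
    · rw [Nat.mod_eq_of_lt hb]
      refine ⟨by omega, by omega, ?_⟩
      rcases eq_or_lt_of_le (show b + 1 ≤ k * r from hb) with hb | hb
      · rw [hb, Nat.mod_self]; omega
      · rw [Nat.mod_eq_of_lt hb]; omega
  refine ⟨hne.1, hne.2.1, hne.2.2, ?_⟩
  by_cases hst : ∃ i, i * r ≤ a ∧ b ≤ (i + 1) * r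
  · obtain ⟨i, hi1, hi2⟩ := hst
    obtain ⟨hik, -⟩ := string_end_le (by omega : i * r < k * r) hi2
    rw [add_mul, one_mul] at hi2
    refine ⟨i, hik, ⟨a - i * r, by omega, ?_⟩, ⟨b - i * r, by omega, ?_⟩⟩
    · rw [Nat.add_sub_of_le hi1, ham]
    · rw [Nat.add_sub_of_le (by omega)]
  · push Not at hst
    obtain ⟨rfl, har⟩ := h2 fun i hi => hst i hi
    exact ⟨0, hk, ⟨a, har, by rw [zero_mul, zero_add, ham]⟩, ⟨0, Nat.zero_le _, by simp⟩⟩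

theorem not_admissible_of_isForbidden {k r a b : ℕ} (ha : 1 ≤ a)
    (hab : a < b) (hb : b ≤ k * r) (h : IsForbidden k r a (b % (k * r))) :
    a + 1 < b ∧ ¬ Admissible k r a b := by
  obtain ⟨-, h2, h3, i, hi, ⟨j, hj, e1⟩, ⟨j', hj', e2⟩⟩ := h
  have hik : (i + 1) * r ≤ k * r := Nat.mul_le_mul_right r hi
  have hir : (i + 1) * r = i * r + r := by ring
  have ea : a = i * r + j := by
    rcases eq_or_lt_of_le (show i * r + j ≤ k * r by omega) with h | h
    · rw [h, Nat.mod_self] at e1; omega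
    · rwa [Nat.mod_eq_of_lt h] at e1
  constructor
  · by_contra hcon
    obtain rfl : b = a + 1 := by omega
    exact h2 rfl
  · rintro (⟨rfl, rfl⟩ | ⟨h4, h5⟩)
    · rw [Nat.mod_self, Nat.zero_add, Nat.mod_eq_of_lt (by omega)] at h3
      exact h3 rfl
    · have e3 := h4 i
      rcases eq_or_lt_of_le hb with rfl | hb
      · rw [Nat.mod_self] at e2
        rcases eq_or_lt_of_le (show i * r + j' ≤ k * r by omega) with h | h
        · exact e3 ⟨by omega, by omega⟩
        · rw [Nat.mod_eq_of_lt h] at e2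
          exact h5 ⟨rfl, by omega⟩
      · rw [Nat.mod_eq_of_lt hb] at e2
        rcases eq_or_lt_of_le (show i * r + j' ≤ k * r by omega) with h | h
        · rw [h, Nat.mod_self] at e2; omega
        · rw [Nat.mod_eq_of_lt h] at e2
          exact e3 ⟨by omega, by omega⟩

theorem numLegalTriangulations_eq {k r : ℕ} (hkr : 3 ≤ k * r) :
    numLegalTriangulations k r = splitCount (Admissible k r) 1 (k * r) := by
  have H := isConvexChain_regularVertex hkr (Admissible k r)
  rw [← H.ncard_isLegal (by omega) (Or.inl ⟨rfl, rfl⟩), numLegalTriangulations,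
    image_regularVertex (by omega)]
  congr 1
  ext T
  simp only [Set.mem_ofPred_eq]
  constructor
  · rintro ⟨hT, hleg⟩
    refine ⟨hT, fun t ht a b ha hab hb hat hbt => ?_⟩
    by_contra hA
    refine hleg _ _ (isForbidden_of_not_admissible hkr ha hab hb hA) t ht ⟨hat, ?_⟩
    rwa [regularVertex_mod (by omega) hb]
  · intro hT
    refine ⟨hT.isTriangulation, fun a b hf t ht hmem => ?_⟩
    have key : ∀ a b, 1 ≤ a → a < b → b ≤ k * r → IsForbidden k r a (b % (k * r)) →
        regularVertex (k * r) a ∈ t → regularVertex (k * r) b ∈ t → False := by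
      intro a b ha hab hb hf hat hbt
      obtain ⟨h1, h2⟩ := not_admissible_of_isForbidden ha hab hb hf
      exact h2 (hT.legal t ht a b ha h1 hb hat hbt)
    have hlt : a < k * r ∧ b < k * r := by
      obtain ⟨-, -, -, i, -, ⟨j, -, rfl⟩, ⟨j', -, rfl⟩⟩ := hf
      exact ⟨Nat.mod_lt _ (by omega), Nat.mod_lt _ (by omega)⟩
    have h0 := (isConvexPolygon_regularVertex (show 1 ≤ k * r by omega)).1
    have hne := hf.1
    rcases Nat.eq_zero_or_pos a with rfl | ha
    · refine key b (k * r) (by omega) hlt.2 le_rfl ?_ hmem.2 ?_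
      · rw [Nat.mod_self]; exact hf.symm
      · rw [h0]; exact hmem.1
    rcases Nat.eq_zero_or_pos b with rfl | hb
    · refine key a (k * r) ha hlt.1 le_rfl ?_ hmem.1 ?_
      · rw [Nat.mod_self]; exact hf
      · rw [h0]; exact hmem.2
    rcases lt_or_gt_of_ne hne with h | h
    · refine key a b ha h hlt.2.le ?_ hmem.1 hmem.2
      rwa [Nat.mod_eq_of_lt hlt.2]
    · refine key b a hb h hlt.1.le ?_ hmem.2 hmem.1
      rw [Nat.mod_eq_of_lt hlt.1]; exact hf.symm

theorem tr_eq_splitCount {k r : ℕ} (hk : 1 ≤ k) (hr : 1 ≤ r) (hkr : 3 ≤ k * r) :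
    tr k r = splitCount (Admissible k r) 1 (k * r) := by
  unfold tr
  split_ifs with h
  · exact numTriangulations_of_isSC h hr (isSC_regularSC hk hr)
  · exact numLegalTriangulations_eq hkr

/-! ### The Catalan series of the step weights -/

theorem sum_range_product_antidiagonal {R : Type*} [AddCommMonoid R] (F : ℕ → ℕ → R) {M N : ℕ}
    (hMN : M ≤ N) (hF : ∀ a b, M ≤ a + b → F a b = 0) :
    ∑ a ∈ Finset.range N, ∑ b ∈ Finset.range N, F a b =
      ∑ m ∈ Finset.range M, ∑ q ∈ Finset.HasAntidiagonal.antidiagonal m, F q.1 q.2 := by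
  rw [← Finset.sum_product', ← Finset.sum_filter_of_ne (p := fun q : ℕ × ℕ => q.1 + q.2 < M)]
  · rw [← Finset.sum_fiberwise_of_maps_to (g := fun q : ℕ × ℕ => q.1 + q.2) (t := Finset.range M)]
    · refine Finset.sum_congr rfl fun m hm => Finset.sum_congr ?_ fun _ _ => rfl
      have := Finset.mem_range.1 hm
      ext q
      simp only [Finset.mem_filter, Finset.mem_product, Finset.mem_range, Finset.HasAntidiagonal.mem_antidiagonal]
      omega
    · intro q hq
      simpa using (Finset.mem_filter.1 hq).2
  · intro q _ hq
    by_contra h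
    exact hq (hF _ _ (not_lt.1 h))

/-- Steps of length one count with weight `1`, steps of length two within a string with weight
`-1`. -/
def stepWeight (r : ℕ) : IncidenceAlgebra ℂ ℕ where
  toFun i j := if j = i + 1 then 1 else
    if j = i + 2 ∧ ∃ q, q * r ≤ i ∧ j ≤ (q + 1) * r then -1 else 0
  eq_zero_of_not_le' i j h := by
    rw [if_neg (by omega), if_neg (by omega)]

theorem stepWeight_apply (r i j : ℕ) : stepWeight r i j = if j = i + 1 then 1 else
    if j = i + 2 ∧ ∃ q, q * r ≤ i ∧ j ≤ (q + 1) * r then -1 else 0 := rfl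

theorem stepWeight_succ (r i : ℕ) : stepWeight r i (i + 1) = 1 := by
  rw [stepWeight_apply, if_pos rfl]

theorem stepWeight_of_le (r : ℕ) {i j : ℕ} (h : j ≤ i) : stepWeight r i j = 0 := by
  rw [stepWeight_apply, if_neg (by omega), if_neg (by omega)]

theorem stepWeight_of_not_string (r : ℕ) {i j : ℕ} (hij : j ≠ i + 1)
    (h : ¬ ∃ q, q * r ≤ i ∧ j ≤ (q + 1) * r) : stepWeight r i j = 0 := by
  rw [stepWeight_apply, if_neg hij, if_neg (fun h' => h h'.2)]

theorem stepWeight_of_string (r : ℕ) {i j : ℕ} (hij : j ≠ i + 1)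
    (h : ∃ q, q * r ≤ i ∧ j ≤ (q + 1) * r) : stepWeight r i j = if j = i + 2 then -1 else 0 := by
  rw [stepWeight_apply, if_neg hij]
  simp [h]

theorem stepWeight_of_gt (r : ℕ) {i j : ℕ} (h : i + 2 < j) : stepWeight r i j = 0 := by
  rw [stepWeight_apply, if_neg (by omega), if_neg (by omega)]

/-- Every step increases the index by at least one. Hence power series in the step weights are
finite sums at each entry, and truncating them far enough loses nothing. -/
theorem stepWeight_pow_apply_eq_zero (r m : ℕ) : ∀ {i j : ℕ}, j < i + m →
    (stepWeight r ^ m) i j = 0 := by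
  induction m with
  | zero =>
    intro i j h
    exact IncidenceAlgebra.apply_eq_zero_of_not_le (by omega) _
  | succ m ih =>
    intro i j h
    rw [pow_succ, IncidenceAlgebra.mul_apply]
    refine Finset.sum_eq_zero fun x _ => ?_
    by_cases hx : x < i + m
    · rw [ih hx, zero_mul]
    · rw [stepWeight_of_le r (by omega), mul_zero]

/-- The truncated Catalan series evaluated at the step weights. -/
def catalanSum (r N i j : ℕ) : ℂ :=
  ∑ m ∈ Finset.range N, (catalan m : ℂ) * (stepWeight r ^ (m + 1)) i j

theorem catalanSum_of_le (r N : ℕ) {i j : ℕ} (h : j ≤ i) : catalanSum r N i j = 0 := by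
  refine Finset.sum_eq_zero fun m _ => ?_
  rw [stepWeight_pow_apply_eq_zero r (m + 1) (by omega), mul_zero]

/-- The Catalan recursion. -/
theorem catalanSum_eq (r : ℕ) {n i j : ℕ} (hj : j ≤ n) :
    catalanSum r (n + 1) i j = stepWeight r i j +
      ∑ l ∈ Finset.Ioo i j, catalanSum r (n + 1) i l * catalanSum r (n + 1) l j := by
  have e1 : ∑ l ∈ Finset.Ioo i j, catalanSum r (n + 1) i l * catalanSum r (n + 1) l j =
      ∑ l ∈ Finset.Icc i j, catalanSum r (n + 1) i l * catalanSum r (n + 1) l j := by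
    refine Finset.sum_subset Finset.Ioo_subset_Icc_self fun l hl hl' => ?_
    rw [Finset.mem_Icc] at hl
    rw [Finset.mem_Ioo] at hl'
    by_cases h : l ≤ i
    · rw [catalanSum_of_le r _ h, zero_mul]
    · rw [catalanSum_of_le r _ (by omega : j ≤ l), mul_zero]
  have e2 : ∑ l ∈ Finset.Icc i j, catalanSum r (n + 1) i l * catalanSum r (n + 1) l j =
      ∑ a ∈ Finset.range (n + 1), ∑ b ∈ Finset.range (n + 1),
        (catalan a : ℂ) * catalan b * (stepWeight r ^ (a + b + 2)) i j := by
    simp only [catalanSum, Finset.sum_mul_sum]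
    rw [Finset.sum_comm]
    refine Finset.sum_congr rfl fun a _ => ?_
    rw [Finset.sum_comm]
    refine Finset.sum_congr rfl fun b _ => ?_
    rw [show a + b + 2 = (a + 1) + (b + 1) by ring,
      pow_add (stepWeight r) (a + 1) (b + 1), IncidenceAlgebra.mul_apply, Finset.mul_sum]
    exact Finset.sum_congr rfl fun l _ => by ring
  -- Regrouping by `a + b` produces the convolution formula for Catalan numbers. The terms with `a +
  -- b ≥ n` vanish, since a walk from `i` to `j ≤ n` is too short for them.
  rw [e1, e2, sum_range_product_antidiagonal _ (Nat.le_succ n), catalanSum, Finset.sum_range_succ',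
    catalan_zero, add_comm]
  · congr 1
    · simp
    · refine Finset.sum_congr rfl fun m _ => ?_
      rw [catalan_succ']
      push_cast
      rw [Finset.sum_mul]
      refine Finset.sum_congr rfl fun q hq => ?_
      rw [Finset.HasAntidiagonal.mem_antidiagonal.1 hq]
  · intro a b hab
    rw [stepWeight_pow_apply_eq_zero r _ (by omega), mul_zero]

section count

variable {k r : ℕ}

theorem admissible_iff {i j : ℕ} (h : j < k * r ∨ r < i) (hr : 1 ≤ r) :
    Admissible k r i j ↔ ¬ ∃ q, q * r ≤ i ∧ j ≤ (q + 1) * r := by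
  unfold Admissible
  constructor
  · rintro (⟨h1, h2⟩ | h1)
    · omega
    · rintro ⟨q, hq⟩
      exact h1.1 q hq
  · intro h1
    exact Or.inr ⟨fun q hq => h1 ⟨q, hq⟩, by omega⟩

/-- Both sides obey the same recursion, by induction on the distance. The condition `j < k * r ∨ r <
i` leaves out the chords from the string `0` to its initial point `k * r`: these are inadmissible,
but the step weights on `ℕ` do not identify `k * r` with `0`. -/
theorem splitCount_eq_catalanSum (hr : 1 ≤ r) (d : ℕ) : ∀ {i j : ℕ}, j ≤ i + d → 1 ≤ i → i < j →
    j ≤ k * r → (j < k * r ∨ r < i) →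
      (splitCount (Admissible k r) i j : ℂ) = catalanSum r (k * r + 1) i j := by
  induction d with
  | zero => intro i j h1 _ h2; omega
  | succ d ih =>
    intro i j hd hi hij hj hreg
    by_cases he : j = i + 1
    · subst he
      rw [splitCount_succ, catalanSum_eq r hj, stepWeight_succ, Finset.sum_eq_zero]
      · simp
      · intro l hl
        rw [Finset.mem_Ioo] at hl
        omega
    rw [catalanSum_eq r hj]
    have hsum : ∑ l ∈ Finset.Ioo i j, catalanSum r (k * r + 1) i l * catalanSum r (k * r + 1) l j =
        ∑ l ∈ Finset.Ioo i j,
          (splitCount (Admissible k r) i l : ℂ) * splitCount (Admissible k r) l j := by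
      refine Finset.sum_congr rfl fun l hl => ?_
      rw [Finset.mem_Ioo] at hl
      rw [ih (by omega) hi hl.1 (by omega) (by omega),
        ih (by omega) (by omega) hl.2 hj (by omega)]
    rw [hsum]
    by_cases hst : ∃ q, q * r ≤ i ∧ j ≤ (q + 1) * r
    · rw [splitCount_of_not _ he (by rw [admissible_iff hreg hr]; exact not_not.2 hst),
        stepWeight_of_string r he hst]
      -- Within a string only neighbours have nonzero count, so the convolution is `1` for `j = i +
      -- 2` and `0` beyond. The weight `-1` cancels exactly this.
      have hterm : ∀ l ∈ Finset.Ioo i j,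
          (splitCount (Admissible k r) i l : ℂ) * splitCount (Admissible k r) l j =
            if l = i + 1 then (if j = i + 2 then 1 else 0) else 0 := by
        intro l hl
        rw [Finset.mem_Ioo] at hl
        obtain ⟨q, hq1, hq2⟩ := hst
        by_cases h1 : l = i + 1
        · subst h1
          rw [splitCount_succ, if_pos rfl]
          split_ifs with h2
          · rw [h2, splitCount_succ]; simp
          · rw [splitCount_of_not _ (by omega)]
            · simp
            · rw [admissible_iff (by omega) hr]
              exact not_not.2 ⟨q, by omega, hq2⟩
        · rw [if_neg h1, splitCount_of_not _ h1]
          · simp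
          · rw [admissible_iff (by omega) hr]
            exact not_not.2 ⟨q, hq1, by omega⟩
      rw [Finset.sum_congr rfl hterm, Finset.sum_ite_eq' (Finset.Ioo i j) (i + 1),
        if_pos (Finset.mem_Ioo.2 ⟨by omega, by omega⟩)]
      split_ifs <;> simp
    · rw [splitCount_eq_sum _ he ((admissible_iff hreg hr).2 hst),
        stepWeight_of_not_string r he hst]
      push_cast
      rw [zero_add]

/-- The number of splittings of the base chord, as a Catalan sum. -/
theorem splitCount_base (hr : 1 ≤ r) (hkr : 3 ≤ k * r) (hne : ¬ (k = 1 ∧ r = 3)) :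
    (splitCount (Admissible k r) 1 (k * r) : ℂ) = catalanSum r (k * r + 1) 1 (k * r) -
      if 2 ≤ r then catalanSum r (k * r + 1) 2 (k * r) else 0 := by
  have hk : 1 ≤ k := by
    rcases Nat.eq_zero_or_pos k with rfl | h
    · simp at hkr
    · exact h
  -- This fails for `(k, r) = (1, 3)`, where `1` and `3` are at distance two in the string `0`.
  have hstep : stepWeight r 1 (k * r) = 0 := by
    rw [stepWeight_apply, if_neg (by omega), if_neg]
    rintro ⟨h1, q, hq1, hq2⟩
    rcases Nat.eq_zero_or_pos q with rfl | hq
    · have h3 : 3 ≤ r := by omega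
      have : k * 3 ≤ k * r := Nat.mul_le_mul_left k h3
      obtain rfl : k = 1 := by omega
      exact hne ⟨rfl, by omega⟩
    · have : 1 * r ≤ q * r := Nat.mul_le_mul_right r hq
      obtain rfl : r = 1 := by omega
      omega
  -- For `l > r` both factors are Catalan sums. For `l ≤ r` the chord from `l` to `k * r` is
  -- inadmissible, and the chord from `1` to `l` has count `0` unless `l = 2`; so `l = 2` is the
  -- only term to correct, and only if `r ≥ 2`.
  have hterm : ∀ l ∈ Finset.Ioo 1 (k * r),
      ((splitCount (Admissible k r) 1 l * splitCount (Admissible k r) l (k * r) : ℕ) : ℂ) =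
        catalanSum r (k * r + 1) 1 l * catalanSum r (k * r + 1) l (k * r) -
          if l = 2 then (if 2 ≤ r then catalanSum r (k * r + 1) 2 (k * r) else 0) else 0 := by
    intro l hl
    rw [Finset.mem_Ioo] at hl
    rw [← splitCount_eq_catalanSum hr l (by omega) le_rfl hl.1 hl.2.le (Or.inl hl.2)]
    push_cast
    by_cases hlr : r < l
    · rw [splitCount_eq_catalanSum hr (k * r) (by omega) (by omega) hl.2 le_rfl (Or.inr hlr)]
      split_ifs <;> first | omega | simp
    · have h0 : ∀ m, m = l → m = 2 → splitCount (Admissible k r) m (k * r) = 0 := by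
        rintro m rfl rfl
        refine splitCount_of_not _ ?_ ?_
        · intro h3
          have h2 : k * 2 ≤ k * r := Nat.mul_le_mul_left k (by omega)
          obtain rfl : k = 1 := by omega
          exact hne ⟨rfl, by omega⟩
        · rintro (h | h)
          · omega
          · exact h.2 ⟨rfl, by omega⟩
      by_cases h2 : l = 2
      · subst h2
        rw [h0 2 rfl rfl, if_pos rfl, if_pos (by omega), splitCount_succ]
        simp
      · rw [splitCount_of_not _ (by omega : l ≠ 1 + 1)]
        · simp [h2]
        · rw [admissible_iff (Or.inl hl.2) hr]
          exact not_not.2 ⟨0, by omega, by omega⟩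
  rw [splitCount_eq_sum _ (by omega) (Or.inl ⟨rfl, rfl⟩), Nat.cast_sum, Finset.sum_congr rfl hterm,
    Finset.sum_sub_distrib, Finset.sum_ite_eq' (Finset.Ioo 1 (k * r)) 2,
    if_pos (Finset.mem_Ioo.2 ⟨by omega, by omega⟩), catalanSum_eq r le_rfl (i := 1), hstep, zero_add]

/-- The number of splittings of the base chord in terms of closed walks around the polygon. -/
theorem splitCount_base_eq_sum (hr : 1 ≤ r) (hkr : 3 ≤ k * r) (hne : ¬ (k = 1 ∧ r = 3)) :
    (splitCount (Admissible k r) 1 (k * r) : ℂ) =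
      ∑ m ∈ Finset.range (k * r + 1), (catalan m : ℂ) * (stepWeight r ^ (m + 2)) 0 (k * r) := by
  -- Split off the first step: from `0` it leads to `1` with weight `1`, or to `2` with weight `-1`
  -- if `r ≥ 2`. This is precisely the correction in `splitCount_base`.
  have h1 : ∀ m, (stepWeight r ^ (m + 2)) 0 (k * r) = (stepWeight r ^ (m + 1)) 1 (k * r) -
      if 2 ≤ r then (stepWeight r ^ (m + 1)) 2 (k * r) else 0 := by
    intro m
    have hsub : ({1, 2} : Finset ℕ) ⊆ Finset.Icc 0 (k * r) := by
      intro l hl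
      simp only [Finset.mem_insert, Finset.mem_singleton] at hl
      rw [Finset.mem_Icc]
      omega
    rw [show m + 2 = 1 + (m + 1) by ring, pow_add (stepWeight r) 1 (m + 1), pow_one,
      IncidenceAlgebra.mul_apply, ← Finset.sum_subset hsub]
    · rw [Finset.sum_pair (by norm_num), stepWeight_succ r 0, one_mul, sub_eq_add_neg]
      congr 1
      split_ifs with h
      · rw [stepWeight_of_string r (by norm_num) ⟨0, by omega, by omega⟩]
        simp
      · rw [stepWeight_of_not_string r (by norm_num)]
        · simp
        · rintro ⟨q, hq1, hq2⟩
          rcases Nat.eq_zero_or_pos q with rfl | hq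
          · omega
          · have : 1 * r ≤ q * r := Nat.mul_le_mul_right r hq
            omega
    · intro l _ hl
      simp only [Finset.mem_insert, Finset.mem_singleton] at hl
      rcases Nat.eq_zero_or_pos l with rfl | h
      · rw [stepWeight_of_le r le_rfl, zero_mul]
      · rw [stepWeight_of_gt r (by omega), zero_mul]
  rw [splitCount_base hr hkr hne]
  simp only [h1, mul_sub, Finset.sum_sub_distrib]
  rw [catalanSum]
  congr 1
  split_ifs
  · rw [catalanSum]
  · simp

end count

/-! ### Generating functions of walks -/

/-- The generating function of walks from `0` to `j` by length. -/
def walkSum (r N : ℕ) (y : ℂ) (j : ℕ) : ℂ :=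
  ∑ m ∈ Finset.range N, y ^ m * (stepWeight r ^ m) 0 j

theorem walkSum_zero (r N : ℕ) (y : ℂ) : walkSum r (N + 1) y 0 = 1 := by
  rw [walkSum, Finset.sum_range_succ', Finset.sum_eq_zero]
  · simp
  · intro m _
    rw [stepWeight_pow_apply_eq_zero r _ (by omega), mul_zero]

theorem walkSum_succ (r : ℕ) {N : ℕ} (y : ℂ) {j : ℕ} (hj : j < N) :
    walkSum r (N + 1) y (j + 1) = y * ∑ l ∈ Finset.range (j + 1),
      walkSum r (N + 1) y l * stepWeight r l (j + 1) := by
  -- Splitting off the last step lowers the length by one; the truncation is unaffected because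
  -- walks of length `N` do not end at `l < N`.
  have hw : ∀ l ∈ Finset.range (j + 1), walkSum r (N + 1) y l =
      ∑ m ∈ Finset.range N, y ^ m * (stepWeight r ^ m) 0 l := by
    intro l hl
    rw [Finset.mem_range] at hl
    rw [walkSum, Finset.sum_range_succ, stepWeight_pow_apply_eq_zero r N (by omega), mul_zero,
      add_zero]
  rw [Finset.sum_congr rfl fun l hl => by rw [hw l hl], walkSum, Finset.sum_range_succ']
  have h0 : (stepWeight r ^ 0) 0 (j + 1) = 0 := by simp
  rw [h0, mul_zero, add_zero]
  simp only [Finset.sum_mul]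
  rw [Finset.sum_comm, Finset.mul_sum]
  refine Finset.sum_congr rfl fun m _ => ?_
  rw [pow_succ (stepWeight r), IncidenceAlgebra.mul_apply, Finset.mul_sum, Finset.mul_sum]
  have : Finset.Icc 0 (j + 1) = Finset.range (j + 1 + 1) := by
    ext
    simp only [Finset.mem_Icc, Finset.mem_range]
    omega
  rw [this, Finset.sum_range_succ, stepWeight_of_le r le_rfl, mul_zero, mul_zero, add_zero]
  exact Finset.sum_congr rfl fun l _ => by ring

theorem walkSum_one (r : ℕ) {N : ℕ} (y : ℂ) (hN : 0 < N) :
    walkSum r (N + 1) y 1 = y * walkSum r (N + 1) y 0 := by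
  rw [walkSum_succ r y hN]
  simp [stepWeight_succ r 0]

theorem walkSum_add_two (r : ℕ) {N : ℕ} (y : ℂ) {j : ℕ} (hj : j + 1 < N) :
    walkSum r (N + 1) y (j + 2) = y * (walkSum r (N + 1) y (j + 1) +
      walkSum r (N + 1) y j * stepWeight r j (j + 2)) := by
  rw [walkSum_succ r y hj, Finset.sum_range_succ, Finset.sum_range_succ, Finset.sum_eq_zero,
    stepWeight_succ]
  · ring
  · intro l hl
    rw [Finset.mem_range] at hl
    rw [stepWeight_of_gt r (by omega), mul_zero]

/-- The walks through one string. -/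
def stringFactor (t : ℂ) (a : ℕ) : ℂ :=
  ((1 - t) ^ (a + 1) - t ^ (a + 1)) / ((1 - 2 * t) * (t * (1 - t)) ^ a)

/-- Inside a string the walks satisfy `f (a + 2) = y * (f (a + 1) - f a)` with `y = 1 / (t * (1 -
t))`, whose characteristic roots are `1 / t` and `1 / (1 - t)`. Two consecutive values are carried
along for the induction. -/
theorem walkSum_string {t : ℂ} (h0 : t ≠ 0) (h1 : 1 - t ≠ 0) (h2 : 1 - 2 * t ≠ 0) {r N q : ℕ}
    (hr : 1 ≤ r) (hN : (q + 1) * r ≤ N) : ∀ a, a + 1 ≤ r →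
      walkSum r (N + 1) (1 / (t * (1 - t))) (q * r + a) =
        walkSum r (N + 1) (1 / (t * (1 - t))) (q * r) * stringFactor t a ∧
      walkSum r (N + 1) (1 / (t * (1 - t))) (q * r + (a + 1)) =
        walkSum r (N + 1) (1 / (t * (1 - t))) (q * r) * stringFactor t (a + 1) := by
  have hN' : q * r + r ≤ N := by rwa [add_mul, one_mul] at hN
  have f0 : stringFactor t 0 = 1 := by
    unfold stringFactor
    rw [pow_zero, mul_one, div_eq_one_iff_eq h2]; ring
  have f1 : stringFactor t 1 = 1 / (t * (1 - t)) := by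
    have e : (1 - t) ^ (1 + 1) - t ^ (1 + 1) = 1 - 2 * t := by ring
    rw [stringFactor, e, pow_one, ← div_div, div_self h2]
  have f2 : ∀ a, stringFactor t (a + 2) =
      1 / (t * (1 - t)) * (stringFactor t (a + 1) - stringFactor t a) := by
    intro a
    unfold stringFactor
    field_simp; ring
  intro a
  induction a with
  | zero =>
    intro _
    refine ⟨by rw [f0]; simp, ?_⟩
    rw [zero_add, f1]
    rcases Nat.eq_zero_or_pos (q * r) with hq | hq
    · rw [hq, zero_add, walkSum_one r _ (by omega)]; ring
    · obtain ⟨x, hx⟩ : ∃ x, q * r = x + 1 := ⟨q * r - 1, by omega⟩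
      -- A step of length two across the corner has weight `0`. So the walk starts afresh at each
      -- corner, and the factors of the strings multiply.
      rw [hx, walkSum_add_two r _ (by omega), stepWeight_of_not_string r (by omega)]
      · ring
      · rintro ⟨q', h1, h2⟩
        have h3 : q' < q := by
          by_contra hcon
          have := Nat.mul_le_mul_right r (not_lt.1 hcon)
          omega
        have := Nat.mul_le_mul_right r (show q' + 1 ≤ q from h3)
        omega
  | succ a ih =>
    intro ha
    obtain ⟨ih1, ih2⟩ := ih (by omega)
    refine ⟨ih2, ?_⟩
    rw [show q * r + (a + 1 + 1) = (q * r + a) + 2 by ring, walkSum_add_two r _ (by omega),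
      show q * r + a + 1 = q * r + (a + 1) by ring, ih1, ih2,
      stepWeight_of_string r (by omega) ⟨q, by omega, by rw [add_mul]; omega⟩, if_pos rfl,
      show a + 1 + 1 = a + 2 by ring, f2]
    ring

theorem walkSum_mul {t : ℂ} (h0 : t ≠ 0) (h1 : 1 - t ≠ 0) (h2 : 1 - 2 * t ≠ 0) {r N : ℕ}
    (hr : 1 ≤ r) : ∀ k, k * r ≤ N →
      walkSum r (N + 1) (1 / (t * (1 - t))) (k * r) = stringFactor t r ^ k := by
  intro k
  induction k with
  | zero => intro _; rw [zero_mul, walkSum_zero, pow_zero]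
  | succ k ih =>
    intro hk
    have := (walkSum_string h0 h1 h2 hr hk (r - 1) (by omega)).2
    rw [Nat.sub_add_cancel hr] at this
    rw [show (k + 1) * r = k * r + r by ring, this, ih (by rw [add_mul] at hk; omega), pow_succ]

/-- The integrand as a combination of powers of `1 / (t (1 - t))`. -/
theorem integrand_eq_sum {t : ℂ} (h0 : t ≠ 0) (h1 : 1 - t ≠ 0) (h2 : 1 - 2 * t ≠ 0) {k r : ℕ}
    (hr : 1 ≤ r) (hkr : 3 ≤ k * r) :
    integrand k r t = ∑ m ∈ Finset.range (k * r + 1),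
      (stepWeight r ^ (m + 2)) 0 (k * r) * ((1 - 2 * t) ^ 2 / (t * (1 - t)) ^ (m + 2)) := by
  -- The truncation leaves `k * r + 1` terms once the lengths `0` and `1` are removed; these
  -- contribute nothing, as `k * r ≥ 3` is out of reach.
  have hw := walkSum_mul h0 h1 h2 hr k (show k * r ≤ k * r + 2 by omega)
  rw [walkSum, Finset.sum_range_succ', Finset.sum_range_succ'] at hw
  have e0 : (stepWeight r ^ 0) 0 (k * r) = 0 := by
    rw [pow_zero, IncidenceAlgebra.one_apply, if_neg (by omega)]
  have e1 : (stepWeight r ^ (0 + 1)) 0 (k * r) = 0 := by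
    rw [zero_add, pow_one, stepWeight_of_gt r (by omega)]
  rw [e0, e1, mul_zero, mul_zero, add_zero, add_zero] at hw
  have hsum : ∑ m ∈ Finset.range (k * r + 1),
      (stepWeight r ^ (m + 2)) 0 (k * r) * ((1 - 2 * t) ^ 2 / (t * (1 - t)) ^ (m + 2)) =
      (1 - 2 * t) ^ 2 * stringFactor t r ^ k := by
    rw [← hw, Finset.mul_sum]
    refine Finset.sum_congr rfl fun m _ => ?_
    rw [one_div, inv_pow]
    ring
  rw [hsum, integrand, stringFactor, zpow_sub₀ h2, zpow_natCast, div_pow, mul_pow, ← pow_mul,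
    mul_pow t]
  norm_cast
  field_simp

/-! ### Catalan numbers as contour integrals -/

theorem EncirclesZeroOnce.ne {γ : ℝ → ℂ} (hγ : EncirclesZeroOnce γ) {x : ℝ}
    (hx : x ∈ Set.Icc (0 : ℝ) 1) : γ x ≠ 0 ∧ 1 - γ x ≠ 0 ∧ 1 - 2 * γ x ≠ 0 := by
  obtain ⟨h1, h2⟩ := hγ.2.1 x hx
  refine ⟨norm_pos_iff.1 h1, fun h => ?_, fun h => ?_⟩
  · have : γ x = 1 := by linear_combination -h
    rw [this] at h2
    norm_num at h2
  · have : γ x = 1 / 2 := by linear_combination -h / 2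
    rw [this] at h2
    norm_num at h2

theorem IsContour.intervalIntegrable {γ : ℝ → ℂ} (hγ : IsContour γ) {f : ℂ → ℂ}
    (hf : ContinuousOn (fun x => f (γ x)) (Set.Icc 0 1)) :
    IntervalIntegrable (fun x => f (γ x) * deriv γ x) MeasureTheory.volume 0 1 :=
  hγ.integrable.continuousOn_mul (by rwa [Set.uIcc_of_le zero_le_one])

/-- The contour integral of a derivative vanishes. -/
theorem IsContour.contourIntegral_deriv {γ : ℝ → ℂ} (hγ : IsContour γ) {F f : ℂ → ℂ}
    (hF : ∀ x ∈ Set.Icc (0 : ℝ) 1, HasDerivAt F (f (γ x)) (γ x))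
    (hf : ContinuousOn (fun x => f (γ x)) (Set.Icc 0 1)) : contourIntegral f γ = 0 := by
  obtain ⟨s, hs⟩ := hγ.differentiable
  have hcont : ContinuousOn (fun x => F (γ x)) (Set.Icc 0 1) := fun x hx =>
    (hF x hx).continuousAt.comp_continuousWithinAt (hγ.continuousOn x hx)
  have := MeasureTheory.integral_eq_of_hasDerivAt_off_countable_of_le (fun x => F (γ x))
    (fun x => f (γ x) * deriv γ x) zero_le_one s.countable_toSet hcont
    (fun x hx => (hF x ⟨hx.1.1.le, hx.1.2.le⟩).comp x (hs x hx.1 hx.2).hasDerivAt)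
    (hγ.intervalIntegrable hf)
  rw [contourIntegral, this, hγ.closed, sub_self]

/-- The contour integral of `(t (1 - t))⁻ᵐ`. -/
def centralIntegral (γ : ℝ → ℂ) (m : ℕ) : ℂ := contourIntegral (fun t => 1 / (t * (1 - t)) ^ m) γ

section

variable {γ : ℝ → ℂ}

theorem EncirclesZeroOnce.continuousOn_comp (hγ : EncirclesZeroOnce γ) {f : ℂ → ℂ}
    (hf : ∀ t, t ≠ 0 → 1 - t ≠ 0 → 1 - 2 * t ≠ 0 → ContinuousAt f t) :
    ContinuousOn (fun x => f (γ x)) (Set.Icc 0 1) := fun x hx =>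
  (hf _ (hγ.ne hx).1 (hγ.ne hx).2.1 (hγ.ne hx).2.2).comp_continuousWithinAt
    (hγ.1.continuousOn x hx)

theorem EncirclesZeroOnce.integrable (hγ : EncirclesZeroOnce γ) {f : ℂ → ℂ}
    (hf : ∀ t, t ≠ 0 → 1 - t ≠ 0 → 1 - 2 * t ≠ 0 → ContinuousAt f t) :
    IntervalIntegrable (fun x => f (γ x) * deriv γ x) MeasureTheory.volume 0 1 :=
  hγ.1.intervalIntegrable (hγ.continuousOn_comp hf)

theorem EncirclesZeroOnce.contourIntegral_congr (hγ : EncirclesZeroOnce γ) {f g : ℂ → ℂ}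
    (h : ∀ t, t ≠ 0 → 1 - t ≠ 0 → 1 - 2 * t ≠ 0 → f t = g t) :
    contourIntegral f γ = contourIntegral g γ := by
  refine intervalIntegral.integral_congr fun x hx => ?_
  rw [Set.uIcc_of_le zero_le_one] at hx
  obtain ⟨h0, h1, h2⟩ := hγ.ne hx
  simp only [h _ h0 h1 h2]

theorem continuousAt_one_div_pow (m : ℕ) (t : ℂ) (h0 : t ≠ 0) (h1 : 1 - t ≠ 0) :
    ContinuousAt (fun t : ℂ => 1 / (t * (1 - t)) ^ m) t := by
  have : (t * (1 - t)) ^ m ≠ 0 := pow_ne_zero _ (mul_ne_zero h0 h1)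
  fun_prop (disch := assumption)

theorem continuousAt_sq_div_pow (m : ℕ) (t : ℂ) (h0 : t ≠ 0) (h1 : 1 - t ≠ 0) :
    ContinuousAt (fun t : ℂ => (1 - 2 * t) ^ 2 / (t * (1 - t)) ^ m) t := by
  have : (t * (1 - t)) ^ m ≠ 0 := pow_ne_zero _ (mul_ne_zero h0 h1)
  fun_prop (disch := assumption)

theorem contourIntegral_add {f g : ℂ → ℂ}
    (hf : IntervalIntegrable (fun x => f (γ x) * deriv γ x) MeasureTheory.volume 0 1)
    (hg : IntervalIntegrable (fun x => g (γ x) * deriv γ x) MeasureTheory.volume 0 1) :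
    contourIntegral (fun t => f t + g t) γ = contourIntegral f γ + contourIntegral g γ := by
  simp only [contourIntegral, add_mul]
  exact intervalIntegral.integral_add hf hg

theorem contourIntegral_const_mul (c : ℂ) (f : ℂ → ℂ) :
    contourIntegral (fun t => c * f t) γ = c * contourIntegral f γ := by
  simp only [contourIntegral, mul_assoc]
  exact intervalIntegral.integral_const_mul _ _

/-- Partial fractions: `1 / t` contributes the winding number, and `1 / (1 - t)` has the primitive
`-log (1 - t)`, holomorphic along the contour because `1 - t` has positive real part there. -/
theorem EncirclesZeroOnce.centralIntegral_one (hγ : EncirclesZeroOnce γ) :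
    centralIntegral γ 1 = 2 * Real.pi * Complex.I := by
  have hpi : (2 * Real.pi * Complex.I : ℂ) ≠ 0 := by
    simp [Real.pi_ne_zero, Complex.I_ne_zero]
  have h1 : contourIntegral (fun t => 1 / t) γ = 2 * Real.pi * Complex.I := by
    have := hγ.2.2
    field_simp at this
    linear_combination this
  have c1 : ∀ t : ℂ, t ≠ 0 → 1 - t ≠ 0 → 1 - 2 * t ≠ 0 → ContinuousAt (fun t : ℂ => 1 / t) t := by
    intro t h0 _ _
    fun_prop (disch := assumption)
  have c2 : ∀ t : ℂ, t ≠ 0 → 1 - t ≠ 0 → 1 - 2 * t ≠ 0 →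
      ContinuousAt (fun t : ℂ => 1 / (1 - t)) t := by
    intro t _ h0 _
    fun_prop (disch := assumption)
  have h2 : contourIntegral (fun t => 1 / (1 - t)) γ = 0 := by
    refine hγ.1.contourIntegral_deriv (F := fun t => -Complex.log (1 - t)) ?_
      (hγ.continuousOn_comp c2)
    intro x hx
    have hs : 1 - γ x ∈ Complex.slitPlane := by
      left
      have := (Complex.re_le_norm (γ x)).trans_lt (hγ.2.1 x hx).2
      simp
      linarith
    have := ((hasDerivAt_id (γ x)).const_sub 1).clog hs
    refine this.neg.congr_deriv ?_
    simp [neg_div]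
  rw [centralIntegral, hγ.contourIntegral_congr (g := fun t => 1 / t + 1 / (1 - t)),
    contourIntegral_add (hγ.integrable c1) (hγ.integrable c2), h1, h2, add_zero]
  intro t h0 h1 _
  field_simp
  ring

/-- Integration by parts, applied to `(1 - 2 t) (t (1 - t))⁻ᵐ⁻¹`. -/
theorem EncirclesZeroOnce.integral_by_parts (hγ : EncirclesZeroOnce γ) (m : ℕ) :
    ((m : ℂ) + 1) * contourIntegral (fun t => (1 - 2 * t) ^ 2 / (t * (1 - t)) ^ (m + 2)) γ =
      -2 * centralIntegral γ (m + 1) := by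
  have hd : contourIntegral (fun t => ((m : ℂ) + 1) * ((1 - 2 * t) ^ 2 / (t * (1 - t)) ^ (m + 2)) +
      2 * (1 / (t * (1 - t)) ^ (m + 1))) γ = 0 := by
    refine hγ.1.contourIntegral_deriv (F := fun t => -(1 - 2 * t) / (t * (1 - t)) ^ (m + 1)) ?_
      (hγ.continuousOn_comp (f := fun t => ((m : ℂ) + 1) *
        ((1 - 2 * t) ^ 2 / (t * (1 - t)) ^ (m + 2)) + 2 * (1 / (t * (1 - t)) ^ (m + 1))) ?_)
    · intro x hx
      obtain ⟨h0, h1, -⟩ := hγ.ne hx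
      generalize γ x = t at *
      have e1 : HasDerivAt (fun t : ℂ => -(1 - 2 * t)) 2 t := by
        have := (((hasDerivAt_id t).const_mul 2).const_sub 1).neg
        exact this.congr_deriv (by simp)
      have e2 : HasDerivAt (fun t : ℂ => t * (1 - t)) (1 - 2 * t) t := by
        have := (hasDerivAt_id t).mul ((hasDerivAt_id t).const_sub 1)
        refine this.congr_deriv ?_
        simp; ring
      have hne : (t * (1 - t)) ^ (m + 1) ≠ 0 := pow_ne_zero _ (mul_ne_zero h0 h1)
      refine (e1.div (e2.pow (m + 1)) hne).congr_deriv ?_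
      simp only [Pi.pow_apply, Nat.add_sub_cancel, mul_pow]
      push_cast
      field_simp
      ring
    · intro t h0 h1 _
      have a1 := continuousAt_one_div_pow (m + 1) t h0 h1
      have a2 := continuousAt_sq_div_pow (m + 2) t h0 h1
      exact (continuousAt_const.mul a2).add (continuousAt_const.mul a1)
  rw [contourIntegral_add, contourIntegral_const_mul, contourIntegral_const_mul] at hd
  · rw [centralIntegral]
    linear_combination hd
  · exact hγ.integrable fun t h0 h1 _ => continuousAt_const.mul (continuousAt_sq_div_pow _ t h0 h1)
  · exact hγ.integrable fun t h0 h1 _ => continuousAt_const.mul (continuousAt_one_div_pow _ t h0 h1)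

/-- This is `(1 - 2 * t) ^ 2 = 1 - 4 * (t * (1 - t))`. -/
theorem EncirclesZeroOnce.integral_eq_sub (hγ : EncirclesZeroOnce γ) (m : ℕ) :
    contourIntegral (fun t => (1 - 2 * t) ^ 2 / (t * (1 - t)) ^ (m + 2)) γ =
      centralIntegral γ (m + 2) - 4 * centralIntegral γ (m + 1) := by
  rw [hγ.contourIntegral_congr (g := fun t => 1 / (t * (1 - t)) ^ (m + 2) +
      (-4) * (1 / (t * (1 - t)) ^ (m + 1))), contourIntegral_add, contourIntegral_const_mul,
    centralIntegral, centralIntegral]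
  · ring
  · exact hγ.integrable fun t h0 h1 _ => continuousAt_one_div_pow _ t h0 h1
  · exact hγ.integrable fun t h0 h1 _ => continuousAt_const.mul (continuousAt_one_div_pow _ t h0 h1)
  · intro t h0 h1 _
    field_simp
    ring

/-- Comparing `integral_by_parts` with `integral_eq_sub` yields the recursion of the central
binomial coefficients, so no residue beyond that of `1 / t` is needed. -/
theorem EncirclesZeroOnce.centralIntegral_succ (hγ : EncirclesZeroOnce γ) (m : ℕ) :
    centralIntegral γ (m + 1) = (m.centralBinom : ℂ) * (2 * Real.pi * Complex.I) := by
  induction m with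
  | zero => rw [zero_add, hγ.centralIntegral_one]; simp
  | succ m ih =>
    have h1 := hγ.integral_by_parts m
    rw [hγ.integral_eq_sub m, ih] at h1
    have h2 : ((m : ℂ) + 1) * ((m + 1).centralBinom : ℂ) = 2 * (2 * m + 1) * m.centralBinom := by
      exact_mod_cast Nat.succ_mul_centralBinom_succ m
    have hm : (m : ℂ) + 1 ≠ 0 := Nat.cast_add_one_ne_zero m
    apply mul_left_cancel₀ hm
    linear_combination h1 - (2 * Real.pi * Complex.I) * h2

/-- Catalan numbers as contour integrals. -/
theorem EncirclesZeroOnce.integral_eq_catalan (hγ : EncirclesZeroOnce γ) (m : ℕ) :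
    contourIntegral (fun t => (1 - 2 * t) ^ 2 / (t * (1 - t)) ^ (m + 2)) γ =
      -(4 * Real.pi * Complex.I) * catalan m := by
  have h1 := hγ.integral_by_parts m
  rw [hγ.centralIntegral_succ m] at h1
  have h2 : ((m : ℂ) + 1) * (catalan m : ℂ) = m.centralBinom := by
    exact_mod_cast succ_mul_catalan_eq_centralBinom m
  have hm : (m : ℂ) + 1 ≠ 0 := Nat.cast_add_one_ne_zero m
  apply mul_left_cancel₀ hm
  linear_combination h1 + (4 * Real.pi * Complex.I) * h2

theorem EncirclesZeroOnce.contourIntegral_sum (hγ : EncirclesZeroOnce γ) (c : ℕ → ℂ) (N : ℕ) :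
    contourIntegral (fun t => ∑ m ∈ Finset.range N,
      c m * ((1 - 2 * t) ^ 2 / (t * (1 - t)) ^ (m + 2))) γ =
      -(4 * Real.pi * Complex.I) * ∑ m ∈ Finset.range N, (catalan m : ℂ) * c m := by
  simp only [contourIntegral, Finset.sum_mul]
  rw [intervalIntegral.integral_finsetSum, Finset.mul_sum]
  · refine Finset.sum_congr rfl fun m _ => ?_
    have h1 := hγ.integral_eq_catalan m
    have h2 := contourIntegral_const_mul (γ := γ) (c m)
      fun t => (1 - 2 * t) ^ 2 / (t * (1 - t)) ^ (m + 2)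
    rw [h1] at h2
    rw [contourIntegral] at h2
    rw [h2]; ring
  · exact fun m _ => hγ.integrable fun t h0 h1 _ =>
      continuousAt_const.mul (continuousAt_sq_div_pow _ t h0 h1)

end

/-! ### The integral representation and its symmetry -/

theorem tr_eq_contourIntegral {k r : ℕ} (hk : 1 ≤ k) (hr : 1 ≤ r) (hkr : 3 ≤ k * r)
    (hne : ¬ (k = 1 ∧ r = 3)) {γ : ℝ → ℂ} (hγ : EncirclesZeroOnce γ) :
    (tr k r : ℂ) =
      -(1 / (4 * Real.pi * Complex.I)) * contourIntegral (integrand k r) γ := by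
  rw [hγ.contourIntegral_congr fun t h0 h1 h2 => integrand_eq_sum h0 h1 h2 hr hkr,
    hγ.contourIntegral_sum, tr_eq_splitCount hk hr hkr, splitCount_base_eq_sum hr hkr hne]
  have hpi : (4 * Real.pi * Complex.I : ℂ) ≠ 0 := by
    simp [Real.pi_ne_zero, Complex.I_ne_zero]
  field_simp

/-- The base of the `k`-th power and the factor `1 - 2 * t` both change sign; the exponents `k` and
`k - 2` have the same parity, so the signs cancel. -/
theorem integrand_one_sub (k r : ℕ) (t : ℂ) : integrand k r (1 - t) = integrand k r t := by
  have e1 : (1 - (1 - t)) ^ (r + 1) - (1 - t) ^ (r + 1) =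
      -((1 - t) ^ (r + 1) - t ^ (r + 1)) := by ring
  have e2 : 1 - 2 * (1 - t) = -(1 - 2 * t) := by ring
  have e3 : (1 - t) ^ (r * k) * (1 - (1 - t)) ^ (r * k) = t ^ (r * k) * (1 - t) ^ (r * k) := by
    ring
  rw [integrand, integrand, e1, e2, e3]
  rcases Nat.even_or_odd k with h | h
  · have h' : Even ((k : ℤ) - 2) := ((Int.even_coe_nat k).2 h).sub even_two
    rw [h.neg_pow, h'.neg_zpow]
  · have h' : Odd ((k : ℤ) - 2) := ((Int.odd_coe_nat k).2 h).sub_even even_two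
    rw [h.neg_pow, h'.neg_zpow, mul_neg, neg_div_neg_eq]

end SubdividedPolygon

end

theorem proposition2p1 (k r : ℕ) (hk : 1 ≤ k) (hr : 1 ≤ r) (hrk : 3 ≤ r * k)
    (hne : ¬ (k = 1 ∧ r = 3)) :
    (3 ≤ k → ∀ S : Set SubdividedPolygon.Plane, SubdividedPolygon.IsSC k r S →
      SubdividedPolygon.numTriangulations S = SubdividedPolygon.tr k r) ∧
    (∀ γ : ℝ → ℂ, SubdividedPolygon.EncirclesZeroOnce γ →
      (SubdividedPolygon.tr k r : ℂ) =
        -(1 / (4 * Real.pi * Complex.I)) *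
          SubdividedPolygon.contourIntegral (SubdividedPolygon.integrand k r) γ) ∧
    (∀ t : ℂ, SubdividedPolygon.integrand k r (1 - t) = SubdividedPolygon.integrand k r t) := by
  rw [mul_comm] at hrk
  refine ⟨fun h S hS => ?_, fun γ hγ => ?_, SubdividedPolygon.integrand_one_sub k r⟩
  · rw [SubdividedPolygon.numTriangulations_of_isSC h hr hS,
      SubdividedPolygon.tr_eq_splitCount hk hr hrk]
  · exact SubdividedPolygon.tr_eq_contourIntegral hk hr hrk hne hγ
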